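/- **Setting.** Let $\mathcal S,\mathcal A$ be finite nonempty sets with $S=|\mathcal S|$, $A=|\mathcal A|$. An instance consists of a horizon $H\ge 1$, rewards $r_h(s,a)\in[0,1]$ ($1\le h\le H$), a threshold $\mu_0\in\mathbb R$, a tolerance $\delta\in(0,1)$ (all known to the agent), and an initial distribution $p_0$ on $\mathcal S$ and transition kernels $p_h(\cdot\mid s,a)$, $1\le h\le H$ (unknown to the agent). A policy is $\pi=(\pi_h)_{h=1}^H$ with $\pi_h:\mathcal S\to\mathcal A$. Executing $\pi$ for one episode means $S_1\sim p_0$, $A_h=\pi_h(S_h)$, $S_{h+1}\sim p_h(\cdot\mid S_h,A_h)$, with total reward $\sum_{h=1}^H r_h(S_h,A_h)$, whose expectation is the value $V_0^\pi$. Let $V_0^*=\max_\pi V_0^\pi$. The instance is positive if $V_0^*>\mu_0$ and negative if $V_0^*<\mu_0$. In each episode an algorithm chooses a policy on the basis of the previous episodes and observes the trajectory; after finitely many episodes it may stop and output a policy or $\mathsf{None}$. Let $\tau\le\infty$ be the number of episodes at which it stops, and $\hat\pi$ its output. An algorithm is $\delta$-PAC if $\Pr(\tau<\infty,\ \hat\pi\text{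 is a policy},\ V_0^{\hat\pi}\ge\mu_0)\ge 1-\delta$ on every positive instance and $\Pr(\tau<\infty,\ \hat\pi=\mathsf{None})\ge 1-\delta$ on every negative instance. **Confidence bounds.** Suppose $t$ exploration episodes have been collected. For $1\le h\le H$ let $n_h(s,a)$ be the number of them with $(S_h,A_h)=(s,a)$; let $\hat p_h(s'\mid s,a)$ be the fraction of these with $S_{h+1}=s'$ ($1/S$ if $n_h(s,a)=0$). For the fictitious round $0$ with a single state-action pair let $n_0=t$, and let $\hat p_0(s')$ be the fraction of episodes with $S_1=s'$ ($1/S$ if $t=0$). For $\delta'\in(0,1)$ let $$\beta_p(n,\delta')=\log\frac{2SAH}{\delta'}+(S-1)\log\Big(e\Big(1+\frac n{S-1}\Big)\Big)$$ (the second term is $0$ if $S=1$), and let $\mathcal C_h(s,a;\delta')$ be the set of distributions $q$ on $\mathcal S$ with $\mathrm{KL}(\hat p_h(\cdot\mid s,a),q)\le\beta_p(n_h(s,a),\delta')/n_h(s,a)$ (all distributions if $n_h(s,a)=0$); define $\mathcal C_0(\delta')$ in the same way from $\hat p_0,n_0$. With $\overline V_{H+1}=\underline V_{H+1}=0$ put,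 for $h=H,\dots,1$, $$\overline Q_h(s,a)=r_h(s,a)+\max_{q\in\mathcal C_h(s,a;\delta')}\sum_{s'}q(s')\overline V_{h+1}(s'),\quad \overline V_h(s)=\max_a\overline Q_h(s,a),\quad \overline\pi_h(s)\in\arg\max_a\overline Q_h(s,a),$$ $$\underline V_h(s)=r_h(s,\overline\pi_h(s))+\min_{q\in\mathcal C_h(s,\overline\pi_h(s);\delta')}\sum_{s'}q(s')\underline V_{h+1}(s'),$$ and $\overline V_0=\max_{q\in\mathcal C_0(\delta')}\sum_{s}q(s)\overline V_1(s)$, $\underline V_0=\min_{q\in\mathcal C_0(\delta')}\sum_{s}q(s)\underline V_1(s)$. Ties in the argmax are broken by an arbitrary fixed rule, which may depend on the exploration history, the phase, the round and the state. **Algorithm BEE-GPI.** Let $C=1.01$, $\epsilon_k=2^{-k}$, $\delta_k=3^{-k}$, $\alpha_k=5^k$, $$T_k^{ee}=\frac{(H+1)^2SA\log(2SAH/\delta_k)}{\epsilon_k}+\frac{(H+1)^2S^2A}{\epsilon_k}\log\Big(\frac{(H+1)^2S^2A\log(2SAH/\delta_k)}{\epsilon_k}\Big),$$ $$T_k^{et}=\frac{100}{\epsilon_k}\Big(\log\frac{\alpha_k}{\delta}+\log\log\frac{24H^2}{\epsilon_k}\Big).$$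 Start with an empty exploration history. In phase $k=1,2,\dots$: 1. *Explore.* All quantities above are computed from the $t$ episodes of the current exploration history with $\delta'=\delta_k$. As long as neither (P) $\underline V_0-(C-1)(\overline V_0-\underline V_0)>\mu_0$ nor (N) $\overline V_0<\mu_0$ holds and $t\le T_k^{ee}-1$, execute $\overline\pi$ for one episode and add it to the exploration history. When this loop ends: if (P) holds, go to step 2 with the candidate $\hat\pi_k=\overline\pi$; otherwise, if (N) holds, stop with output $\mathsf{None}$ if $\delta_k<\delta/10$ and go to phase $k+1$ if $\delta_k\ge\delta/10$; otherwise go to phase $k+1$. 2. *Exploit.* Set $N=0$. While $N\le T_k^{et}-1$, execute $\hat\pi_k$ for one new episode, observe its total reward $X_{N+1}$, increase $N$ by $1$, and stop with output $\hat\pi_k$ if $$\frac1N\sum_{i=1}^NX_i-\sqrt{\frac{H^2\log\big(2\alpha_k(\log_2 2N)^2/\delta\big)}{N}}\ \ge\ \mu_0 .$$ If the loop ends without output, go to phase $k+1$. (Exploitation episodes are not added to the exploration history.) **Theorem.** BEE-GPI is $\delta$-PAC, and it stops almost surely on every positive and on every negative instance. That is, on every positive instance $\tau<\infty$ almost surely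 and, with probability at least $1-\delta$, the output is a policy $\hat\pi$ with $V_0^{\hat\pi}\ge\mu_0$; on every negative instance $\tau<\infty$ almost surely and the output is $\mathsf{None}$ with probability at least $1-\delta$. -/

import Mathlib

universe u v w

open MeasureTheory

namespace GPI

/-! ## Episodic Markov decision processes and the good policy identification problem

Rounds `1, …, H` are indexed by `Fin H` (the index `h` is round `h + 1`), the rounds `1, …, H + 1`
of the visited states by `Fin (H + 1)`. -/

/-- Deterministic policies: one map from states to actions per round. -/
abbrev Policy (S : Type u) (A : Type v) (H : ℕ) := Fin H → S → A

/-- What is observed in one episode: the states `S_1, …, S_{H+1}` and the actions `A_1, …, A_H`.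
The rewards are a known function of these; the fictitious round `0` carries no information. -/
abbrev Episode (S : Type u) (A : Type v) (H : ℕ) := (Fin (H + 1) → S) × (Fin H → A)

/-- The part of an instance that is known to the agent: horizon, rewards, threshold, and error
tolerance (besides the state and action spaces). -/
structure Task (S : Type u) (A : Type v) where
  /-- horizon -/
  H : ℕ
  H_pos : 0 < H
  /-- deterministic rewards -/
  r : Fin H → S → A → ℝ
  r_nonneg : ∀ h s a, 0 ≤ r h s a
  r_le_one : ∀ h s a, r h s a ≤ 1
  /-- threshold -/
  μ₀ : ℝ
  /-- error tolerance -/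
  δ : ℝ
  δ_pos : 0 < δ
  δ_lt_one : δ < 1

/-- The part of an instance that is unknown to the agent: the initial distribution (that is, the
transition out of the fictitious round `0`) and the transition kernels. -/
structure Dynamics (S : Type u) (A : Type v) [Fintype S] (H : ℕ) where
  init : S → ℝ
  init_mem : init ∈ stdSimplex ℝ S
  P : Fin H → S → A → S → ℝ
  P_mem : ∀ h s a, P h s a ∈ stdSimplex ℝ S

section Values

variable {S : Type u} {A : Type v} [Fintype S]

/-- `V_{h+1}^π(s)`: expected total reward of `π` from round `h + 1` to the end. -/
noncomputable def valueFrom (T : Task S A) (D : Dynamics S A T.H) (π : Policy S A T.H)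
    (h : ℕ) (s : S) : ℝ :=
  if hh : h < T.H then
    T.r ⟨h, hh⟩ s (π ⟨h, hh⟩ s)
      + ∑ s', D.P ⟨h, hh⟩ s (π ⟨h, hh⟩ s) s' * valueFrom T D π (h + 1) s'
  else 0
termination_by T.H - h

/-- `V_0^π(s_0)`: expected total reward of `π` in an episode. -/
noncomputable def value (T : Task S A) (D : Dynamics S A T.H) (π : Policy S A T.H) : ℝ :=
  ∑ s, D.init s * valueFrom T D π 0 s

open Classical in
/-- `V_0^*(s_0)`: the largest value of a deterministic policy. -/
noncomputable def optValue [Fintype A] [Nonempty A] (T : Task S A) (D : Dynamics S A T.H) : ℝ :=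
  Finset.univ.sup' Finset.univ_nonempty (fun π : Policy S A T.H => value T D π)

/-- Positive instances. -/
def IsPositive [Fintype A] [Nonempty A] (T : Task S A) (D : Dynamics S A T.H) : Prop :=
  T.μ₀ < optValue T D

/-- Negative instances. -/
def IsNegative [Fintype A] [Nonempty A] (T : Task S A) (D : Dynamics S A T.H) : Prop :=
  optValue T D < T.μ₀

open Classical in
/-- The probability that executing `π` for one episode produces `z`. -/
noncomputable def episodeProb {H : ℕ} (D : Dynamics S A H) (π : Policy S A H)
    (z : Episode S A H) : ℝ :=
  D.init (z.1 0) * ∏ h : Fin H,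
    (if z.2 h = π h (z.1 h.castSucc) then D.P h (z.1 h.castSucc) (z.2 h) (z.1 h.succ) else 0)

end Values

/-- Total reward of an episode. -/
noncomputable def totalReward {S : Type u} {A : Type v} (T : Task S A) (z : Episode S A T.H) : ℝ :=
  ∑ h, T.r h (z.1 h.castSucc) (z.2 h)

/-! ## Algorithms and their runs -/

/-- What an algorithm does between two episodes: execute a policy for one more episode, or stop
with an answer (`none` is the answer `None`). -/
inductive Decision (S : Type u) (A : Type v) (H : ℕ)
  | sample (π : Policy S A H)
  | halt (ans : Option (Policy S A H))

/-- A sampling rule, a stopping rule and a recommendation rule, as functions of the episodes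
observed so far (in chronological order). -/
abbrev Strategy (S : Type u) (A : Type v) (H : ℕ) := List (Episode S A H) → Decision S A H

section Runs

variable {S : Type u} {A : Type v} {H : ℕ} {Ω : Type w}

/-- The first `n` episodes. -/
def history (Z : ℕ → Ω → Episode S A H) (n : ℕ) (ω : Ω) : List (Episode S A H) :=
  (List.range n).map (fun i => Z i ω)

/-- `Z` is a sequence of episodes generated by running `alg`: conditionally on the past `d`, as
long as the algorithm samples, the next episode has the law of the policy chosen on `d`. (What `Z`
is after the algorithm has stopped is immaterial.) -/
structure IsRun [Fintype S] [MeasurableSpace Ω] (alg : Strategy S A H) (D : Dynamics S A H)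
    (ℙ : Measure Ω) (Z : ℕ → Ω → Episode S A H) : Prop where
  measurableSet_eq : ∀ n z, MeasurableSet {ω | Z n ω = z}
  law : ∀ (n : ℕ) (d : List (Episode S A H)) (π : Policy S A H) (z : Episode S A H),
    d.length = n → alg d = Decision.sample π →
      ℙ.real {ω | history Z n ω = d ∧ Z n ω = z}
        = episodeProb D π z * ℙ.real {ω | history Z n ω = d}

/-- On the outcome `ω` the algorithm stops, at the end of some finite number `n = τ` of episodes,
and its output is `ans`. -/
def Outputs (alg : Strategy S A H) (Z : ℕ → Ω → Episode S A H) (ω : Ω)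
    (ans : Option (Policy S A H)) : Prop :=
  ∃ n, alg (history Z n ω) = Decision.halt ans ∧
    ∀ m < n, ∃ π, alg (history Z m ω) = Decision.sample π

/-- The event `τ < ∞`. -/
def Stops (alg : Strategy S A H) (Z : ℕ → Ω → Episode S A H) (ω : Ω) : Prop :=
  ∃ ans, Outputs alg Z ω ans

end Runs

/-- `δ`-PAC algorithms (`δ` is a component of the task). The algorithm has access to the task only,
the guarantee is for all dynamics. -/
def IsDeltaPAC {S : Type u} {A : Type v} [Fintype S] [Fintype A] [Nonempty A]
    (alg : (T : Task S A) → Strategy S A T.H) : Prop :=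
  ∀ (T : Task S A) (D : Dynamics S A T.H) (Ω : Type w) [MeasurableSpace Ω]
    (ℙ : Measure Ω) [IsProbabilityMeasure ℙ] (Z : ℕ → Ω → Episode S A T.H),
    IsRun (alg T) D ℙ Z →
      (IsPositive T D →
        1 - T.δ ≤ ℙ.real {ω | ∃ π, Outputs (alg T) Z ω (some π) ∧ T.μ₀ ≤ value T D π}) ∧
      (IsNegative T D → 1 - T.δ ≤ ℙ.real {ω | Outputs (alg T) Z ω none})

/-! ## The exploration oracle ES-BPI-UCRL -/

/-- A rule which picks a maximizer of a function on the actions. The choice among several maximizers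
may depend on the exploration history, the phase, the round and the state. -/
structure ArgmaxRule (S : Type u) (A : Type v) (H : ℕ) where
  choose : List (Episode S A H) → ℕ → Fin H → S → (A → ℝ) → A
  le_choose : ∀ (d : List (Episode S A H)) (k : ℕ) (h : Fin H) (s : S) (f : A → ℝ) (a : A),
    f a ≤ f (choose d k h s f)

/-- `ε_k` -/
noncomputable def epsK (k : ℕ) : ℝ := 1 / 2 ^ k
/-- `δ_k` -/
noncomputable def deltaK (k : ℕ) : ℝ := 1 / 3 ^ k
/-- `α_k` -/
noncomputable def alphaK (k : ℕ) : ℝ := 5 ^ k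
/-- The tuning constant `C`. -/
noncomputable def tuningC : ℝ := 1.01

section Counts

variable {S : Type u} {A : Type v} {H : ℕ}

open Classical in
/-- `n_h^t(s, a)`, where `d` consists of `t` episodes. -/
noncomputable def visits (d : List (Episode S A H)) (h : Fin H) (s : S) (a : A) : ℕ :=
  d.countP (fun z => z.1 h.castSucc = s ∧ z.2 h = a)

open Classical in
/-- Empirical transition kernel. -/
noncomputable def pHat [Fintype S] (d : List (Episode S A H)) (h : Fin H) (s : S) (a : A)
    (s' : S) : ℝ :=
  if 0 < visits d h s a then
    (d.countP (fun z => z.1 h.castSucc = s ∧ z.2 h = a ∧ z.1 h.succ = s') : ℝ) / visits d h s a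
  else 1 / Fintype.card S

open Classical in
/-- Empirical transition out of the fictitious round `0`, whose pair `(s_0, a_0)` is visited once
in each episode. -/
noncomputable def pHatInit [Fintype S] (d : List (Episode S A H)) (s' : S) : ℝ :=
  if 0 < d.length then (d.countP (fun z => z.1 0 = s') : ℝ) / d.length
  else 1 / Fintype.card S

end Counts

section Expectations

variable {S : Type u} [Fintype S]

open Classical in
/-- Kullback–Leibler divergence between distributions on a finite set. -/
noncomputable def finKL (p q : S → ℝ) : EReal :=
  if ∀ s, q s = 0 → p s = 0 then ((∑ s, p s * Real.log (p s / q s) : ℝ) : EReal) else ⊤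

/-- `max_{q ∈ 𝒞} ∑ q(s) V(s)`; attained on the confidence sets, which are compact and nonempty. -/
noncomputable def maxExp (𝒞 : Set (S → ℝ)) (V : S → ℝ) : ℝ :=
  sSup ((fun q : S → ℝ => ∑ s, q s * V s) '' 𝒞)

/-- `min_{q ∈ 𝒞} ∑ q(s) V(s)` -/
noncomputable def minExp (𝒞 : Set (S → ℝ)) (V : S → ℝ) : ℝ :=
  sInf ((fun q : S → ℝ => ∑ s, q s * V s) '' 𝒞)

end Expectations

section Oracle

variable {S : Type u} {A : Type v} [Fintype S] [Fintype A]

/-- The exploration bonus `β_p(n, δ')`. For `S = 1` its second summand is `0`. -/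
noncomputable def betaP (T : Task S A) (n : ℕ) (δ' : ℝ) : ℝ :=
  Real.log (2 * Fintype.card S * Fintype.card A * T.H / δ')
    + ((Fintype.card S : ℝ) - 1)
      * Real.log (Real.exp 1 * (1 + (n : ℝ) / ((Fintype.card S : ℝ) - 1)))

/-- Confidence set around an empirical distribution `p` of `n` samples; as long as there is no
sample (`β_p / n = ∞`) it is the whole simplex. -/
noncomputable def confSet (T : Task S A) (δ' : ℝ) (n : ℕ) (p : S → ℝ) : Set (S → ℝ) :=
  {q | q ∈ stdSimplex ℝ S ∧ (n = 0 ∨ finKL p q ≤ ((betaP T n δ' / n : ℝ) : EReal))}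

/-- `𝒞_h^t(s, a; δ')` -/
noncomputable def confTrans (T : Task S A) (d : List (Episode S A T.H)) (δ' : ℝ) (h : Fin T.H)
    (s : S) (a : A) : Set (S → ℝ) :=
  confSet T δ' (visits d h s a) (pHat d h s a)

/-- `𝒞_0^t(s_0, a_0; δ')` -/
noncomputable def confInit (T : Task S A) (d : List (Episode S A T.H)) (δ' : ℝ) : Set (S → ℝ) :=
  confSet T δ' d.length (pHatInit d)

/-- One step of optimistic backward induction: the optimistic action values in the round with
index `h`, given the optimistic values `V` of the next round. -/
noncomputable def optimisticQ (T : Task S A) (d : List (Episode S A T.H)) (δ' : ℝ)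
    (V : S → ℝ) (h : Fin T.H) (s : S) (a : A) : ℝ :=
  T.r h s a + maxExp (confTrans T d δ' h s a) V

/-- The optimistic value function of round `h + 1` (of index `h`). -/
noncomputable def optimisticV [Nonempty A] (T : Task S A) (d : List (Episode S A T.H)) (δ' : ℝ)
    (h : ℕ) (s : S) : ℝ :=
  if hh : h < T.H then
    Finset.univ.sup' Finset.univ_nonempty
      (optimisticQ T d δ' (fun s' => optimisticV T d δ' (h + 1) s') ⟨h, hh⟩ s)
  else 0
termination_by T.H - h

/-- The optimistic value of the fictitious round `0`. -/
noncomputable def optimisticV0 [Nonempty A] (T : Task S A) (d : List (Episode S A T.H))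
    (δ' : ℝ) : ℝ :=
  maxExp (confInit T d δ') (optimisticV T d δ' 0)

/-- The optimistic policy `π̄^t(·; δ_k)`. -/
noncomputable def optimisticPolicy [Nonempty A] (T : Task S A) (tie : ArgmaxRule S A T.H) (k : ℕ)
    (d : List (Episode S A T.H)) : Policy S A T.H :=
  fun h s => tie.choose d k h s
    (optimisticQ T d (deltaK k) (optimisticV T d (deltaK k) (h + 1)) h s)

/-- The lower confidence bound on `V_{h+1}^π`. -/
noncomputable def pessimisticV (T : Task S A) (d : List (Episode S A T.H)) (δ' : ℝ)
    (π : Policy S A T.H) (h : ℕ) (s : S) : ℝ :=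
  if hh : h < T.H then
    T.r ⟨h, hh⟩ s (π ⟨h, hh⟩ s)
      + minExp (confTrans T d δ' ⟨h, hh⟩ s (π ⟨h, hh⟩ s))
          (fun s' => pessimisticV T d δ' π (h + 1) s')
  else 0
termination_by T.H - h

/-- The lower confidence bound on `V_0^π`. -/
noncomputable def pessimisticV0 (T : Task S A) (d : List (Episode S A T.H)) (δ' : ℝ)
    (π : Policy S A T.H) : ℝ :=
  minExp (confInit T d δ') (pessimisticV T d δ' π 0)

/-- The positive stopping criterion in phase `k` with exploration history `d`. -/
def PosCrit [Nonempty A] (T : Task S A) (tie : ArgmaxRule S A T.H) (k : ℕ)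
    (d : List (Episode S A T.H)) : Prop :=
  pessimisticV0 T d (deltaK k) (optimisticPolicy T tie k d)
    - (tuningC - 1) * (optimisticV0 T d (deltaK k)
        - pessimisticV0 T d (deltaK k) (optimisticPolicy T tie k d)) > T.μ₀

/-- The negative stopping criterion in phase `k` with exploration history `d`. -/
def NegCrit [Nonempty A] (T : Task S A) (k : ℕ) (d : List (Episode S A T.H)) : Prop :=
  optimisticV0 T d (deltaK k) < T.μ₀

/-- The budget `T_k^ee` on the total number of exploration episodes. -/
noncomputable def exploreBudget (T : Task S A) (k : ℕ) : ℝ :=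
  ((T.H : ℝ) + 1) ^ 2 * Fintype.card S * Fintype.card A
      * Real.log (2 * Fintype.card S * Fintype.card A * T.H / deltaK k) / epsK k
    + ((T.H : ℝ) + 1) ^ 2 * (Fintype.card S : ℝ) ^ 2 * Fintype.card A / epsK k
      * Real.log (((T.H : ℝ) + 1) ^ 2 * (Fintype.card S : ℝ) ^ 2 * Fintype.card A
          * Real.log (2 * Fintype.card S * Fintype.card A * T.H / deltaK k) / epsK k)

end Oracle

/-! ## BEE-GPI -/

section BEE

variable {S : Type u} {A : Type v}

/-- The budget `T_k^et` on the number of exploitation episodes of phase `k`. -/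
noncomputable def exploitBudget (T : Task S A) (k : ℕ) : ℝ :=
  100 * ((Real.log (alphaK k / T.δ) + Real.log (Real.log (24 * (T.H : ℝ) ^ 2 / epsK k))) / epsK k)

/-- The test of the exploitation stage of phase `k`, where `X` is the list of the `N` total rewards
collected in this stage. -/
def ExploitPass (T : Task S A) (k : ℕ) (X : List ℝ) : Prop :=
  X.sum / X.length
    - Real.sqrt ((T.H : ℝ) ^ 2
        * Real.log (2 * alphaK k * (Real.logb 2 (2 * X.length)) ^ 2 / T.δ) / X.length) ≥ T.μ₀

/-- Memory of BEE-GPI while it waits for an episode, or after it has terminated: in the exploration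
stage of phase `k` with exploration history `d`; in the exploitation stage of phase `k` with
exploration history `d`, candidate policy `π` and total rewards `X` collected in this stage;
terminated with output `ans`. -/
inductive BEEState (S : Type u) (A : Type v) (H : ℕ)
  | exploring (k : ℕ) (d : List (Episode S A H))
  | exploiting (k : ℕ) (d : List (Episode S A H)) (π : Policy S A H) (X : List ℝ)
  | finished (ans : Option (Policy S A H))

theorem log_ratio_ge [Fintype S] [Fintype A] [Nonempty S] [Nonempty A] (T : Task S A) (k : ℕ) :
    1 / 2 ≤ Real.log (2 * Fintype.card S * Fintype.card A * T.H / deltaK k) := by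
  have hS : (1 : ℝ) ≤ Fintype.card S := by exact_mod_cast Fintype.card_pos
  have hA : (1 : ℝ) ≤ Fintype.card A := by exact_mod_cast Fintype.card_pos
  have hH : (1 : ℝ) ≤ T.H := by exact_mod_cast T.H_pos
  have h3 : (1 : ℝ) ≤ 3 ^ k := one_le_pow₀ (by norm_num)
  have h1 : (2 : ℝ) ≤ 2 * Fintype.card S * Fintype.card A * T.H / deltaK k := by
    have e1 : (1 : ℝ) ≤ (Fintype.card S : ℝ) * Fintype.card A := one_le_mul_of_one_le_of_one_le hS hA
    have e2 := one_le_mul_of_one_le_of_one_le e1 hH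
    have e3 := one_le_mul_of_one_le_of_one_le e2 h3
    rw [deltaK, div_div_eq_mul_div, div_one]
    linarith
  have := Real.log_two_gt_d9
  have := Real.log_le_log (by norm_num) h1
  linarith

/-- The exploration budgets tend to infinity. -/
theorem le_exploreBudget [Fintype S] [Fintype A] [Nonempty S] [Nonempty A] (T : Task S A)
    (k : ℕ) : (k : ℝ) + 1 ≤ exploreBudget T k := by
  have hS : (1 : ℝ) ≤ Fintype.card S := by exact_mod_cast Fintype.card_pos
  have hA : (1 : ℝ) ≤ Fintype.card A := by exact_mod_cast Fintype.card_pos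
  have hH : (1 : ℝ) ≤ T.H := by exact_mod_cast T.H_pos
  have h2 : (k : ℝ) + 1 ≤ 2 ^ k := by exact_mod_cast Nat.lt_two_pow_self (n := k)
  have hL := log_ratio_ge T k
  unfold exploreBudget
  set L := Real.log (2 * Fintype.card S * Fintype.card A * T.H / deltaK k)
  have hHH : (4 : ℝ) ≤ ((T.H : ℝ) + 1) ^ 2 := by nlinarith
  have hc1 : (4 : ℝ) ≤ ((T.H : ℝ) + 1) ^ 2 * Fintype.card S * Fintype.card A := by
    have e1 := one_le_mul_of_one_le_of_one_le hS hA
    nlinarith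
  have hc2 : (4 : ℝ) ≤ ((T.H : ℝ) + 1) ^ 2 * (Fintype.card S : ℝ) ^ 2 * Fintype.card A := by
    have e1 := one_le_mul_of_one_le_of_one_le (one_le_mul_of_one_le_of_one_le hS hS) hA
    nlinarith
  set c₁ := ((T.H : ℝ) + 1) ^ 2 * Fintype.card S * Fintype.card A
  set c₂ := ((T.H : ℝ) + 1) ^ 2 * (Fintype.card S : ℝ) ^ 2 * Fintype.card A
  have hk : (0 : ℝ) ≤ k := Nat.cast_nonneg k
  simp only [epsK, div_div_eq_mul_div, div_one]
  have f1 : (2 : ℝ) ≤ c₁ * L := by nlinarith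
  have f2 : (2 : ℝ) ≤ c₂ * L := by nlinarith
  have f3 : (1 : ℝ) ≤ c₂ * L * 2 ^ k := by nlinarith
  have f4 := Real.log_nonneg f3
  have f5 : 0 ≤ c₂ * 2 ^ k * Real.log (c₂ * L * 2 ^ k) := by positivity
  nlinarith

/-- At least one exploitation episode fits into the budget. -/
theorem one_le_exploitBudget (T : Task S A) (k : ℕ) : 1 ≤ exploitBudget T k := by
  have hH : (1 : ℝ) ≤ T.H := by exact_mod_cast T.H_pos
  have h2 : (1 : ℝ) ≤ 2 ^ k := one_le_pow₀ (by norm_num)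
  have h5 : (1 : ℝ) ≤ 5 ^ k := one_le_pow₀ (by norm_num)
  have hδ := T.δ_pos
  have hδ1 := T.δ_lt_one
  have g1 : 0 ≤ Real.log (alphaK k / T.δ) := by
    apply Real.log_nonneg
    rw [alphaK, le_div_iff₀ hδ]
    linarith
  have g2 : (24 : ℝ) ≤ 24 * (T.H : ℝ) ^ 2 / epsK k := by
    rw [epsK, div_div_eq_mul_div, div_one]
    have := one_le_mul_of_one_le_of_one_le (one_le_mul_of_one_le_of_one_le hH hH) h2
    nlinarith
  have g3 : (5 / 2 : ℝ) ≤ Real.log (24 * (T.H : ℝ) ^ 2 / epsK k) := by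
    have e0 := Real.log_two_gt_d9
    have e1 : Real.log 16 = 4 * Real.log 2 := by
      rw [show (16 : ℝ) = 2 ^ 4 by norm_num, Real.log_pow]; norm_num
    have e2 := Real.log_le_log (by norm_num) (show (16 : ℝ) ≤ 24 * (T.H : ℝ) ^ 2 / epsK k by linarith)
    linarith
  have g4 : (1 / 2 : ℝ) ≤ Real.log (Real.log (24 * (T.H : ℝ) ^ 2 / epsK k)) := by
    have e0 := Real.log_two_gt_d9
    have e2 := Real.log_le_log (by norm_num)
      (show (2 : ℝ) ≤ Real.log (24 * (T.H : ℝ) ^ 2 / epsK k) by linarith)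
    linarith
  rw [exploitBudget, epsK, div_div_eq_mul_div, div_one]
  rw [epsK] at g4
  nlinarith

theorem lt_of_deltaK_ge (T : Task S A) (k : ℕ) (h : T.δ / 10 ≤ deltaK k) :
    k < ⌈10 / T.δ⌉₊ := by
  have hδ := T.δ_pos
  have h3 : (k : ℝ) < 3 ^ k := by exact_mod_cast Nat.lt_pow_self (by norm_num : 1 < 3)
  have hp : (0 : ℝ) < 3 ^ k := by positivity
  have : (3 : ℝ) ^ k ≤ 10 / T.δ := by
    rw [deltaK, le_div_iff₀ hp] at h
    rw [le_div_iff₀ hδ]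
    linarith
  exact Nat.lt_ceil.2 (h3.trans_le this)

open Classical in
/-- BEE-GPI runs in the exploration stage of phase `k` with exploration history `d` until it needs
a further episode or terminates. As long as no criterion of the oracle holds, exploration goes on;
else the output of the oracle leads to the exploitation stage of phase `k`, to termination with
`None`, or to phase `k + 1`. -/
noncomputable def explore [Fintype S] [Fintype A] [Nonempty S] [Nonempty A]
    (T : Task S A) (tie : ArgmaxRule S A T.H) (k : ℕ)
    (d : List (Episode S A T.H)) : BEEState S A T.H :=
  if _h₁ : ¬ PosCrit T tie k d ∧ ¬ NegCrit T k d ∧ (d.length : ℝ) ≤ exploreBudget T k - 1 then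
    .exploring k d
  else if _h₂ : PosCrit T tie k d then
    -- candidate policy, exploitation starts with `N = 0`
    if _h₃ : (0 : ℝ) ≤ exploitBudget T k - 1 then
      .exploiting k d (optimisticPolicy T tie k d) []
    else explore T tie (k + 1) d
  else if _h₄ : NegCrit T k d then
    if _h₅ : deltaK k ≥ T.δ / 10 then explore T tie (k + 1) d
    else .finished none
  else
    -- not completed
    explore T tie (k + 1) d
termination_by ⌈10 / T.δ⌉₊ + d.length + 1 - k
decreasing_by
  · exact absurd (sub_nonneg.2 (one_le_exploitBudget T k)) _h₃
  · have := lt_of_deltaK_ge T k _h₅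
    omega
  · have h6 : ¬ (d.length : ℝ) ≤ exploreBudget T k - 1 := fun h => _h₁ ⟨_h₂, _h₄, h⟩
    have h7 := le_exploreBudget T k
    have h8 : k < d.length := by
      have : (k : ℝ) < d.length := by linarith
      exact_mod_cast this
    omega

open Classical in
/-- Update of the memory by a new episode `z`, which was generated by the policy of `nextDecision`. -/
noncomputable def update [Fintype S] [Fintype A] [Nonempty S] [Nonempty A]
    (T : Task S A) (tie : ArgmaxRule S A T.H) :
    BEEState S A T.H → Episode S A T.H → BEEState S A T.H
  | .exploring k d, z => explore T tie k (d ++ [z])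
  | .exploiting k d π X, z =>
      if ExploitPass T k (X ++ [totalReward T z]) then .finished (some π)
      else if ((X ++ [totalReward T z]).length : ℝ) ≤ exploitBudget T k - 1 then
        .exploiting k d π (X ++ [totalReward T z])
      else explore T tie (k + 1) d
  | .finished ans, _ => .finished ans

/-- The next action of BEE-GPI: exploration executes the optimistic policy, exploitation the
candidate policy. -/
noncomputable def nextDecision [Fintype S] [Fintype A] [Nonempty A]
    (T : Task S A) (tie : ArgmaxRule S A T.H) :
    BEEState S A T.H → Decision S A T.H
  | .exploring k d => .sample (optimisticPolicy T tie k d)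
  | .exploiting _ _ π _ => .sample π
  | .finished ans => .halt ans

/-- The algorithm BEE-GPI; it starts in phase `1` with empty exploration history. -/
noncomputable def beeGPI [Fintype S] [Fintype A] [Nonempty S] [Nonempty A]
    (T : Task S A) (tie : ArgmaxRule S A T.H) : Strategy S A T.H :=
  fun hist => nextDecision T tie (hist.foldl (update T tie) (explore T tie 1 []))

end BEE

end GPI

/-!
BEE-GPI is correct because two kinds of events are rare, and it terminates because, phase by phase,
the probability of these events and of exhausting a budget tends to `0`.

All probabilities come from one maximal inequality (`measureReal_exists_le`) for the state machine
that runs the algorithm: if a nonnegative potential `G` of its memory does not increase in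
expectation by an episode, where it counts as `c` when a transition of a given kind occurs, then
such a transition ever occurs with probability at most `G s₀ / c`. It is proved by induction along
the tree of histories and needs nothing of a run but the law of the next episode. It is applied
with four potentials.

* The likelihood ratio between Laplace's rule of succession and the true law of the next states
  (`laplaceRatio`). Since it is at least `exp (n KL(p̂, p))` divided by the number of possible
  counts, it yields that in phase `k` all confidence sets contain the true laws, for all
  exploration histories at once, with probability at least `1 - δ_k` (`ReliableRun`,
  `measureReal_not_reliable_le`). On reliable histories the upper and lower confidence bounds are
  bounds for the values.
* The exponential supermartingale of the total rewards, with Hoeffding's lemma for a single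
  episode. With a union bound over dyadic ranges of the number of rewards, the exploitation stage
  of phase `k` accepts a policy of value less than `μ₀` with probability at most `δ / α_k`.
* The squared deviation of the rewards of a candidate, compensated by its variance bound: a
  candidate whose value exceeds `μ₀` by a fixed amount passes one of the tests of a late phase.
* The sum of the bonuses `1 / √(n + 1)` over all visits. The width of the confidence interval is at
  most a factor of order `√β` times the bonuses collected in expectation by the next episode
  (`width_le`), and the sum of all bonuses in `t` episodes is of order `√t`. The budgets at least
  double from one phase to the next, so a phase that exhausts its budget while the intervals
  stay wide would collect bonuses of larger order than `√t`.

A wrong `None` needs an unreliable history in a phase with `δ_k < δ / 10`, which has probability at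
most `∑ δ_k ≤ δ / 2`; a wrong policy has probability at most `∑ δ / α_k = δ / 4`. The gap between
`V*` and `μ₀` bounds the width from below as long as no criterion holds, and separates the value of
each candidate from `μ₀`. Since a run without termination passes through all phases, and from some
phase on an unreliable history or an exhausted budget is needed for that, it has probability `0`.
-/

set_option linter.unusedSectionVars false

namespace GPI

/-! ### The law of an episode -/

section EpisodeLaw

variable {S : Type u} {A : Type v} [Fintype S] [Fintype A]

/-- Expectation of `F` over the episode produced by executing `π`. -/
noncomputable def expect {H : ℕ} (D : Dynamics S A H) (π : Policy S A H)
    (F : Episode S A H → ℝ) : ℝ :=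
  ∑ z, episodeProb D π z * F z

/-- The dynamics of the rounds after the first one, given the first state and action. -/
noncomputable def Dynamics.tail {H : ℕ} (D : Dynamics S A (H + 1)) (s : S) (a : A) :
    Dynamics S A H where
  init := D.P 0 s a
  init_mem := D.P_mem 0 s a
  P h := D.P h.succ
  P_mem h := D.P_mem h.succ

theorem episodeProb_nonneg {H : ℕ} (D : Dynamics S A H) (π : Policy S A H)
    (z : Episode S A H) : 0 ≤ episodeProb D π z := by
  unfold episodeProb
  refine mul_nonneg (D.init_mem.1 _) (Finset.prod_nonneg fun h _ => ?_)
  split_ifs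
  · exact (D.P_mem _ _ _).1 _
  · exact le_rfl

theorem action_eq_of_episodeProb_ne_zero {H : ℕ} {D : Dynamics S A H} {π : Policy S A H}
    {z : Episode S A H} (hz : episodeProb D π z ≠ 0) (h : Fin H) :
    z.2 h = π h (z.1 h.castSucc) := by
  by_contra hne
  apply hz
  unfold episodeProb
  rw [Finset.prod_eq_zero (Finset.mem_univ h) (by rw [if_neg hne]), mul_zero]

theorem trans_ne_zero_of_episodeProb_ne_zero {H : ℕ} {D : Dynamics S A H} {π : Policy S A H}
    {z : Episode S A H} (hz : episodeProb D π z ≠ 0) (h : Fin H) :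
    D.P h (z.1 h.castSucc) (z.2 h) (z.1 h.succ) ≠ 0 := by
  intro h0
  apply hz
  unfold episodeProb
  rw [Finset.prod_eq_zero (Finset.mem_univ h) (by rw [h0, ite_self]), mul_zero]

theorem init_ne_zero_of_episodeProb_ne_zero {H : ℕ} {D : Dynamics S A H} {π : Policy S A H}
    {z : Episode S A H} (hz : episodeProb D π z ≠ 0) : D.init (z.1 0) ≠ 0 := by
  intro h0
  apply hz
  unfold episodeProb
  rw [h0, zero_mul]

theorem expect_succ {H : ℕ} (D : Dynamics S A (H + 1)) (π : Policy S A (H + 1))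
    (F : Episode S A (H + 1) → ℝ) :
    expect D π F = ∑ s, D.init s *
      expect (D.tail s (π 0 s)) (fun h => π h.succ)
        (fun z => F (Fin.cons s z.1, Fin.cons (π 0 s) z.2)) := by
  classical
  unfold expect
  rw [Fintype.sum_prod_type, ← (Fin.consEquiv (fun _ : Fin (H + 2) => S)).sum_comp,
    Fintype.sum_prod_type]
  refine Finset.sum_congr rfl fun s _ => ?_
  rw [Finset.mul_sum, Fintype.sum_prod_type]
  refine Finset.sum_congr rfl fun f _ => ?_
  rw [← (Fin.consEquiv (fun _ : Fin (H + 1) => A)).sum_comp, Fintype.sum_prod_type,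
    Finset.sum_eq_single (π 0 s)]
  · refine Finset.sum_congr rfl fun g _ => ?_
    simp [episodeProb, Fin.consEquiv, Fin.prod_univ_succ, Dynamics.tail]
    ring
  · intro a _ ha
    refine Finset.sum_eq_zero fun g _ => ?_
    simp [episodeProb, Fin.consEquiv, Fin.prod_univ_succ, ha]
  · simp

theorem expect_add {H : ℕ} (D : Dynamics S A H) (π : Policy S A H) (F G : Episode S A H → ℝ) :
    expect D π (fun z => F z + G z) = expect D π F + expect D π G := by
  simp [expect, mul_add, Finset.sum_add_distrib]

theorem expect_sub {H : ℕ} (D : Dynamics S A H) (π : Policy S A H) (F G : Episode S A H → ℝ) :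
    expect D π (fun z => F z - G z) = expect D π F - expect D π G := by
  simp [expect, mul_sub, Finset.sum_sub_distrib]

theorem expect_const_mul {H : ℕ} (D : Dynamics S A H) (π : Policy S A H) (c : ℝ)
    (F : Episode S A H → ℝ) : expect D π (fun z => c * F z) = c * expect D π F := by
  simp only [expect, Finset.mul_sum]
  exact Finset.sum_congr rfl fun z _ => by ring

theorem expect_sum {H : ℕ} {ι : Type*} (I : Finset ι) (D : Dynamics S A H) (π : Policy S A H)
    (F : ι → Episode S A H → ℝ) :
    expect D π (fun z => ∑ i ∈ I, F i z) = ∑ i ∈ I, expect D π (F i) := by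
  simp only [expect, Finset.mul_sum]
  exact Finset.sum_comm

theorem expect_mono {H : ℕ} {D : Dynamics S A H} {π : Policy S A H} {F G : Episode S A H → ℝ}
    (h : ∀ z, episodeProb D π z ≠ 0 → F z ≤ G z) : expect D π F ≤ expect D π G := by
  refine Finset.sum_le_sum fun z _ => ?_
  by_cases hz : episodeProb D π z = 0
  · simp [hz]
  · exact mul_le_mul_of_nonneg_left (h z hz) (episodeProb_nonneg D π z)

/-- The first state has law `init`. -/
theorem expect_first {H : ℕ} (D : Dynamics S A H) (π : Policy S A H) (f : S → ℝ) :
    expect D π (fun z => f (z.1 0)) = ∑ s, D.init s * f s := by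
  induction H generalizing f with
  | zero =>
    unfold expect
    rw [Fintype.sum_prod_type, ← (Equiv.funUnique (Fin 1) S).symm.sum_comp]
    simp [episodeProb]
  | succ H ih =>
    rw [expect_succ]
    refine Finset.sum_congr rfl fun s _ => ?_
    have := ih (D.tail s (π 0 s)) (fun h => π h.succ) (fun _ => f s)
    simp only [Fin.cons_zero]
    rw [this, ← Finset.sum_mul]
    congr 1
    rw [(D.tail s (π 0 s)).init_mem.2, one_mul]

theorem expect_const {H : ℕ} (D : Dynamics S A H) (π : Policy S A H) (c : ℝ) :
    expect D π (fun _ => c) = c := by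
  rw [expect_first D π (fun _ => c), ← Finset.sum_mul, D.init_mem.2, one_mul]

/-- The Markov property: given the state and the action of round `h`, the next state has law
`P h`. -/
theorem expect_step {H : ℕ} (D : Dynamics S A H) (π : Policy S A H) (h : Fin H)
    (F : S → A → S → ℝ) :
    expect D π (fun z => F (z.1 h.castSucc) (z.2 h) (z.1 h.succ))
      = expect D π (fun z => ∑ s', D.P h (z.1 h.castSucc) (z.2 h) s'
          * F (z.1 h.castSucc) (z.2 h) s') := by
  induction H with
  | zero => exact h.elim0
  | succ H ih =>
    rw [expect_succ, expect_succ]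
    refine Finset.sum_congr rfl fun s _ => ?_
    congr 1
    refine Fin.cases ?_ (fun i => ?_) h
    · simp only [Fin.castSucc_zero, Fin.cons_zero, Fin.cons_succ]
      rw [expect_first _ _ (F s (π 0 s)), expect_const]
      rfl
    · simp only [← Fin.succ_castSucc, Fin.cons_succ]
      exact ih (D.tail s (π 0 s)) (fun h => π h.succ) i

/-- Telescoping of a backward recursion along an episode: if `U h = g h + P h U (h + 1)` along the
policy and `U H = 0`, then `U 0` is the expectation of the sum of the `g h`. Inequalities in the
recursion give an inequality. -/
theorem sum_init_le_expect_sum {H : ℕ} (D : Dynamics S A H) (π : Policy S A H)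
    (g : Fin H → S → A → ℝ) (U : ℕ → S → ℝ) (hU : ∀ s, U H s ≤ 0)
    (hrec : ∀ (h : Fin H) (s : S),
      U h s ≤ g h s (π h s) + ∑ s', D.P h s (π h s) s' * U (h + 1) s') :
    ∑ s, D.init s * U 0 s
      ≤ expect D π (fun z => ∑ h, g h (z.1 h.castSucc) (z.2 h)) := by
  have hstep : ∀ h : Fin H,
      expect D π (fun z => U h (z.1 h.castSucc)) - expect D π (fun z => U (h + 1) (z.1 h.succ))
        ≤ expect D π (fun z => g h (z.1 h.castSucc) (z.2 h)) := by
    intro h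
    rw [expect_step D π h (fun _ _ s' => U (h + 1) s'), ← expect_sub]
    refine expect_mono fun z hz => ?_
    rw [action_eq_of_episodeProb_ne_zero hz h]
    linarith [hrec h (z.1 h.castSucc)]
  have hsum := Finset.sum_le_sum fun (h : Fin H) (_ : h ∈ Finset.univ) => hstep h
  rw [← expect_sum] at hsum
  refine le_trans ?_ hsum
  have htel : ∀ f : Fin (H + 1) → ℝ, ∑ h : Fin H, (f h.castSucc - f h.succ)
      = f 0 - f (Fin.last H) := by
    intro f
    have e1 := Fin.sum_univ_succ f
    have e2 := Fin.sum_univ_castSucc f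
    rw [Finset.sum_sub_distrib]
    linarith
  have := htel (fun h => expect D π (fun z => U h (z.1 h)))
  simp only [Fin.val_castSucc, Fin.val_succ, Fin.val_zero, Fin.val_last] at this
  rw [this, ← expect_first D π]
  have h2 : expect D π (fun z => U H (z.1 (Fin.last H))) ≤ expect D π (fun _ => 0) :=
    expect_mono fun z _ => hU _
  rw [expect_const] at h2
  linarith

theorem valueFrom_of_lt (T : Task S A) (D : Dynamics S A T.H) (π : Policy S A T.H) (h : Fin T.H)
    (s : S) : valueFrom T D π h s = T.r h s (π h s)
      + ∑ s', D.P h s (π h s) s' * valueFrom T D π (h + 1) s' := by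
  rw [valueFrom, dif_pos h.2]

theorem valueFrom_last (T : Task S A) (D : Dynamics S A T.H) (π : Policy S A T.H)
    (s : S) : valueFrom T D π T.H s = 0 := by
  rw [valueFrom, dif_neg (lt_irrefl _)]

theorem expect_totalReward (T : Task S A) (D : Dynamics S A T.H) (π : Policy S A T.H) :
    expect D π (totalReward T) = value T D π := by
  -- both inequalities are telescoping sums, for the rewards and for their negatives
  apply le_antisymm
  · have := sum_init_le_expect_sum D π (fun h s a => - T.r h s a)
      (fun h s => - valueFrom T D π h s) (fun s => by rw [valueFrom_last]; simp)
      (fun h s => by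
        simp only [mul_neg, Finset.sum_neg_distrib]
        rw [valueFrom_of_lt T D π h s]
        linarith)
    simp only [mul_neg, Finset.sum_neg_distrib] at this
    have h2 := expect_const_mul D π (-1) (totalReward T)
    simp only [neg_mul, one_mul] at h2
    unfold totalReward at h2 ⊢
    unfold value
    linarith
  · exact sum_init_le_expect_sum D π T.r (valueFrom T D π)
      (fun s => (valueFrom_last T D π s).le) (fun h s => (valueFrom_of_lt T D π h s).le)

theorem totalReward_nonneg (T : Task S A) (z : Episode S A T.H) : 0 ≤ totalReward T z :=
  Finset.sum_nonneg fun _ _ => T.r_nonneg _ _ _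

theorem totalReward_le (T : Task S A) (z : Episode S A T.H) : totalReward T z ≤ T.H := by
  calc totalReward T z ≤ ∑ _h : Fin T.H, (1 : ℝ) :=
        Finset.sum_le_sum fun _ _ => T.r_le_one _ _ _
    _ = T.H := by simp

theorem value_nonneg (T : Task S A) (D : Dynamics S A T.H) (π : Policy S A T.H) :
    0 ≤ value T D π := by
  rw [← expect_totalReward, ← expect_const D π 0]
  exact expect_mono fun z _ => totalReward_nonneg T z

theorem value_le (T : Task S A) (D : Dynamics S A T.H) (π : Policy S A T.H) :
    value T D π ≤ T.H := by
  rw [← expect_totalReward, ← expect_const D π T.H]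
  exact expect_mono fun z _ => totalReward_le T z

theorem expect_reward_sub_sq_le (T : Task S A) (D : Dynamics S A T.H) (π : Policy S A T.H) :
    expect D π (fun z => (totalReward T z - value T D π) ^ 2) ≤ (T.H : ℝ) ^ 2 := by
  rw [← expect_const D π ((T.H : ℝ) ^ 2)]
  refine expect_mono fun z _ => ?_
  have h1 := totalReward_nonneg T z
  have h2 := totalReward_le T z
  have h3 := value_nonneg T D π
  have h4 := value_le T D π
  exact sq_le_sq' (by linarith) (by linarith)

/-- Hoeffding's lemma for the total reward of an episode. -/
theorem expect_exp_reward_le (T : Task S A) (D : Dynamics S A T.H) (π : Policy S A T.H) (l : ℝ) :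
    expect D π (fun z => Real.exp (l * (totalReward T z - value T D π)))
      ≤ Real.exp (l ^ 2 * (T.H : ℝ) ^ 2 / 8) := by
  let _ : MeasurableSpace (Episode S A T.H) := ⊤
  -- Mathlib's version is about a measure, here the discrete one with weights `episodeProb`
  let μ : Measure (Episode S A T.H) :=
    ∑ z, ENNReal.ofReal (episodeProb D π z) • Measure.dirac z
  have hint : ∀ F : Episode S A T.H → ℝ, ∫ z, F z ∂μ = expect D π F := by
    intro F
    rw [integral_finsetSum_measure]
    · refine Finset.sum_congr rfl fun z _ => ?_
      rw [integral_smul_measure, integral_dirac,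
        ENNReal.toReal_ofReal (episodeProb_nonneg D π z), smul_eq_mul]
    · intro z _
      exact (integrable_dirac (by simp)).smul_measure ENNReal.ofReal_ne_top
  have : IsProbabilityMeasure μ := by
    constructor
    simp only [μ, Measure.coe_finsetSum, Finset.sum_apply, Measure.smul_apply,
      measure_univ, smul_eq_mul, mul_one]
    rw [← ENNReal.ofReal_sum_of_nonneg fun z _ => episodeProb_nonneg D π z]
    have := expect_const D π 1
    simp only [expect, mul_one] at this
    rw [this, ENNReal.ofReal_one]
  have hsub := ProbabilityTheory.hasSubgaussianMGF_of_mem_Icc (μ := μ)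
    (X := totalReward T) (a := 0) (b := T.H) (measurable_from_top.aemeasurable)
    (Filter.Eventually.of_forall fun z => ⟨totalReward_nonneg T z, totalReward_le T z⟩)
  have := hsub.mgf_le l
  rw [ProbabilityTheory.mgf, hint, hint, expect_totalReward] at this
  refine this.trans (Real.exp_le_exp.2 (le_of_eq ?_))
  simp
  ring

end EpisodeLaw

/-! ### A maximal inequality for runs of a state machine -/

section Runs

variable {S : Type u} {A : Type v} {H : ℕ} {Ω : Type w}

theorem history_succ (Z : ℕ → Ω → Episode S A H) (n : ℕ) (ω : Ω) :
    history Z (n + 1) ω = history Z n ω ++ [Z n ω] := by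
  simp [history, List.range_succ]

/-- The memory, after `n` episodes, of a state machine with initial state `s₀` and update rule
`upd`. -/
def memory {σ : Type*} (upd : σ → Episode S A H → σ) (s₀ : σ) (Z : ℕ → Ω → Episode S A H) (n : ℕ)
    (ω : Ω) : σ :=
  (history Z n ω).foldl upd s₀

theorem memory_succ {σ : Type*} (upd : σ → Episode S A H → σ) (s₀ : σ)
    (Z : ℕ → Ω → Episode S A H) (n : ℕ) (ω : Ω) :
    memory upd s₀ Z (n + 1) ω = upd (memory upd s₀ Z n ω) (Z n ω) := by
  simp [memory, history_succ]

theorem measureReal_iUnion_le_of_hasSum [MeasurableSpace Ω] (ℙ : Measure Ω)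
    [IsProbabilityMeasure ℙ] {E : ℕ → Set Ω} {x : ℕ → ℝ} {X : ℝ} (hE : ∀ i, ℙ.real (E i) ≤ x i)
    (hx : HasSum x X) : ℙ.real (⋃ i, E i) ≤ X := by
  have h0 : ∀ i, 0 ≤ x i := fun i => measureReal_nonneg.trans (hE i)
  have hX : 0 ≤ X := hx.nonneg h0
  have : ℙ (⋃ i, E i) ≤ ENNReal.ofReal X := by
    rw [← hx.tsum_eq, ENNReal.ofReal_tsum_of_nonneg h0 hx.summable]
    refine (measure_iUnion_le E).trans (ENNReal.tsum_le_tsum fun i => ?_)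
    rw [← ofReal_measureReal]
    exact ENNReal.ofReal_le_ofReal (hE i)
  exact ENNReal.toReal_le_of_le_ofReal hX this

open Classical in
/-- The maximal inequality for `m` episodes after a given history `d`. Only upper bounds of
probabilities are split up along the next episode, so no event needs to be measurable. -/
theorem measureReal_exists_lt_le [Fintype S] [Fintype A] [MeasurableSpace Ω] {σ : Type*}
    {upd : σ → Episode S A H → σ} {dec : σ → Decision S A H} {s₀ : σ} {D : Dynamics S A H}
    {ℙ : Measure Ω} [IsProbabilityMeasure ℙ] {Z : ℕ → Ω → Episode S A H}
    (hrun : IsRun (fun hist => dec (hist.foldl upd s₀)) D ℙ Z)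
    {I : σ → Prop} (hI : ∀ s z, I s → I (upd s z))
    {B : σ → Episode S A H → Prop}
    (hhalt : ∀ s ans z, dec s = .halt ans → upd s z = s ∧ ¬ B s z)
    {G : σ → ℝ} (hG0 : ∀ s, I s → 0 ≤ G s) {c : ℝ} (hc : 0 < c)
    (hG : ∀ s π, I s → dec s = .sample π →
      expect D π (fun z => if B s z then c else G (upd s z)) ≤ G s)
    (m : ℕ) : ∀ (n : ℕ) (d : List (Episode S A H)), d.length = n → I (d.foldl upd s₀) →
      ℙ.real {ω | history Z n ω = d ∧ ∃ i < m, B (memory upd s₀ Z (n + i) ω) (Z (n + i) ω)}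
        ≤ G (d.foldl upd s₀) / c * ℙ.real {ω | history Z n ω = d} := by
  induction m with
  | zero =>
    intro n d _ hId
    simp only [not_lt_zero, false_and, exists_false, and_false, Set.ofPred_false,
      measureReal_empty]
    exact mul_nonneg (div_nonneg (hG0 _ hId) hc.le) measureReal_nonneg
  | succ m ih =>
    intro n d hd hId
    rcases hdec : dec (d.foldl upd s₀) with π | ans
    · have hsub : {ω | history Z n ω = d ∧
            ∃ i < m + 1, B (memory upd s₀ Z (n + i) ω) (Z (n + i) ω)}
          ⊆ ⋃ z, {ω | (history Z n ω = d ∧ Z n ω = z) ∧ (B (d.foldl upd s₀) z ∨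
            ∃ i < m, B (memory upd s₀ Z (n + 1 + i) ω) (Z (n + 1 + i) ω))} := by
        rintro ω ⟨h1, i, hi, hB⟩
        refine Set.mem_iUnion.2 ⟨Z n ω, ⟨h1, rfl⟩, ?_⟩
        rcases i with _ | i
        · left
          rw [← h1]
          exact hB
        · right
          refine ⟨i, by omega, ?_⟩
          rw [show n + 1 + i = n + (i + 1) by ring]
          exact hB
      refine (measureReal_mono hsub).trans ((measureReal_iUnion_fintype_le _).trans ?_)
      have hz : ∀ z, ℙ.real {ω | (history Z n ω = d ∧ Z n ω = z) ∧ (B (d.foldl upd s₀) z ∨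
            ∃ i < m, B (memory upd s₀ Z (n + 1 + i) ω) (Z (n + 1 + i) ω))}
          ≤ (episodeProb D π z *
              (if B (d.foldl upd s₀) z then c else G (upd (d.foldl upd s₀) z)))
            * (ℙ.real {ω | history Z n ω = d} / c) := by
        intro z
        have hlaw := hrun.law n d π z hd hdec
        split_ifs with hB
        · refine (measureReal_mono (s₂ := {ω | history Z n ω = d ∧ Z n ω = z})
            (fun ω hω => hω.1)).trans (le_of_eq ?_)
          rw [hlaw]
          field_simp
        · have hfold : (d ++ [z]).foldl upd s₀ = upd (d.foldl upd s₀) z := by simp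
          have heq : {ω | history Z (n + 1) ω = d ++ [z]}
              = {ω | history Z n ω = d ∧ Z n ω = z} := by
            ext ω
            simp only [Set.mem_ofPred_eq, history_succ]
            exact List.append_singleton_inj
          have := ih (n + 1) (d ++ [z]) (by simp [hd]) (by rw [hfold]; exact hI _ _ hId)
          rw [heq, hfold, hlaw] at this
          refine (measureReal_mono ?_).trans (this.trans (le_of_eq (by ring)))
          rintro ω ⟨h1, h2⟩
          refine ⟨?_, h2.resolve_left hB⟩
          rw [history_succ, h1.1, h1.2]
      refine (Finset.sum_le_sum fun z _ => hz z).trans ?_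
      rw [← Finset.sum_mul]
      calc _ ≤ G (d.foldl upd s₀) * (ℙ.real {ω | history Z n ω = d} / c) :=
            mul_le_mul_of_nonneg_right (hG _ π hId hdec) (by positivity)
        _ = _ := by ring
    · have hempty : {ω | history Z n ω = d ∧
          ∃ i < m + 1, B (memory upd s₀ Z (n + i) ω) (Z (n + i) ω)} = ∅ := by
        rw [Set.eq_empty_iff_forall_notMem]
        rintro ω ⟨h1, i, -, hB⟩
        have hst : ∀ i, memory upd s₀ Z (n + i) ω = d.foldl upd s₀ := by
          intro i
          induction i with
          | zero => rw [← h1]; rfl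
          | succ i ih' =>
            rw [← add_assoc, memory_succ, ih']
            exact (hhalt _ ans _ hdec).1
        rw [hst] at hB
        exact (hhalt _ ans _ hdec).2 hB
      rw [hempty, measureReal_empty]
      exact mul_nonneg (div_nonneg (hG0 _ hId) hc.le) measureReal_nonneg

open Classical in
/-- A maximal inequality. Suppose that `G` is a nonnegative function of the memory such that the
expected value of `G` after one more episode is at most its value before, where `G` counts as `c`
when a transition of kind `B` occurs. Then a run ever makes a transition of kind `B` with
probability at most `G s₀ / c`. The set `I` is an invariant of the memory. -/
theorem measureReal_exists_le [Fintype S] [Fintype A] [MeasurableSpace Ω] {σ : Type*}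
    {upd : σ → Episode S A H → σ} {dec : σ → Decision S A H} {s₀ : σ} {D : Dynamics S A H}
    {ℙ : Measure Ω} [IsProbabilityMeasure ℙ] {Z : ℕ → Ω → Episode S A H}
    (hrun : IsRun (fun hist => dec (hist.foldl upd s₀)) D ℙ Z)
    {I : σ → Prop} (hI0 : I s₀) (hI : ∀ s z, I s → I (upd s z))
    {B : σ → Episode S A H → Prop}
    (hhalt : ∀ s ans z, dec s = .halt ans → upd s z = s ∧ ¬ B s z)
    {G : σ → ℝ} (hG0 : ∀ s, I s → 0 ≤ G s) {c : ℝ} (hc : 0 < c)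
    (hG : ∀ s π, I s → dec s = .sample π →
      expect D π (fun z => if B s z then c else G (upd s z)) ≤ G s) :
    ℙ.real {ω | ∃ n, B (memory upd s₀ Z n ω) (Z n ω)} ≤ G s₀ / c := by
  have hfin : ∀ m, ℙ.real {ω | ∃ i < m, B (memory upd s₀ Z i ω) (Z i ω)} ≤ G s₀ / c := by
    intro m
    have := measureReal_exists_lt_le hrun hI hhalt hG0 hc hG m 0 [] rfl hI0
    simpa [history] using this
  have hmono : Monotone fun m => {ω | ∃ i < m, B (memory upd s₀ Z i ω) (Z i ω)} := by
    rintro a b hab ω ⟨i, hi, hB⟩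
    exact ⟨i, hi.trans_le hab, hB⟩
  have heq : {ω | ∃ n, B (memory upd s₀ Z n ω) (Z n ω)}
      = ⋃ m, {ω | ∃ i < m, B (memory upd s₀ Z i ω) (Z i ω)} := by
    ext ω
    simp only [Set.mem_ofPred_eq, Set.mem_iUnion]
    exact ⟨fun ⟨n, h⟩ => ⟨n + 1, n, n.lt_succ_self, h⟩, fun ⟨_, n, _, h⟩ => ⟨n, h⟩⟩
  have hpos : 0 ≤ G s₀ / c := div_nonneg (hG0 _ hI0) hc.le
  refine ENNReal.toReal_le_of_le_ofReal hpos ?_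
  rw [heq, hmono.measure_iUnion]
  refine iSup_le fun m => ?_
  rw [← ofReal_measureReal]
  exact ENNReal.ofReal_le_ofReal (hfin m)

end Runs

/-! ### Empirical distributions and the Laplace mixture -/

section Laplace

open scoped Nat

variable {S : Type u} [Fintype S]

/-- The likelihood ratio of a sample with counts `m` between Laplace's rule of succession (which
predicts `x` with probability `(m x + 1) / (n + |S|)` after `n` samples with counts `m`) and
i.i.d. sampling from `p`. It depends on the sample through its counts only. -/
noncomputable def laplaceRatio (p : S → ℝ) (m : S → ℕ) : ℝ :=
  (∏ x, ((m x)! : ℝ) / p x ^ m x) * ((Fintype.card S - 1)! / (∑ x, m x + (Fintype.card S - 1))!)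

theorem laplaceRatio_nonneg {p : S → ℝ} (hp : ∀ x, 0 ≤ p x) (m : S → ℕ) :
    0 ≤ laplaceRatio p m := by
  unfold laplaceRatio
  exact mul_nonneg (Finset.prod_nonneg fun x _ => div_nonneg (by positivity)
    (pow_nonneg (hp x) _)) (by positivity)

theorem laplaceRatio_zero (p : S → ℝ) : laplaceRatio p (fun _ => 0) = 1 := by
  simp [laplaceRatio, Nat.factorial_ne_zero]

open Classical in
/-- A further sample `x` multiplies the ratio by its probability under Laplace's rule divided by
`p x`. -/
theorem mul_laplaceRatio_add_single [Nonempty S] (p : S → ℝ) (m : S → ℕ) (x : S) (hx : p x ≠ 0) :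
    p x * laplaceRatio p (fun y => m y + if y = x then 1 else 0)
      = laplaceRatio p m * (((m x : ℝ) + 1) / (∑ y, (m y : ℝ) + Fintype.card S)) := by
  have hS : 0 < Fintype.card S := Fintype.card_pos
  have hsum : ∑ y, (m y + if y = x then 1 else 0) + (Fintype.card S - 1)
      = (∑ y, m y + (Fintype.card S - 1)) + 1 := by
    rw [Finset.sum_add_distrib]
    simp
    ring
  have hprod : ∏ y, (((m y + if y = x then 1 else 0)! : ℕ) : ℝ)
        / p y ^ (m y + if y = x then 1 else 0)
      = (∏ y, ((m y)! : ℝ) / p y ^ m y) * (((m x : ℝ) + 1) / p x) := by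
    rw [← Finset.mul_prod_erase _ _ (Finset.mem_univ x),
      ← Finset.mul_prod_erase _ (fun y => ((m y)! : ℝ) / p y ^ m y) (Finset.mem_univ x)]
    have : ∀ y ∈ Finset.univ.erase x, (((m y + if y = x then 1 else 0)! : ℕ) : ℝ)
        / p y ^ (m y + if y = x then 1 else 0) = ((m y)! : ℝ) / p y ^ m y := by
      intro y hy
      rw [if_neg (Finset.ne_of_mem_erase hy), add_zero]
    rw [Finset.prod_congr rfl this, if_pos rfl, Nat.factorial_succ, pow_succ]
    push_cast
    field_simp
  have hcast : (((∑ y, m y + (Fintype.card S - 1)) + 1 : ℕ) : ℝ)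
      = ∑ y, (m y : ℝ) + Fintype.card S := by
    rw [show (∑ y, m y + (Fintype.card S - 1)) + 1 = ∑ y, m y + Fintype.card S by omega]
    push_cast
    rfl
  unfold laplaceRatio
  rw [hprod, hsum, Nat.factorial_succ, Nat.cast_mul, hcast]
  have h1 : (0 : ℝ) < ∑ y, (m y : ℝ) + Fintype.card S := by
    have : (0 : ℝ) < Fintype.card S := by exact_mod_cast hS
    positivity
  have h2 : ((∑ y, m y + (Fintype.card S - 1))! : ℝ) ≠ 0 := by positivity
  field_simp

open Classical in
/-- The likelihood ratio is a supermartingale under i.i.d. sampling from `p`. -/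
theorem sum_mul_laplaceRatio_le [Nonempty S] {p : S → ℝ} (hp : p ∈ stdSimplex ℝ S) (m : S → ℕ) :
    ∑ x, p x * laplaceRatio p (fun y => m y + if y = x then 1 else 0) ≤ laplaceRatio p m := by
  have hpos : (0 : ℝ) < ∑ y, (m y : ℝ) + Fintype.card S := by
    have : (0 : ℝ) < Fintype.card S := by exact_mod_cast (Fintype.card_pos : 0 < Fintype.card S)
    positivity
  have hM := laplaceRatio_nonneg hp.1 m
  calc _ ≤ ∑ x, laplaceRatio p m * (((m x : ℝ) + 1) / (∑ y, (m y : ℝ) + Fintype.card S)) := by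
        refine Finset.sum_le_sum fun x _ => ?_
        by_cases hx : p x = 0
        · rw [hx, zero_mul]
          exact mul_nonneg hM (div_nonneg (by positivity) hpos.le)
        · exact (mul_laplaceRatio_add_single p m x hx).le
    _ = laplaceRatio p m := by
        rw [← Finset.mul_sum, ← Finset.sum_div, Finset.sum_add_distrib]
        simp only [Finset.sum_const, Finset.card_univ, nsmul_eq_mul, mul_one]
        rw [div_self hpos.ne', mul_one]

/-- A multinomial probability is at most `1`: it is a single term in the multinomial theorem for
`(∑ m x) ^ (∑ m x)`. -/
theorem prod_pow_self_mul_factorial_le (m : S → ℕ) :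
    (∏ x, m x ^ m x) * (∑ x, m x)! ≤ (∑ x, m x) ^ (∑ x, m x) * ∏ x, (m x)! := by
  classical
  have h1 := Finset.sum_pow_eq_sum_piAntidiag Finset.univ m (∑ x, m x)
  have h2 : Nat.multinomial Finset.univ m * ∏ x, m x ^ m x ≤ (∑ x, m x) ^ (∑ x, m x) := by
    rw [h1]
    exact Finset.single_le_sum (f := fun k : S → ℕ =>
      Nat.multinomial Finset.univ k * ∏ x, m x ^ k x) (fun _ _ => Nat.zero_le _)
      (Finset.mem_piAntidiag.2 ⟨rfl, by simp⟩)
  have h3 := Nat.multinomial_spec Finset.univ m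
  calc _ = (Nat.multinomial Finset.univ m * ∏ x, m x ^ m x) * ∏ x, (m x)! := by
        rw [← h3]; ring
    _ ≤ _ := Nat.mul_le_mul_right _ h2

theorem log_choose_le (n r : ℕ) :
    Real.log ((n + r).choose r) ≤ r * Real.log (Real.exp 1 * (1 + (n : ℝ) / r)) := by
  rcases Nat.eq_zero_or_pos r with rfl | hr
  · simp
  have hr' : (0 : ℝ) < r := by exact_mod_cast hr
  rw [← Real.log_pow]
  refine Real.log_le_log (by exact_mod_cast Nat.choose_pos (Nat.le_add_left r n)) ?_
  refine (Nat.choose_le_pow_div r (n + r)).trans ?_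
  have h1 := Real.pow_div_factorial_le_exp (r : ℝ) hr'.le r
  have h2 : Real.exp 1 * (1 + (n : ℝ) / r) = Real.exp 1 * ((n + r) / r) := by
    field_simp
    ring
  rw [h2, mul_pow, ← Real.exp_nat_mul, mul_one, div_pow]
  have h3 : (0 : ℝ) < (r : ℝ) ^ r := by positivity
  push_cast
  calc ((n : ℝ) + r) ^ r / (r ! : ℝ)
      = ((r : ℝ) ^ r / r !) * (((n : ℝ) + r) ^ r / (r : ℝ) ^ r) := by field_simp
    _ ≤ _ := mul_le_mul_of_nonneg_right h1 (by positivity)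

/-- If the likelihood ratio is at most `c`, then the Kullback-Leibler divergence of the empirical
distribution from `p` is small. The second summand bounds the logarithm of the number of possible
counts. -/
theorem finKL_le_of_laplaceRatio_le [Nonempty S] {p : S → ℝ} (hp : ∀ x, 0 ≤ p x) {m : S → ℕ}
    {n : ℕ} (hm : ∑ x, m x = n) (hn : 0 < n) (hsupp : ∀ x, p x = 0 → m x = 0) {c : ℝ}
    (hc : laplaceRatio p m ≤ c) :
    finKL (fun x => (m x : ℝ) / n) p ≤ (((Real.log c + ((Fintype.card S : ℝ) - 1)
      * Real.log (Real.exp 1 * (1 + (n : ℝ) / ((Fintype.card S : ℝ) - 1)))) / n : ℝ) : EReal) := by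
  have hn' : (0 : ℝ) < n := by exact_mod_cast hn
  rw [finKL, if_pos (fun x hx => by simp [hsupp x hx])]
  rw [EReal.coe_le_coe_iff, le_div_iff₀ hn']
  have hpow : ∀ x, 0 < p x ^ m x := by
    intro x
    rcases (hp x).eq_or_lt with h | h
    · rw [hsupp x h.symm, pow_zero]; exact one_pos
    · exact pow_pos h _
  have hmm : ∀ x, 0 < (m x : ℝ) ^ m x := by
    intro x
    rcases Nat.eq_zero_or_pos (m x) with h | h
    · rw [h, pow_zero]; exact one_pos
    · exact pow_pos (by exact_mod_cast h) _
  have hlog : (∑ x, (m x : ℝ) / n * Real.log ((m x : ℝ) / n / p x)) * n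
      = Real.log ((∏ x, (m x : ℝ) ^ m x) / n ^ n / ∏ x, p x ^ m x) := by
    rw [← hm, ← Finset.prod_pow_eq_pow_sum, ← Finset.prod_div_distrib, ← Finset.prod_div_distrib,
      hm, Real.log_prod (fun x _ => (div_pos (div_pos (hmm x) (by positivity)) (hpow x)).ne'),
      Finset.sum_mul]
    refine Finset.sum_congr rfl fun x _ => ?_
    rw [← div_pow, ← div_pow, Real.log_pow]
    field_simp
  obtain ⟨r, hr⟩ : ∃ r, Fintype.card S = r + 1 :=
    ⟨Fintype.card S - 1, by have := Fintype.card_pos (α := S); omega⟩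
  have hr' : (Fintype.card S : ℝ) - 1 = r := by rw [hr]; push_cast; ring
  have hM : laplaceRatio p m * ((n + r).choose r : ℝ)
      = (∏ x, ((m x)! : ℝ)) / n ! / ∏ x, p x ^ m x := by
    unfold laplaceRatio
    rw [hm, hr, Nat.add_sub_cancel, Finset.prod_div_distrib]
    have h1 := Nat.add_choose_mul_factorial_mul_factorial n r
    have h2 : ((n + r).choose r : ℝ) * n ! * r ! = (n + r)! := by
      exact_mod_cast h1
    rw [← h2]
    have h3 : ((n + r).choose r : ℝ) ≠ 0 := by
      exact_mod_cast (Nat.choose_pos (Nat.le_add_left r n)).ne'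
    have h4 : (∏ x, p x ^ m x) ≠ 0 := (Finset.prod_pos fun x _ => hpow x).ne'
    field_simp
  have hPp : 0 < ∏ x, p x ^ m x := Finset.prod_pos fun x _ => hpow x
  have hMpos : 0 < laplaceRatio p m := by
    have h3 : (0 : ℝ) < ((n + r).choose r : ℝ) := by
      exact_mod_cast (Nat.choose_pos (Nat.le_add_left r n))
    refine pos_of_mul_pos_left ?_ h3.le
    rw [hM]
    exact div_pos (div_pos (Finset.prod_pos fun x _ => by positivity) (by positivity)) hPp
  rw [hlog, hr']
  calc _ ≤ Real.log (laplaceRatio p m * ((n + r).choose r : ℝ)) := by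
        refine Real.log_le_log ?_ ?_
        · exact div_pos (div_pos (Finset.prod_pos fun x _ => hmm x) (by positivity)) hPp
        · rw [hM]
          refine div_le_div_of_nonneg_right ?_ hPp.le
          rw [div_le_div_iff₀ (by positivity) (by positivity)]
          have := prod_pow_self_mul_factorial_le m
          rw [hm] at this
          rw [mul_comm (∏ x, ((m x)! : ℝ))]
          exact_mod_cast this
    _ = Real.log (laplaceRatio p m) + Real.log ((n + r).choose r : ℝ) :=
        Real.log_mul hMpos.ne' (by exact_mod_cast (Nat.choose_pos (Nat.le_add_left r n)).ne')
    _ ≤ _ := add_le_add (Real.log_le_log hMpos hc) (log_choose_le n r)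

end Laplace

/-! ### The phases of BEE-GPI -/

section Phases

variable {S : Type u} {A : Type v}

/-- The current phase (`0` after termination). -/
def BEEState.phase {H : ℕ} : BEEState S A H → ℕ
  | .exploring k _ => k
  | .exploiting k _ _ _ => k
  | .finished _ => 0

/-- The exploration history held in memory (empty after termination). -/
def BEEState.data {H : ℕ} : BEEState S A H → List (Episode S A H)
  | .exploring _ d => d
  | .exploiting _ d _ _ => d
  | .finished _ => []

variable [Fintype S] [Fintype A] [Nonempty S] [Nonempty A]

/-- The exploration budgets at least double, so at least half of the budget of a phase is left when
the phase starts. -/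
theorem two_mul_exploreBudget_le (T : Task S A) (k : ℕ) :
    2 * exploreBudget T k ≤ exploreBudget T (k + 1) := by
  have hS : (1 : ℝ) ≤ Fintype.card S := by exact_mod_cast Fintype.card_pos
  have hA : (1 : ℝ) ≤ Fintype.card A := by exact_mod_cast Fintype.card_pos
  have hH : (1 : ℝ) ≤ T.H := by exact_mod_cast T.H_pos
  have hL := log_ratio_ge T k
  have hLL : Real.log (2 * Fintype.card S * Fintype.card A * T.H / deltaK k)
      ≤ Real.log (2 * Fintype.card S * Fintype.card A * T.H / deltaK (k + 1)) := by
    refine Real.log_le_log ?_ ?_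
    · rw [deltaK]; positivity
    · rw [deltaK, deltaK, div_div_eq_mul_div, div_div_eq_mul_div, div_one, div_one, pow_succ]
      have : (0 : ℝ) < 2 * Fintype.card S * Fintype.card A * T.H * 3 ^ k := by positivity
      linarith
  unfold exploreBudget
  set L := Real.log (2 * Fintype.card S * Fintype.card A * T.H / deltaK k)
  set L' := Real.log (2 * Fintype.card S * Fintype.card A * T.H / deltaK (k + 1))
  have hc1 : (0 : ℝ) < ((T.H : ℝ) + 1) ^ 2 * Fintype.card S * Fintype.card A := by positivity
  have hc2 : (4 : ℝ) ≤ ((T.H : ℝ) + 1) ^ 2 * (Fintype.card S : ℝ) ^ 2 * Fintype.card A := by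
    have e1 := one_le_mul_of_one_le_of_one_le (one_le_mul_of_one_le_of_one_le hS hS) hA
    have hHH : (4 : ℝ) ≤ ((T.H : ℝ) + 1) ^ 2 := by nlinarith
    nlinarith
  set c₁ := ((T.H : ℝ) + 1) ^ 2 * Fintype.card S * Fintype.card A
  set c₂ := ((T.H : ℝ) + 1) ^ 2 * (Fintype.card S : ℝ) ^ 2 * Fintype.card A
  have hx : (1 : ℝ) ≤ 2 ^ k := one_le_pow₀ (by norm_num)
  simp only [epsK, div_div_eq_mul_div, div_one, pow_succ]
  set x := (2 : ℝ) ^ k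
  have f1 : 1 ≤ c₂ * L := by nlinarith
  have f2 : c₂ * L ≤ c₂ * L' := mul_le_mul_of_nonneg_left hLL (by linarith)
  have f3 : 1 ≤ c₂ * L * x := by nlinarith
  have f4 : c₂ * L * x ≤ c₂ * L' * (x * 2) := by nlinarith
  have f5 := Real.log_le_log (by linarith) f4
  have f6 : c₁ * L * x ≤ c₁ * L' * x :=
    mul_le_mul_of_nonneg_right (mul_le_mul_of_nonneg_left hLL hc1.le) (by linarith)
  have f7 : c₂ * x * Real.log (c₂ * L * x) ≤ c₂ * x * Real.log (c₂ * L' * (x * 2)) :=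
    mul_le_mul_of_nonneg_left f5 (mul_nonneg (by linarith) (by linarith))
  linarith

theorem exploreBudget_mono (T : Task S A) : Monotone (exploreBudget T) := by
  refine monotone_nat_of_le_succ fun k => ?_
  have := two_mul_exploreBudget_le T k
  have := le_exploreBudget T k
  have : (0 : ℝ) ≤ k := Nat.cast_nonneg k
  linarith

/-- Phase `k` ends without a candidate or an answer when the exploration history is `d`. -/
def ExploreFails (T : Task S A) (tie : ArgmaxRule S A T.H) (k : ℕ)
    (d : List (Episode S A T.H)) : Prop :=
  ¬ PosCrit T tie k d ∧ ((NegCrit T k d ∧ T.δ / 10 ≤ deltaK k) ∨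
    (¬ NegCrit T k d ∧ exploreBudget T k - 1 < d.length))

/-- The outcome of `explore`: it skips the phases which fail for `d`, and the first other phase `k'`
decides how it ends. -/
theorem explore_cases (T : Task S A) (tie : ArgmaxRule S A T.H) (k : ℕ)
    (d : List (Episode S A T.H)) :
    ∃ k' ≥ k, (∀ j, k ≤ j → j < k' → ExploreFails T tie j d) ∧
      ((explore T tie k d = .exploring k' d ∧ ¬ PosCrit T tie k' d ∧ ¬ NegCrit T k' d ∧
          (d.length : ℝ) ≤ exploreBudget T k' - 1) ∨
        (explore T tie k d = .exploiting k' d (optimisticPolicy T tie k' d) [] ∧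
          PosCrit T tie k' d) ∨
        (explore T tie k d = .finished none ∧ NegCrit T k' d ∧ deltaK k' < T.δ / 10)) := by
  have hstep : ∀ k, ExploreFails T tie k d → (∃ k' ≥ k + 1,
      (∀ j, k + 1 ≤ j → j < k' → ExploreFails T tie j d) ∧
      ((explore T tie (k + 1) d = .exploring k' d ∧ ¬ PosCrit T tie k' d ∧ ¬ NegCrit T k' d ∧
          (d.length : ℝ) ≤ exploreBudget T k' - 1) ∨
        (explore T tie (k + 1) d = .exploiting k' d (optimisticPolicy T tie k' d) [] ∧
          PosCrit T tie k' d) ∨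
        (explore T tie (k + 1) d = .finished none ∧ NegCrit T k' d ∧ deltaK k' < T.δ / 10))) →
      ∃ k' ≥ k, (∀ j, k ≤ j → j < k' → ExploreFails T tie j d) ∧
      ((explore T tie (k + 1) d = .exploring k' d ∧ ¬ PosCrit T tie k' d ∧ ¬ NegCrit T k' d ∧
          (d.length : ℝ) ≤ exploreBudget T k' - 1) ∨
        (explore T tie (k + 1) d = .exploiting k' d (optimisticPolicy T tie k' d) [] ∧
          PosCrit T tie k' d) ∨
        (explore T tie (k + 1) d = .finished none ∧ NegCrit T k' d ∧ deltaK k' < T.δ / 10)) := by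
    rintro k hk ⟨k', hk', hf, hc⟩
    refine ⟨k', by omega, fun j hj hj' => ?_, hc⟩
    rcases hj.eq_or_lt with rfl | h
    · exact hk
    · exact hf j h hj'
  induction k using explore.induct T tie d with
  | case1 k h₁ =>
    refine ⟨k, le_rfl, fun j h1 h2 => absurd h2 (by omega), Or.inl ⟨?_, h₁⟩⟩
    rw [explore, dif_pos h₁]
  | case2 k h₁ h₂ h₃ =>
    refine ⟨k, le_rfl, fun j h1 h2 => absurd h2 (by omega), Or.inr (Or.inl ⟨?_, h₂⟩)⟩
    rw [explore, dif_neg h₁, dif_pos h₂, dif_pos h₃]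
  | case3 k h₁ h₂ h₃ ih =>
    exact absurd (sub_nonneg.2 (one_le_exploitBudget T k)) h₃
  | case4 k h₁ h₂ h₃ h₄ ih =>
    rw [explore, dif_neg h₁, dif_neg h₂, dif_pos h₃, dif_pos h₄]
    exact hstep k ⟨h₂, Or.inl ⟨h₃, h₄⟩⟩ ih
  | case5 k h₁ h₂ h₃ h₄ =>
    refine ⟨k, le_rfl, fun j h1 h2 => absurd h2 (by omega),
      Or.inr (Or.inr ⟨?_, h₃, not_le.1 h₄⟩)⟩
    rw [explore, dif_neg h₁, dif_neg h₂, dif_pos h₃, dif_neg h₄]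
  | case6 k h₁ h₂ h₃ ih =>
    rw [explore, dif_neg h₁, dif_neg h₂, dif_neg h₃]
    refine hstep k ⟨h₂, Or.inr ⟨h₃, ?_⟩⟩ ih
    by_contra hlen
    exact h₁ ⟨h₂, h₃, not_lt.1 hlen⟩

/-- What holds whenever BEE-GPI waits for an episode. -/
def BEEInv (T : Task S A) (tie : ArgmaxRule S A T.H) : BEEState S A T.H → Prop
  | .exploring k d => ¬ PosCrit T tie k d ∧ ¬ NegCrit T k d ∧
      (d.length : ℝ) ≤ exploreBudget T k - 1
  | .exploiting k d π X => PosCrit T tie k d ∧ π = optimisticPolicy T tie k d ∧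
      (d.length : ℝ) ≤ exploreBudget T k ∧ (X.length : ℝ) ≤ exploitBudget T k - 1
  | .finished _ => True

theorem beeInv_explore (T : Task S A) (tie : ArgmaxRule S A T.H) {k : ℕ}
    {d : List (Episode S A T.H)} (hd : (d.length : ℝ) ≤ exploreBudget T k) :
    BEEInv T tie (explore T tie k d) := by
  obtain ⟨k', hk', -, ⟨h, h'⟩ | ⟨h, h'⟩ | ⟨h, -⟩⟩ := explore_cases T tie k d
  · rw [h]; exact h'
  · rw [h]
    refine ⟨h', rfl, hd.trans (exploreBudget_mono T hk'), ?_⟩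
    have := one_le_exploitBudget T k'
    simp only [List.length_nil, Nat.cast_zero]
    linarith
  · rw [h]; trivial

theorem beeInv_update (T : Task S A) (tie : ArgmaxRule S A T.H) (s : BEEState S A T.H)
    (z : Episode S A T.H) (hs : BEEInv T tie s) : BEEInv T tie (update T tie s z) := by
  rcases s with ⟨k, d⟩ | ⟨k, d, π, X⟩ | ans
  · refine beeInv_explore T tie ?_
    have := hs.2.2
    simp only [List.length_append, List.length_singleton, Nat.cast_add, Nat.cast_one]
    linarith
  · rw [update]
    split_ifs with h1 h2
    · trivial
    · exact ⟨hs.1, hs.2.1, hs.2.2.1, h2⟩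
    · exact beeInv_explore T tie (hs.2.2.1.trans (exploreBudget_mono T (Nat.le_succ k)))
  · trivial

theorem beeInv_start (T : Task S A) (tie : ArgmaxRule S A T.H) :
    BEEInv T tie (explore T tie 1 []) := by
  refine beeInv_explore T tie ?_
  have := le_exploreBudget T 1
  simp only [List.length_nil, Nat.cast_zero]
  norm_num at this
  linarith

theorem data_explore (T : Task S A) (tie : ArgmaxRule S A T.H) (k : ℕ)
    (d : List (Episode S A T.H)) :
    (explore T tie k d).data = d ∨ (explore T tie k d).data = [] := by
  obtain ⟨k', -, -, ⟨h, -⟩ | ⟨h, -⟩ | ⟨h, -⟩⟩ := explore_cases T tie k d <;> rw [h] <;>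
    simp [BEEState.data]

theorem nextDecision_eq_halt {T : Task S A} {tie : ArgmaxRule S A T.H} {s : BEEState S A T.H}
    {ans : Option (Policy S A T.H)} (h : nextDecision T tie s = .halt ans) : s = .finished ans := by
  rcases s with ⟨k, d⟩ | ⟨k, d, π, X⟩ | a
  · simp [nextDecision] at h
  · simp [nextDecision] at h
  · simpa [nextDecision] using h

end Phases

section Runs

variable {S : Type u} {A : Type v} [Fintype S] [Fintype A] [Nonempty S] [Nonempty A]
  {Ω : Type w}

/-- The memory of BEE-GPI after `n` episodes. -/
noncomputable def beeMemory (T : Task S A) (tie : ArgmaxRule S A T.H)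
    (Z : ℕ → Ω → Episode S A T.H) (n : ℕ) (ω : Ω) : BEEState S A T.H :=
  memory (update T tie) (explore T tie 1 []) Z n ω

theorem beeMemory_zero (T : Task S A) (tie : ArgmaxRule S A T.H)
    (Z : ℕ → Ω → Episode S A T.H) (ω : Ω) :
    beeMemory T tie Z 0 ω = explore T tie 1 [] := by
  simp [beeMemory, memory, history]

theorem beeMemory_succ (T : Task S A) (tie : ArgmaxRule S A T.H)
    (Z : ℕ → Ω → Episode S A T.H) (n : ℕ) (ω : Ω) :
    beeMemory T tie Z (n + 1) ω = update T tie (beeMemory T tie Z n ω) (Z n ω) :=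
  memory_succ _ _ Z n ω

theorem beeInv_beeMemory (T : Task S A) (tie : ArgmaxRule S A T.H)
    (Z : ℕ → Ω → Episode S A T.H) (n : ℕ) (ω : Ω) : BEEInv T tie (beeMemory T tie Z n ω) := by
  induction n with
  | zero => rw [beeMemory_zero]; exact beeInv_start T tie
  | succ n ih => rw [beeMemory_succ]; exact beeInv_update T tie _ _ ih

open Classical in
/-- The maximal inequality for runs of BEE-GPI. -/
theorem bee_measureReal_exists_le {T : Task S A} {tie : ArgmaxRule S A T.H}
    {D : Dynamics S A T.H} [MeasurableSpace Ω] {ℙ : Measure Ω} [IsProbabilityMeasure ℙ]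
    {Z : ℕ → Ω → Episode S A T.H} (hrun : IsRun (beeGPI T tie) D ℙ Z)
    {B : BEEState S A T.H → Episode S A T.H → Prop} (hB : ∀ ans z, ¬ B (.finished ans) z)
    {G : BEEState S A T.H → ℝ} (hG0 : ∀ s, BEEInv T tie s → 0 ≤ G s) {c : ℝ} (hc : 0 < c)
    (hG : ∀ s π, BEEInv T tie s → nextDecision T tie s = .sample π →
      expect D π (fun z => if B s z then c else G (update T tie s z)) ≤ G s) :
    ℙ.real {ω | ∃ n, B (beeMemory T tie Z n ω) (Z n ω)} ≤ G (explore T tie 1 []) / c :=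
  measureReal_exists_le (dec := nextDecision T tie) hrun (beeInv_start T tie)
    (beeInv_update T tie) (fun s ans z h => by
      rw [nextDecision_eq_halt h]
      exact ⟨rfl, hB ans z⟩) hG0 hc hG

/-- An output is given either without any episode or by an update of the memory. -/
theorem exists_beeMemory_of_outputs {T : Task S A} {tie : ArgmaxRule S A T.H}
    {Z : ℕ → Ω → Episode S A T.H} {ω : Ω} {ans : Option (Policy S A T.H)}
    (h : Outputs (beeGPI T tie) Z ω ans) :
    explore T tie 1 [] = .finished ans ∨
      ∃ n, (∀ a, beeMemory T tie Z n ω ≠ .finished a) ∧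
        update T tie (beeMemory T tie Z n ω) (Z n ω) = .finished ans := by
  obtain ⟨n, hn, hlt⟩ := h
  have hn' : beeMemory T tie Z n ω = .finished ans := nextDecision_eq_halt hn
  rcases n with _ | n
  · left
    rw [← hn', beeMemory_zero]
  · right
    refine ⟨n, fun a ha => ?_, by rw [← beeMemory_succ, hn']⟩
    obtain ⟨π, hπ⟩ := hlt n n.lt_succ_self
    have : nextDecision T tie (beeMemory T tie Z n ω) = .sample π := hπ
    rw [ha] at this
    simp [nextDecision] at this

theorem stops_of_beeMemory_eq_finished {T : Task S A} {tie : ArgmaxRule S A T.H}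
    {Z : ℕ → Ω → Episode S A T.H} {ω : Ω} {n : ℕ} {ans : Option (Policy S A T.H)}
    (h : beeMemory T tie Z n ω = .finished ans) : Stops (beeGPI T tie) Z ω := by
  classical
  have hex : ∃ n, ∃ ans, beeMemory T tie Z n ω = .finished ans := ⟨n, ans, h⟩
  obtain ⟨a, ha⟩ := Nat.find_spec hex
  refine ⟨a, Nat.find hex, ?_, fun m hm => ?_⟩
  · change nextDecision T tie (beeMemory T tie Z _ ω) = _
    rw [ha]
    rfl
  · have hne := Nat.find_min hex hm
    change ∃ π, nextDecision T tie (beeMemory T tie Z m ω) = _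
    rcases hs : beeMemory T tie Z m ω with ⟨k, d⟩ | ⟨k, d, π, X⟩ | b
    · exact ⟨_, rfl⟩
    · exact ⟨_, rfl⟩
    · exact absurd ⟨b, hs⟩ hne

end Runs

/-! ### Validity of the confidence sets -/

section Samples

variable {S : Type u} {A : Type v} [Fintype S] [Fintype A] [Nonempty S] {H : ℕ}

open Classical in
/-- If each episode contributes the sample `obs z` or no sample: the number of samples equal to
`x`. -/
noncomputable def sampleCount (obs : Episode S A H → Option S) (d : List (Episode S A H))
    (x : S) : ℕ :=
  d.countP (fun z => obs z = some x)

open Classical in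
theorem sampleCount_append_some {obs : Episode S A H → Option S} (d : List (Episode S A H))
    {z : Episode S A H} {y : S} (h : obs z = some y) :
    sampleCount obs (d ++ [z]) = fun x => sampleCount obs d x + if x = y then 1 else 0 := by
  funext x
  simp [sampleCount, h, List.countP_append, eq_comm]

theorem sampleCount_append_none {obs : Episode S A H → Option S} (d : List (Episode S A H))
    {z : Episode S A H} (h : obs z = none) :
    sampleCount obs (d ++ [z]) = sampleCount obs d := by
  funext x
  simp [sampleCount, h, List.countP_append]

theorem sum_sampleCount {obs : Episode S A H → Option S} (d : List (Episode S A H)) :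
    ∑ x, sampleCount obs d x = d.countP (fun z => (obs z).isSome) := by
  classical
  induction d using List.reverseRecOn with
  | nil => simp [sampleCount]
  | append_singleton d z ih =>
    rcases h : obs z with _ | y
    · rw [sampleCount_append_none d h, ih, List.countP_append, List.countP_singleton]
      simp [h]
    · rw [sampleCount_append_some d h, List.countP_append, List.countP_singleton,
        Finset.sum_add_distrib, ih]
      simp [h]

/-- Whatever policy is executed, the sample `obs z`, if there is one, has conditional law `p`. -/
structure SamplesFrom (D : Dynamics S A H) (obs : Episode S A H → Option S) (p : S → ℝ) :
    Prop where
  mem : p ∈ stdSimplex ℝ S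
  expect_le : ∀ (π : Policy S A H) (f : S → ℝ) (c : ℝ), ∑ x, p x * f x ≤ c →
    expect D π (fun z => (obs z).elim c f) ≤ c
  ne_zero : ∀ (π : Policy S A H) (z : Episode S A H) (x : S), episodeProb D π z ≠ 0 →
    obs z = some x → p x ≠ 0

/-- The samples in `d` are consistent with the law `p`, at level `c`. -/
def Consistent (obs : Episode S A H → Option S) (p : S → ℝ) (c : ℝ)
    (d : List (Episode S A H)) : Prop :=
  (∀ x, p x = 0 → sampleCount obs d x = 0) ∧ laplaceRatio p (sampleCount obs d) ≤ c

theorem consistent_nil {obs : Episode S A H → Option S} (p : S → ℝ) {c : ℝ} (hc : 1 ≤ c) :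
    Consistent obs p c [] := by
  have : sampleCount obs ([] : List (Episode S A H)) = fun _ => 0 := by
    funext x; simp [sampleCount]
  refine ⟨fun x _ => by rw [this], ?_⟩
  rw [this, laplaceRatio_zero]
  exact hc

open Classical in
/-- The likelihood ratio, replaced by `c` as soon as consistency at level `c` fails. -/
noncomputable def cappedRatio (obs : Episode S A H → Option S) (p : S → ℝ) (c : ℝ)
    (d : List (Episode S A H)) : ℝ :=
  if Consistent obs p c d then laplaceRatio p (sampleCount obs d) else c

theorem cappedRatio_le {obs : Episode S A H → Option S} {p : S → ℝ} {c : ℝ}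
    (d : List (Episode S A H)) : cappedRatio obs p c d ≤ c := by
  unfold cappedRatio
  split_ifs with h
  · exact h.2
  · exact le_rfl

theorem cappedRatio_nonneg {obs : Episode S A H → Option S} {p : S → ℝ} (hp : ∀ x, 0 ≤ p x)
    {c : ℝ} (hc : 0 ≤ c) (d : List (Episode S A H)) : 0 ≤ cappedRatio obs p c d := by
  unfold cappedRatio
  split_ifs with h
  · exact laplaceRatio_nonneg hp _
  · exact hc

/-- The capped ratio is a supermartingale. While the samples are consistent, it is dominated by the
likelihood ratio; samples outside the support of `p` have probability zero. -/
theorem expect_cappedRatio_le {D : Dynamics S A H} {obs : Episode S A H → Option S} {p : S → ℝ}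
    (hobs : SamplesFrom D obs p) (c : ℝ) (π : Policy S A H) (d : List (Episode S A H)) :
    expect D π (fun z => cappedRatio obs p c (d ++ [z])) ≤ cappedRatio obs p c d := by
  classical
  by_cases hd : Consistent obs p c d
  · rw [cappedRatio, if_pos hd]
    refine le_trans (expect_mono fun z hz => ?_) (hobs.expect_le π
      (fun x => laplaceRatio p (fun y => sampleCount obs d y + if y = x then 1 else 0)) _
      (sum_mul_laplaceRatio_le hobs.mem _))
    rcases h : obs z with _ | y
    · rw [cappedRatio, Consistent, sampleCount_append_none d h, ← Consistent, if_pos hd]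
      exact le_rfl
    · rw [cappedRatio, Consistent, sampleCount_append_some d h]
      split_ifs with hc
      · exact le_rfl
      · simp only [Option.elim_some]
        by_contra hlt
        refine hc ⟨fun x hx => ?_, ?_⟩
        · have hne : x ≠ y := by
            rintro rfl
            exact hobs.ne_zero π z x hz h hx
          simp only [if_neg hne, hd.1 x hx]
        · exact (not_le.1 hlt).le
  · rw [cappedRatio, if_neg hd]
    exact (expect_mono fun z _ => cappedRatio_le _).trans (expect_const D π c).le

end Samples

section Reliable

variable {S : Type u} {A : Type v} [Fintype S] [Fintype A] [Nonempty S] {H : ℕ}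

open Classical in
/-- The next-state sample of an episode for each state-action pair of each round. The index `none`
stands for the pair of the fictitious round `0`. -/
noncomputable def nextStateSample :
    Option (Fin H × S × A) → Episode S A H → Option S
  | none, z => some (z.1 0)
  | some (h, s, a), z => if z.1 h.castSucc = s ∧ z.2 h = a then some (z.1 h.succ) else none

/-- The law of the samples `nextStateSample`. -/
def Dynamics.nextStateLaw (D : Dynamics S A H) : Option (Fin H × S × A) → S → ℝ
  | none => D.init
  | some (h, s, a) => D.P h s a

theorem samplesFrom_nextStateLaw (D : Dynamics S A H) (i : Option (Fin H × S × A)) :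
    SamplesFrom D (nextStateSample i) (D.nextStateLaw i) := by
  classical
  rcases i with _ | ⟨h, s, a⟩
  · refine ⟨D.init_mem, fun π f c hf => ?_, fun π z x hz hx => ?_⟩
    · exact (expect_first D π f).trans_le hf
    · simp only [nextStateSample, Option.some.injEq] at hx
      rw [← hx]
      exact init_ne_zero_of_episodeProb_ne_zero hz
  · refine ⟨D.P_mem h s a, fun π f c hf => ?_, fun π z x hz hx => ?_⟩
    · have := expect_step D π h (fun s₁ a₁ x => if s₁ = s ∧ a₁ = a then f x else c)
      have heq : (fun z => (nextStateSample (some (h, s, a)) z).elim c f)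
          = fun z : Episode S A H => if z.1 h.castSucc = s ∧ z.2 h = a then f (z.1 h.succ)
            else c := by
        funext z
        simp only [nextStateSample]
        split_ifs <;> rfl
      rw [heq, this]
      refine le_trans (expect_mono fun z _ => ?_) (expect_const D π c).le
      by_cases hz : z.1 h.castSucc = s ∧ z.2 h = a
      · simp only [hz, and_self, if_true]
        exact hf
      · simp only [hz, if_false]
        rw [← Finset.sum_mul, (D.P_mem _ _ _).2, one_mul]
    · simp only [nextStateSample] at hx
      split_ifs at hx with hc
      rw [← Option.some.inj hx]
      have := trans_ne_zero_of_episodeProb_ne_zero hz h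
      rw [hc.1, hc.2] at this
      exact this

/-- The exploration history `d` and all its prefixes are consistent with all laws, at the level
that corresponds to the error probability `δ_k`. With the prefixes included, a history that is not
reliable stays so when it is extended. -/
def Reliable (T : Task S A) (D : Dynamics S A T.H) (k : ℕ) (d : List (Episode S A T.H)) : Prop :=
  ∀ d', d' <+: d → ∀ i, Consistent (nextStateSample i) (D.nextStateLaw i)
    (2 * Fintype.card S * Fintype.card A * T.H / deltaK k) d'

theorem Reliable.of_append {T : Task S A} {D : Dynamics S A T.H} {k : ℕ}
    {d e : List (Episode S A T.H)} (h : Reliable T D k (d ++ e)) : Reliable T D k d :=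
  fun _ hd' => h _ (hd'.trans (List.prefix_append d e))

theorem one_le_reliableLevel [Nonempty A] (T : Task S A) (k : ℕ) :
    (1 : ℝ) ≤ 2 * Fintype.card S * Fintype.card A * T.H / deltaK k := by
  have h := log_ratio_ge T k
  by_contra hlt
  have h0 : 0 ≤ 2 * (Fintype.card S : ℝ) * Fintype.card A * T.H / deltaK k := by
    rw [deltaK]; positivity
  have := Real.log_nonpos h0 (not_le.1 hlt).le
  linarith

theorem reliable_nil [Nonempty A] (T : Task S A) (D : Dynamics S A T.H) (k : ℕ) :
    Reliable T D k [] :=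
  fun d' hd' _ => by
    rw [List.prefix_nil.1 hd']
    exact consistent_nil _ (one_le_reliableLevel T k)

theorem sum_sampleCount_some (d : List (Episode S A H)) (h : Fin H) (s : S) (a : A) :
    ∑ x, sampleCount (nextStateSample (some (h, s, a))) d x = visits d h s a := by
  classical
  rw [sum_sampleCount, visits]
  congr 1
  funext z
  simp only [nextStateSample]
  split_ifs with h <;> simp [h]

theorem sum_sampleCount_none (d : List (Episode S A H)) :
    ∑ x, sampleCount (nextStateSample none) d x = d.length := by
  classical
  rw [sum_sampleCount]
  simp [nextStateSample]

theorem pHat_eq_sampleCount_div {d : List (Episode S A H)} {h : Fin H} {s : S} {a : A}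
    (hpos : 0 < visits d h s a) : pHat d h s a = fun x =>
      (sampleCount (nextStateSample (some (h, s, a))) d x : ℝ) / visits d h s a := by
  classical
  funext x
  rw [pHat, if_pos hpos]
  congr 2
  unfold sampleCount
  congr 1
  funext z
  simp only [nextStateSample]
  split_ifs with hz <;> simp_all

theorem pHatInit_eq_sampleCount_div {d : List (Episode S A H)} (hpos : 0 < d.length) :
    pHatInit d = fun x => (sampleCount (nextStateSample none) d x : ℝ) / d.length := by
  classical
  funext x
  rw [pHatInit, if_pos hpos]
  simp [sampleCount, nextStateSample]

theorem mem_confTrans_of_reliable {T : Task S A} {D : Dynamics S A T.H} {k : ℕ}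
    {d : List (Episode S A T.H)} (hd : Reliable T D k d) (h : Fin T.H) (s : S) (a : A) :
    D.P h s a ∈ confTrans T d (deltaK k) h s a := by
  refine ⟨D.P_mem h s a, ?_⟩
  rcases Nat.eq_zero_or_pos (visits d h s a) with h0 | hpos
  · exact Or.inl h0
  · right
    obtain ⟨h1, h2⟩ := hd d List.prefix_rfl (some (h, s, a))
    have := finKL_le_of_laplaceRatio_le (D.P_mem h s a).1 (sum_sampleCount_some d h s a) hpos h1 h2
    rw [← betaP] at this
    rw [pHat_eq_sampleCount_div hpos]
    exact this

theorem mem_confInit_of_reliable {T : Task S A} {D : Dynamics S A T.H} {k : ℕ}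
    {d : List (Episode S A T.H)} (hd : Reliable T D k d) :
    D.init ∈ confInit T d (deltaK k) := by
  refine ⟨D.init_mem, ?_⟩
  rcases Nat.eq_zero_or_pos d.length with h0 | hpos
  · exact Or.inl h0
  · right
    obtain ⟨h1, h2⟩ := hd d List.prefix_rfl none
    have := finKL_le_of_laplaceRatio_le D.init_mem.1 (sum_sampleCount_none d) hpos h1 h2
    rw [← betaP] at this
    rw [pHatInit_eq_sampleCount_div hpos]
    exact this

end Reliable

section ReliableRuns

variable {S : Type u} {A : Type v} [Fintype S] [Fintype A] [Nonempty S] [Nonempty A]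
  {Ω : Type w} {T : Task S A} {tie : ArgmaxRule S A T.H} {D : Dynamics S A T.H}

/-- The extension of a function of the exploration history to the memory of BEE-GPI, by `0` after
termination. -/
def liftPotential {H : ℕ} (g : List (Episode S A H) → ℝ) : BEEState S A H → ℝ
  | .exploring _ d => g d
  | .exploiting _ d _ _ => g d
  | .finished _ => 0

theorem liftPotential_explore_le {g : List (Episode S A T.H) → ℝ} (hg : ∀ d, 0 ≤ g d) (k : ℕ)
    (d : List (Episode S A T.H)) : liftPotential g (explore T tie k d) ≤ g d := by
  obtain ⟨k', -, -, ⟨h, -⟩ | ⟨h, -⟩ | ⟨h, -⟩⟩ := explore_cases T tie k d <;> rw [h]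
  · exact le_rfl
  · exact le_rfl
  · exact hg d

/-- The probability that samples from `p` are ever inconsistent with `p` at level `c` is at most
`1 / c`. -/
theorem measureReal_inconsistent_le [MeasurableSpace Ω] {ℙ : Measure Ω} [IsProbabilityMeasure ℙ]
    {Z : ℕ → Ω → Episode S A T.H} (hrun : IsRun (beeGPI T tie) D ℙ Z)
    {obs : Episode S A T.H → Option S} {p : S → ℝ} (hobs : SamplesFrom D obs p) {c : ℝ}
    (hc : 1 ≤ c) :
    ℙ.real {ω | ∃ n, ∃ k d, beeMemory T tie Z n ω = .exploring k d ∧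
      ¬ Consistent obs p c (d ++ [Z n ω])} ≤ 1 / c := by
  classical
  have hc0 : 0 < c := by linarith
  have hnn := cappedRatio_nonneg (obs := obs) hobs.mem.1 hc0.le
  have hstart : liftPotential (cappedRatio obs p c) (explore T tie 1 []) ≤ 1 := by
    refine (liftPotential_explore_le hnn 1 []).trans (le_of_eq ?_)
    rw [cappedRatio, if_pos (consistent_nil p hc)]
    have : sampleCount obs ([] : List (Episode S A T.H)) = fun _ => 0 := by
      funext x; simp [sampleCount]
    rw [this, laplaceRatio_zero]
  refine le_trans ?_ (div_le_div_of_nonneg_right hstart hc0.le)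
  refine bee_measureReal_exists_le hrun
    (B := fun s z => ∃ k d, s = .exploring k d ∧ ¬ Consistent obs p c (d ++ [z]))
    (G := liftPotential (cappedRatio obs p c)) ?_ ?_ hc0 ?_
  · rintro ans z ⟨k, d, h, -⟩
    simp at h
  · rintro (⟨k, d⟩ | ⟨k, d, π, X⟩ | ans) -
    · exact hnn d
    · exact hnn d
    · exact le_rfl
  · rintro (⟨k, d⟩ | ⟨k, d, π, X⟩ | ans) π' - hdec
    · refine le_trans (expect_mono fun z _ => ?_) (expect_cappedRatio_le hobs c π' d)
      split_ifs with hB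
      · obtain ⟨k', d', h, hB⟩ := hB
        simp only [BEEState.exploring.injEq] at h
        rw [cappedRatio, if_neg (h.2 ▸ hB)]
      · exact liftPotential_explore_le hnn k (d ++ [z])
    · refine le_trans (expect_mono fun z _ => ?_) (expect_const D π' (cappedRatio obs p c d)).le
      rw [if_neg (by rintro ⟨k, d, h, -⟩; simp at h), update]
      split_ifs
      · exact hnn d
      · exact le_rfl
      · exact liftPotential_explore_le hnn (k + 1) d
    · simp [nextDecision] at hdec

/-- All exploration histories of the run are reliable at the level of phase `k`, including a
history with which BEE-GPI terminates. -/
def ReliableRun (T : Task S A) (tie : ArgmaxRule S A T.H) (D : Dynamics S A T.H)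
    (Z : ℕ → Ω → Episode S A T.H) (k : ℕ) (ω : Ω) : Prop :=
  ∀ n, Reliable T D k (beeMemory T tie Z n ω).data ∧
    ∀ j d, beeMemory T tie Z n ω = .exploring j d → Reliable T D k (d ++ [Z n ω])

/-- With probability at least `1 - δ_k`, all exploration histories of a run are reliable. -/
theorem measureReal_not_reliable_le [MeasurableSpace Ω] {ℙ : Measure Ω} [IsProbabilityMeasure ℙ]
    {Z : ℕ → Ω → Episode S A T.H} (hrun : IsRun (beeGPI T tie) D ℙ Z) (k : ℕ) :
    ℙ.real {ω | ¬ ReliableRun T tie D Z k ω} ≤ deltaK k := by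
  have hsub : {ω | ¬ ReliableRun T tie D Z k ω}
      ⊆ ⋃ i, {ω | ∃ n, ∃ j d, beeMemory T tie Z n ω = .exploring j d ∧
          ¬ Consistent (nextStateSample i) (D.nextStateLaw i)
            (2 * Fintype.card S * Fintype.card A * T.H / deltaK k) (d ++ [Z n ω])} := by
    intro ω hω
    by_contra hcon
    apply hω
    have hnew : ∀ n j d, beeMemory T tie Z n ω = .exploring j d → Reliable T D k d →
        Reliable T D k (d ++ [Z n ω]) := by
      intro n j d hs ih d' hd' i
      rcases List.prefix_concat_iff.1 hd' with rfl | hd'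
      · by_contra hi
        exact hcon (Set.mem_iUnion.2 ⟨i, n, j, d, hs, hi⟩)
      · exact ih d' hd' i
    have hdata : ∀ n, Reliable T D k (beeMemory T tie Z n ω).data := by
      intro n
      induction n with
      | zero =>
        rw [beeMemory_zero]
        rcases data_explore T tie 1 [] with h | h <;> rw [h] <;> exact reliable_nil T D k
      | succ n ih =>
        rw [beeMemory_succ]
        rcases hs : beeMemory T tie Z n ω with ⟨j, d⟩ | ⟨j, d, π, X⟩ | ans
        · rw [hs] at ih
          rw [update]
          rcases data_explore T tie j (d ++ [Z n ω]) with h | h <;> rw [h]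
          · exact hnew n j d hs ih
          · exact reliable_nil T D k
        · rw [hs] at ih
          rw [update]
          split_ifs
          · exact reliable_nil T D k
          · exact ih
          · rcases data_explore T tie (j + 1) d with h | h <;> rw [h]
            · exact ih
            · exact reliable_nil T D k
        · exact reliable_nil T D k
    refine fun n => ⟨hdata n, fun j d hs => hnew n j d hs ?_⟩
    have := hdata n
    rw [hs] at this
    exact this
  refine (measureReal_mono hsub).trans ((measureReal_iUnion_fintype_le _).trans ?_)
  have hS : (1 : ℝ) ≤ Fintype.card S := by exact_mod_cast Fintype.card_pos
  have hA : (1 : ℝ) ≤ Fintype.card A := by exact_mod_cast Fintype.card_pos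
  have hH : (1 : ℝ) ≤ T.H := by exact_mod_cast T.H_pos
  have hδ : 0 < deltaK k := by rw [deltaK]; positivity
  refine (Finset.sum_le_sum fun i _ => measureReal_inconsistent_le hrun
    (samplesFrom_nextStateLaw D i) (one_le_reliableLevel T k)).trans ?_
  rw [Finset.sum_const, Finset.card_univ, Fintype.card_option, Fintype.card_prod,
    Fintype.card_prod, Fintype.card_fin, nsmul_eq_mul, one_div_div]
  push_cast
  rw [mul_div_assoc', div_le_iff₀ (by positivity)]
  have h1 : (1 : ℝ) ≤ T.H * (Fintype.card S * Fintype.card A) :=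
    one_le_mul_of_one_le_of_one_le hH (one_le_mul_of_one_le_of_one_le hS hA)
  nlinarith

end ReliableRuns

/-! ### Optimism, pessimism, and the width of the confidence bounds -/

section Simplex

variable {S : Type u} [Fintype S]

theorem le_maxExp {𝒞 : Set (S → ℝ)} (h𝒞 : 𝒞 ⊆ stdSimplex ℝ S) {p : S → ℝ} (hp : p ∈ 𝒞)
    (V : S → ℝ) : ∑ s, p s * V s ≤ maxExp 𝒞 V := by
  refine le_csSup ⟨∑ s, |V s|, ?_⟩ ⟨p, hp, rfl⟩
  rintro _ ⟨q, hq, rfl⟩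
  refine Finset.sum_le_sum fun s _ => ?_
  have h1 := (h𝒞 hq).1 s
  have h2 : q s ≤ 1 := by
    rw [← (h𝒞 hq).2]
    exact Finset.single_le_sum (fun t _ => (h𝒞 hq).1 t) (Finset.mem_univ s)
  nlinarith [le_abs_self (V s), abs_nonneg (V s)]

theorem minExp_eq_neg_maxExp (𝒞 : Set (S → ℝ)) (V : S → ℝ) :
    minExp 𝒞 V = - maxExp 𝒞 (fun s => - V s) := by
  unfold minExp maxExp
  rw [Real.sInf_def]
  congr 2
  ext x
  simp only [Set.mem_neg, Set.mem_image, mul_neg, Finset.sum_neg_distrib]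
  exact ⟨fun ⟨q, hq, h⟩ => ⟨q, hq, by rw [h, neg_neg]⟩,
    fun ⟨q, hq, h⟩ => ⟨q, hq, by rw [← h, neg_neg]⟩⟩

theorem minExp_le {𝒞 : Set (S → ℝ)} (h𝒞 : 𝒞 ⊆ stdSimplex ℝ S) {p : S → ℝ} (hp : p ∈ 𝒞)
    (V : S → ℝ) : minExp 𝒞 V ≤ ∑ s, p s * V s := by
  have := le_maxExp h𝒞 hp (fun s => - V s)
  simp only [mul_neg, Finset.sum_neg_distrib] at this
  rw [minExp_eq_neg_maxExp]
  linarith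

theorem maxExp_le {𝒞 : Set (S → ℝ)} {p : S → ℝ} (hp : p ∈ 𝒞) {V : S → ℝ} {b : ℝ}
    (h : ∀ q ∈ 𝒞, ∑ s, q s * V s ≤ b) : maxExp 𝒞 V ≤ b := by
  refine csSup_le ⟨_, p, hp, rfl⟩ ?_
  rintro _ ⟨q, hq, rfl⟩
  exact h q hq

theorem sum_mul_le_of_mem_stdSimplex {q V : S → ℝ} (hq : q ∈ stdSimplex ℝ S) {b : ℝ}
    (h : ∀ s, V s ≤ b) : ∑ s, q s * V s ≤ b := by
  calc _ ≤ ∑ s, q s * b := Finset.sum_le_sum fun s _ => mul_le_mul_of_nonneg_left (h s) (hq.1 s)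
    _ = b := by rw [← Finset.sum_mul, hq.2, one_mul]

/-- A form of Pinsker's inequality with a weaker constant, by comparison with the squared Hellinger
distance. -/
theorem sum_abs_sub_le_of_finKL_le {p q : S → ℝ} (hp : p ∈ stdSimplex ℝ S)
    (hq : q ∈ stdSimplex ℝ S) {b : ℝ} (h : finKL p q ≤ ((b : ℝ) : EReal)) :
    ∑ s, |p s - q s| ≤ 2 * Real.sqrt b := by
  rw [finKL] at h
  split_ifs at h with hsupp
  swap
  · exact absurd h (by simp)
  rw [EReal.coe_le_coe_iff] at h
  -- `p log (p / q) = -2 p log √(q / p) ≥ 2 p (1 - √(q / p))`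
  have hterm : ∀ s, (Real.sqrt (p s) - Real.sqrt (q s)) ^ 2 + p s - q s
      ≤ p s * Real.log (p s / q s) := by
    intro s
    have hps := hp.1 s
    have hqs := hq.1 s
    have e1 := Real.sq_sqrt hps
    have e2 := Real.sq_sqrt hqs
    rcases hps.eq_or_lt with h0 | hpos
    · rw [← h0]
      simp [e2]
    · have hqpos : 0 < q s := lt_of_le_of_ne hqs fun h0 => hpos.ne' (hsupp s h0.symm)
      have hsp := Real.sqrt_pos.2 hpos
      have hsq := Real.sqrt_pos.2 hqpos
      have hl : Real.log (p s / q s) = - (2 * Real.log (Real.sqrt (q s) / Real.sqrt (p s))) := by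
        rw [Real.log_div hpos.ne' hqpos.ne', Real.log_div hsq.ne' hsp.ne', Real.log_sqrt hqs,
          Real.log_sqrt hps]
        ring
      have hl2 := Real.log_le_sub_one_of_pos (div_pos hsq hsp)
      have hl3 : p s * Real.log (Real.sqrt (q s) / Real.sqrt (p s))
          ≤ Real.sqrt (p s) * Real.sqrt (q s) - p s := by
        calc _ ≤ p s * (Real.sqrt (q s) / Real.sqrt (p s) - 1) :=
              mul_le_mul_of_nonneg_left hl2 hps
          _ = _ := by
              have : p s * (Real.sqrt (q s) / Real.sqrt (p s))
                  = Real.sqrt (p s) * Real.sqrt (q s) := by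
                field_simp
                exact e1.symm
              rw [mul_sub, this, mul_one]
      rw [hl]
      nlinarith
  have hHell : ∑ s, (Real.sqrt (p s) - Real.sqrt (q s)) ^ 2 ≤ b := by
    have := Finset.sum_le_sum fun s (_ : s ∈ Finset.univ) => hterm s
    simp only [Finset.sum_add_distrib, Finset.sum_sub_distrib] at this
    rw [hp.2, hq.2] at this
    linarith
  have hb : 0 ≤ b := (Finset.sum_nonneg fun s _ => sq_nonneg _).trans hHell
  have hCS : (∑ s, |Real.sqrt (p s) - Real.sqrt (q s)| * (Real.sqrt (p s) + Real.sqrt (q s))) ^ 2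
      ≤ (∑ s, |Real.sqrt (p s) - Real.sqrt (q s)| ^ 2)
        * ∑ s, (Real.sqrt (p s) + Real.sqrt (q s)) ^ 2 :=
    Finset.sum_mul_sq_le_sq_mul_sq _ _ _
  have heq : ∀ s, |p s - q s|
      = |Real.sqrt (p s) - Real.sqrt (q s)| * (Real.sqrt (p s) + Real.sqrt (q s)) := by
    intro s
    have e1 := Real.sq_sqrt (hp.1 s)
    have e2 := Real.sq_sqrt (hq.1 s)
    have e3 : 0 ≤ Real.sqrt (p s) + Real.sqrt (q s) := by positivity
    rw [← abs_of_nonneg e3, ← abs_mul]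
    congr 1
    nlinarith
  have h4 : ∑ s, (Real.sqrt (p s) + Real.sqrt (q s)) ^ 2 ≤ 4 := by
    calc _ ≤ ∑ s, 2 * (p s + q s) := by
          refine Finset.sum_le_sum fun s _ => ?_
          have e1 := Real.sq_sqrt (hp.1 s)
          have e2 := Real.sq_sqrt (hq.1 s)
          nlinarith [sq_nonneg (Real.sqrt (p s) - Real.sqrt (q s))]
      _ = 4 := by rw [← Finset.mul_sum, Finset.sum_add_distrib, hp.2, hq.2]; norm_num
  simp only [sq_abs] at hCS
  simp only [heq]
  refine abs_le_of_sq_le_sq' ?_ (by positivity) |>.2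
  rw [mul_pow, Real.sq_sqrt hb]
  have h5 : 0 ≤ ∑ s, (Real.sqrt (p s) - Real.sqrt (q s)) ^ 2 :=
    Finset.sum_nonneg fun s _ => sq_nonneg _
  nlinarith

end Simplex

section Confidence

variable {S : Type u} {A : Type v} [Fintype S] [Fintype A] [Nonempty S] [Nonempty A]

theorem confSet_subset (T : Task S A) (δ' : ℝ) (n : ℕ) (p : S → ℝ) :
    confSet T δ' n p ⊆ stdSimplex ℝ S := fun _ h => h.1

theorem betaP_mono (T : Task S A) (δ' : ℝ) {m n : ℕ} (hmn : m ≤ n) :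
    betaP T m δ' ≤ betaP T n δ' := by
  have hS : (1 : ℝ) ≤ Fintype.card S := by exact_mod_cast Fintype.card_pos
  unfold betaP
  have : (m : ℝ) ≤ n := by exact_mod_cast hmn
  rcases hS.eq_or_lt with h | h
  · rw [← h]; simp
  · have h' : 0 < (Fintype.card S : ℝ) - 1 := by linarith
    gcongr

theorem half_le_betaP (T : Task S A) (k n : ℕ) : 1 / 2 ≤ betaP T n (deltaK k) := by
  have hS : (1 : ℝ) ≤ Fintype.card S := by exact_mod_cast Fintype.card_pos
  have h1 := log_ratio_ge T k
  unfold betaP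
  have h' : 0 ≤ (Fintype.card S : ℝ) - 1 := by linarith
  have h2 : (1 : ℝ) ≤ Real.exp 1 * (1 + (n : ℝ) / ((Fintype.card S : ℝ) - 1)) := by
    refine one_le_mul_of_one_le_of_one_le (Real.one_le_exp zero_le_one) ?_
    have : 0 ≤ (n : ℝ) / ((Fintype.card S : ℝ) - 1) := by positivity
    linarith
  have := mul_nonneg h' (Real.log_nonneg h2)
  linarith

/-- The `ℓ¹` diameter of a confidence set. The bound covers `n = 0` as well, where the confidence
set is the whole simplex. -/
theorem sum_abs_sub_le_of_mem_confSet (T : Task S A) {δ' : ℝ} {n : ℕ} {p : S → ℝ}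
    (hp : 0 < n → p ∈ stdSimplex ℝ S) {b : ℝ} (hb : betaP T n δ' ≤ b) (hb2 : 1 / 2 ≤ b)
    {q₁ q₂ : S → ℝ} (h₁ : q₁ ∈ confSet T δ' n p) (h₂ : q₂ ∈ confSet T δ' n p) :
    ∑ s, |q₁ s - q₂ s| ≤ 8 * Real.sqrt b * (1 / Real.sqrt (n + 1)) := by
  rcases Nat.eq_zero_or_pos n with rfl | hn
  · have h : ∑ s, |q₁ s - q₂ s| ≤ 2 := by
      calc _ ≤ ∑ s, (q₁ s + q₂ s) := Finset.sum_le_sum fun s _ => by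
            have e1 := h₁.1.1 s
            have e2 := h₂.1.1 s
            exact abs_sub_le_iff.2 ⟨by linarith, by linarith⟩
        _ = 2 := by rw [Finset.sum_add_distrib, h₁.1.2, h₂.1.2]; norm_num
    have h2 : (1 / 4 : ℝ) ≤ Real.sqrt b := Real.le_sqrt_of_sq_le (by linarith)
    simp only [Nat.cast_zero, zero_add, Real.sqrt_one]
    linarith
  · have hn' : (1 : ℝ) ≤ n := by exact_mod_cast hn
    have hle : Real.sqrt (betaP T n δ' / n) ≤ 2 * (Real.sqrt b * (1 / Real.sqrt (n + 1))) := by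
      have : 2 * (Real.sqrt b * (1 / Real.sqrt (n + 1))) = Real.sqrt (4 * (b / (n + 1))) := by
        rw [Real.sqrt_mul (by norm_num), Real.sqrt_div (by linarith),
          show (4 : ℝ) = 2 ^ 2 by norm_num, Real.sqrt_sq (by norm_num)]
        ring
      rw [this]
      refine Real.sqrt_le_sqrt ?_
      rw [div_le_iff₀ (by linarith), mul_div_assoc', div_mul_eq_mul_div, le_div_iff₀ (by linarith)]
      nlinarith
    have g : ∀ q ∈ confSet T δ' n p, ∑ s, |p s - q s| ≤ 2 * Real.sqrt (betaP T n δ' / n) :=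
      fun q hq => sum_abs_sub_le_of_finKL_le (hp hn) hq.1 (hq.2.resolve_left hn.ne')
    have g1 := g q₁ h₁
    have g2 := g q₂ h₂
    calc _ ≤ ∑ s, (|p s - q₁ s| + |p s - q₂ s|) := Finset.sum_le_sum fun s _ => by
          rw [abs_sub_comm (p s) (q₁ s)]
          exact abs_sub_le _ _ _
      _ ≤ _ := by
          rw [Finset.sum_add_distrib]
          linarith

/-- One step of the recursion for the width of the confidence bounds: up to a bonus, the difference
of the optimistic and the pessimistic value is passed on along any `q` in the confidence set. -/
theorem maxExp_sub_minExp_le (T : Task S A) {δ' : ℝ} {n : ℕ} {p : S → ℝ}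
    (hp : 0 < n → p ∈ stdSimplex ℝ S) {b : ℝ} (hb : betaP T n δ' ≤ b) (hb2 : 1 / 2 ≤ b)
    {q : S → ℝ} (hq : q ∈ confSet T δ' n p) {V W : S → ℝ} {M : ℝ} (hV : ∀ s, |V s| ≤ M)
    (hW : ∀ s, |W s| ≤ M) :
    maxExp (confSet T δ' n p) V - minExp (confSet T δ' n p) W
      ≤ 16 * M * Real.sqrt b * (1 / Real.sqrt (n + 1)) + ∑ s, q s * (V s - W s) := by
  have key : ∀ V : S → ℝ, (∀ s, |V s| ≤ M) → maxExp (confSet T δ' n p) V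
      ≤ ∑ s, q s * V s + M * (8 * Real.sqrt b * (1 / Real.sqrt (n + 1))) := by
    intro V hV
    have hM : 0 ≤ M := (abs_nonneg _).trans (hV (Classical.arbitrary S))
    refine maxExp_le hq fun q' hq' => ?_
    have h1 : ∑ s, q' s * V s - ∑ s, q s * V s ≤ M * ∑ s, |q' s - q s| := by
      rw [← Finset.sum_sub_distrib, Finset.mul_sum]
      refine Finset.sum_le_sum fun s _ => ?_
      calc q' s * V s - q s * V s = (q' s - q s) * V s := by ring
        _ ≤ |q' s - q s| * |V s| := by rw [← abs_mul]; exact le_abs_self _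
        _ ≤ |q' s - q s| * M := mul_le_mul_of_nonneg_left (hV s) (abs_nonneg _)
        _ = _ := mul_comm _ _
    have h2 := mul_le_mul_of_nonneg_left (sum_abs_sub_le_of_mem_confSet T hp hb hb2 hq' hq) hM
    linarith
  have k1 := key V hV
  have k2 := key (fun s => - W s) (fun s => by rw [abs_neg]; exact hW s)
  rw [minExp_eq_neg_maxExp]
  simp only [mul_neg, Finset.sum_neg_distrib, mul_sub, Finset.sum_sub_distrib] at k2 ⊢
  linarith

variable {T : Task S A} {D : Dynamics S A T.H} {k : ℕ} {d : List (Episode S A T.H)}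

theorem valueFrom_le_optimisticV (hd : Reliable T D k d) (π : Policy S A T.H) (h : ℕ) (s : S) :
    valueFrom T D π h s ≤ optimisticV T d (deltaK k) h s := by
  induction hm : T.H - h generalizing h s with
  | zero =>
    rw [valueFrom, dif_neg (by omega), optimisticV, dif_neg (by omega)]
  | succ m ih =>
    have hh : h < T.H := by omega
    rw [valueFrom, dif_pos hh, optimisticV, dif_pos hh]
    refine le_trans ?_ (Finset.le_sup' _ (Finset.mem_univ (π ⟨h, hh⟩ s)))
    refine add_le_add le_rfl (le_trans ?_ (le_maxExp (confSet_subset _ _ _ _)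
      (mem_confTrans_of_reliable hd ⟨h, hh⟩ s (π ⟨h, hh⟩ s)) _))
    exact Finset.sum_le_sum fun s' _ => mul_le_mul_of_nonneg_left (ih (h + 1) s' (by omega))
      ((D.P_mem _ _ _).1 _)

theorem pessimisticV_le_valueFrom (hd : Reliable T D k d) (π : Policy S A T.H) (h : ℕ) (s : S) :
    pessimisticV T d (deltaK k) π h s ≤ valueFrom T D π h s := by
  induction hm : T.H - h generalizing h s with
  | zero =>
    rw [valueFrom, dif_neg (by omega), pessimisticV, dif_neg (by omega)]
  | succ m ih =>
    have hh : h < T.H := by omega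
    rw [valueFrom, dif_pos hh, pessimisticV, dif_pos hh]
    refine add_le_add le_rfl (le_trans (minExp_le (confSet_subset _ _ _ _)
      (mem_confTrans_of_reliable hd ⟨h, hh⟩ s (π ⟨h, hh⟩ s)) _) ?_)
    exact Finset.sum_le_sum fun s' _ => mul_le_mul_of_nonneg_left (ih (h + 1) s' (by omega))
      ((D.P_mem _ _ _).1 _)

theorem optimisticV_le (hd : Reliable T D k d) (h : ℕ) (s : S) :
    optimisticV T d (deltaK k) h s ≤ (T.H - h : ℕ) := by
  induction hm : T.H - h generalizing h s with
  | zero => rw [optimisticV, dif_neg (by omega)]; simp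
  | succ m ih =>
    have hh : h < T.H := by omega
    rw [optimisticV, dif_pos hh]
    refine Finset.sup'_le _ _ fun a _ => ?_
    have h1 := T.r_le_one ⟨h, hh⟩ s a
    have h2 : maxExp (confTrans T d (deltaK k) ⟨h, hh⟩ s a)
        (fun s' => optimisticV T d (deltaK k) (h + 1) s') ≤ (m : ℕ) :=
      maxExp_le (mem_confTrans_of_reliable hd ⟨h, hh⟩ s a) fun q hq =>
        sum_mul_le_of_mem_stdSimplex hq.1 fun s' => ih (h + 1) s' (by omega)
    rw [optimisticQ]
    push_cast
    linarith

theorem pessimisticV_nonneg (hd : Reliable T D k d) (π : Policy S A T.H) (h : ℕ) (s : S) :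
    0 ≤ pessimisticV T d (deltaK k) π h s := by
  induction hm : T.H - h generalizing h s with
  | zero => rw [pessimisticV, dif_neg (by omega)]
  | succ m ih =>
    have hh : h < T.H := by omega
    rw [pessimisticV, dif_pos hh, minExp_eq_neg_maxExp]
    have h1 := T.r_nonneg ⟨h, hh⟩ s (π ⟨h, hh⟩ s)
    have h2 : maxExp (confTrans T d (deltaK k) ⟨h, hh⟩ s (π ⟨h, hh⟩ s))
        (fun s' => - pessimisticV T d (deltaK k) π (h + 1) s') ≤ 0 :=
      maxExp_le (mem_confTrans_of_reliable hd ⟨h, hh⟩ s (π ⟨h, hh⟩ s)) fun q hq =>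
        sum_mul_le_of_mem_stdSimplex hq.1 fun s' => neg_nonpos.2 (ih (h + 1) s' (by omega))
    linarith

theorem value_le_optimisticV0 (hd : Reliable T D k d) (π : Policy S A T.H) :
    value T D π ≤ optimisticV0 T d (deltaK k) :=
  (Finset.sum_le_sum fun s _ => mul_le_mul_of_nonneg_left (valueFrom_le_optimisticV hd π 0 s)
    (D.init_mem.1 s)).trans (le_maxExp (confSet_subset _ _ _ _) (mem_confInit_of_reliable hd) _)

theorem optValue_le_optimisticV0 (hd : Reliable T D k d) :
    optValue T D ≤ optimisticV0 T d (deltaK k) := by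
  classical
  exact Finset.sup'_le _ _ fun π _ => value_le_optimisticV0 hd π

theorem pessimisticV0_le_value (hd : Reliable T D k d) (π : Policy S A T.H) :
    pessimisticV0 T d (deltaK k) π ≤ value T D π :=
  (minExp_le (confSet_subset _ _ _ _) (mem_confInit_of_reliable hd) _).trans
    (Finset.sum_le_sum fun s _ => mul_le_mul_of_nonneg_left (pessimisticV_le_valueFrom hd π 0 s)
      (D.init_mem.1 s))

theorem value_le_optValue (T : Task S A) (D : Dynamics S A T.H) (π : Policy S A T.H) :
    value T D π ≤ optValue T D := by
  classical
  exact Finset.le_sup' (fun π => value T D π) (Finset.mem_univ π)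

theorem abs_optimisticV_le (hd : Reliable T D k d) (h : ℕ) (s : S) :
    |optimisticV T d (deltaK k) h s| ≤ T.H := by
  have π : Policy S A T.H := fun _ _ => Classical.arbitrary A
  have h1 := pessimisticV_nonneg hd π h s
  have h2 := pessimisticV_le_valueFrom hd π h s
  have h3 := valueFrom_le_optimisticV hd π h s
  have h4 := optimisticV_le hd h s
  have h5 : ((T.H - h : ℕ) : ℝ) ≤ T.H := by exact_mod_cast Nat.sub_le _ _
  rw [abs_of_nonneg (by linarith)]
  linarith

theorem abs_pessimisticV_le (hd : Reliable T D k d) (π : Policy S A T.H) (h : ℕ) (s : S) :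
    |pessimisticV T d (deltaK k) π h s| ≤ T.H := by
  have h1 := pessimisticV_nonneg hd π h s
  have h2 := pessimisticV_le_valueFrom hd π h s
  have h3 := valueFrom_le_optimisticV hd π h s
  have h4 := optimisticV_le hd h s
  have h5 : ((T.H - h : ℕ) : ℝ) ≤ T.H := by exact_mod_cast Nat.sub_le _ _
  rw [abs_of_nonneg h1]
  linarith

theorem pHat_mem_stdSimplex (h : Fin T.H) (s : S) (a : A) (hpos : 0 < visits d h s a) :
    pHat d h s a ∈ stdSimplex ℝ S := by
  have hpos' : (0 : ℝ) < visits d h s a := by exact_mod_cast hpos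
  rw [pHat_eq_sampleCount_div hpos]
  refine ⟨fun x => by positivity, ?_⟩
  rw [← Finset.sum_div, ← Nat.cast_sum, sum_sampleCount_some, div_self hpos'.ne']

theorem pHatInit_mem_stdSimplex (hpos : 0 < d.length) : pHatInit d ∈ stdSimplex ℝ S := by
  have hpos' : (0 : ℝ) < d.length := by exact_mod_cast hpos
  rw [pHatInit_eq_sampleCount_div hpos]
  refine ⟨fun x => by positivity, ?_⟩
  rw [← Finset.sum_div, ← Nat.cast_sum, sum_sampleCount_none, div_self hpos'.ne']

theorem visits_le_length (d : List (Episode S A T.H)) (h : Fin T.H) (s : S) (a : A) :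
    visits d h s a ≤ d.length := by
  unfold visits
  exact List.countP_le_length

/-- The width of the confidence interval for the value of the optimistic policy is controlled by
the expected sum of the bonuses `1 / √(n + 1)` along an episode of this policy. -/
theorem width_le (tie : ArgmaxRule S A T.H) (hd : Reliable T D k d) {b : ℝ}
    (hb : betaP T d.length (deltaK k) ≤ b) :
    optimisticV0 T d (deltaK k) - pessimisticV0 T d (deltaK k) (optimisticPolicy T tie k d)
      ≤ 16 * T.H * Real.sqrt b * (1 / Real.sqrt (d.length + 1)
        + expect D (optimisticPolicy T tie k d) (fun z => ∑ h : Fin T.H,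
            1 / Real.sqrt (visits d h (z.1 h.castSucc) (z.2 h) + 1))) := by
  set π := optimisticPolicy T tie k d with hπ
  have hb2 : 1 / 2 ≤ b := (half_le_betaP T k _).trans hb
  have hrec := sum_init_le_expect_sum D π
    (fun h s a => 16 * T.H * Real.sqrt b * (1 / Real.sqrt (visits d h s a + 1)))
    (fun h s => optimisticV T d (deltaK k) h s - pessimisticV T d (deltaK k) π h s)
    (fun s => by
      rw [optimisticV, dif_neg (lt_irrefl _), pessimisticV, dif_neg (lt_irrefl _), sub_zero])
    (fun h s => by
      rw [pessimisticV, dif_pos h.2, optimisticV, dif_pos h.2]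
      have h1 : Finset.univ.sup' Finset.univ_nonempty (optimisticQ T d (deltaK k)
            (fun s' => optimisticV T d (deltaK k) (h + 1) s') h s)
          ≤ optimisticQ T d (deltaK k)
            (fun s' => optimisticV T d (deltaK k) (h + 1) s') h s (π h s) :=
        Finset.sup'_le _ _ fun a _ => tie.le_choose d k h s _ a
      have h2 := maxExp_sub_minExp_le T (pHat_mem_stdSimplex (d := d) h s (π h s))
        ((betaP_mono T (deltaK k) (visits_le_length d h s (π h s))).trans hb) hb2
        (mem_confTrans_of_reliable hd h s (π h s))
        (abs_optimisticV_le hd (h + 1)) (abs_pessimisticV_le hd π (h + 1))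
      rw [optimisticQ, confTrans] at h1
      rw [confTrans]
      simp only [Fin.eta]
      linarith)
  have h0 := maxExp_sub_minExp_le T (pHatInit_mem_stdSimplex (d := d)) hb hb2
    (mem_confInit_of_reliable hd) (abs_optimisticV_le hd 0) (abs_pessimisticV_le hd π 0)
  simp only [← Finset.mul_sum] at hrec
  rw [expect_const_mul] at hrec
  rw [optimisticV0, pessimisticV0, confInit]
  linarith

end Confidence

/-! ### The exploitation stage -/

section Exploit

variable {S : Type u} {A : Type v} [Fintype S] [Fintype A] [Nonempty S] [Nonempty A]
  {Ω : Type w} {T : Task S A} {tie : ArgmaxRule S A T.H} {D : Dynamics S A T.H}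

/-- A potential which is `M` until the exploitation stage of phase `k`, is `v` during this stage,
and `0` afterwards. -/
noncomputable def exploitPotential {H : ℕ} (k : ℕ) (M : ℝ)
    (v : Policy S A H → List ℝ → ℝ) : BEEState S A H → ℝ
  | .exploring k' _ => if k' ≤ k then M else 0
  | .exploiting k' _ π X => if k' < k then M else if k' = k then v π X else 0
  | .finished _ => 0

/-- The maximal inequality for the exploitation stage of phase `k`: if `v` is a supermartingale
during this stage and starts below `M`, then it ever exceeds `c` with probability at most `M / c`,
in particular if the rewards ever have a property `b` that implies `c ≤ v`. -/
theorem measureReal_exploit_le [MeasurableSpace Ω] {ℙ : Measure Ω} [IsProbabilityMeasure ℙ]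
    {Z : ℕ → Ω → Episode S A T.H} (hrun : IsRun (beeGPI T tie) D ℙ Z) (k : ℕ)
    {v : Policy S A T.H → List ℝ → ℝ} (hv : ∀ π X, 0 ≤ v π X) {M : ℝ} (hM : 0 ≤ M)
    (hnil : ∀ π, v π [] ≤ M)
    (hstep : ∀ π X, (X.length : ℝ) ≤ exploitBudget T k - 1 →
      expect D π (fun z => v π (X ++ [totalReward T z])) ≤ v π X)
    {b : Policy S A T.H → List ℝ → Prop} {c : ℝ} (hc : 0 < c)
    (hb : ∀ π X, (X.length : ℝ) ≤ exploitBudget T k → b π X → c ≤ v π X) :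
    ℙ.real {ω | ∃ n d π X, beeMemory T tie Z n ω = .exploiting k d π X ∧
      b π (X ++ [totalReward T (Z n ω)])} ≤ M / c := by
  classical
  have hexp : ∀ k' d, exploitPotential k M v (explore T tie k' d) ≤ if k' ≤ k then M else 0 := by
    intro k' d
    obtain ⟨k₁, hk₁, -, ⟨h, -⟩ | ⟨h, -⟩ | ⟨h, -⟩⟩ := explore_cases T tie k' d <;>
      rw [h, exploitPotential]
    · split_ifs <;> first | exact le_rfl | exact hM | omega
    · split_ifs <;> first | exact le_rfl | exact hM | exact hnil _ | omega
    · split_ifs <;> first | exact le_rfl | exact hM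
  have hstart : exploitPotential k M v (explore T tie 1 []) ≤ M := by
    refine (hexp 1 []).trans ?_
    split_ifs
    · exact le_rfl
    · exact hM
  refine le_trans ?_ (div_le_div_of_nonneg_right hstart hc.le)
  refine bee_measureReal_exists_le hrun (G := exploitPotential k M v)
    (B := fun s z => ∃ d π X, s = .exploiting k d π X ∧ b π (X ++ [totalReward T z])) ?_ ?_ hc ?_
  · rintro ans z ⟨d, π, X, h, -⟩
    simp at h
  · rintro (⟨k', d⟩ | ⟨k', d, π, X⟩ | ans) - <;> rw [exploitPotential]
    · split_ifs <;> first | exact le_rfl | exact hM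
    · split_ifs <;> first | exact le_rfl | exact hM | exact hv _ _
  · rintro (⟨k', d⟩ | ⟨k', d, π, X⟩ | ans) π' hinv hdec
    · refine le_trans (expect_mono fun z _ => ?_)
        (expect_const D π' (exploitPotential k M v (.exploring k' d))).le
      rw [if_neg (by rintro ⟨d, π, X, h, -⟩; simp at h)]
      exact hexp k' _
    · have hπ : π = π' := by simpa [nextDecision] using hdec
      subst hπ
      rcases lt_trichotomy k' k with hlt | rfl | hgt
      · refine le_trans (expect_mono fun z _ => ?_)
          (expect_const D π (exploitPotential k M v (.exploiting k' d π X))).le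
        rw [if_neg (by rintro ⟨d, π, X, h, -⟩; simp at h; omega), exploitPotential, if_pos hlt,
          update]
        split_ifs
        · exact hM
        · rw [exploitPotential, if_pos hlt]
        · refine (hexp _ _).trans ?_
          split_ifs
          · exact le_rfl
          · exact hM
      · have hX := hinv.2.2.2
        have hv' : exploitPotential k' M v (.exploiting k' d π X) = v π X := by
          rw [exploitPotential, if_neg (lt_irrefl _), if_pos rfl]
        rw [hv']
        refine le_trans (expect_mono fun z _ => ?_) (hstep π X hX)
        have hlen : ((X ++ [totalReward T z]).length : ℝ) ≤ exploitBudget T k' := by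
          simp only [List.length_append, List.length_singleton, Nat.cast_add, Nat.cast_one]
          linarith
        split_ifs with hB
        · obtain ⟨d₁, π₁, X₁, h, hB⟩ := hB
          simp only [BEEState.exploiting.injEq] at h
          obtain ⟨-, -, rfl, rfl⟩ := h
          exact hb _ _ hlen hB
        · rw [update]
          split_ifs
          · exact hv _ _
          · rw [exploitPotential, if_neg (lt_irrefl _), if_pos rfl]
          · refine (hexp _ _).trans ?_
            rw [if_neg (by omega)]
            exact hv _ _
      · refine le_trans (expect_mono fun z _ => ?_)
          (expect_const D π (exploitPotential k M v (.exploiting k' d π X))).le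
        rw [if_neg (by rintro ⟨d, π, X, h, -⟩; simp at h; omega), exploitPotential,
          if_neg (by omega), if_neg (by omega), update]
        split_ifs
        · exact le_rfl
        · rw [exploitPotential, if_neg (by omega), if_neg (by omega)]
        · refine (hexp _ _).trans ?_
          rw [if_neg (by omega)]
    · simp [nextDecision] at hdec

/-- The exponential supermartingale of the total rewards for deviations above `μ₀`. -/
noncomputable def expDeviation (T : Task S A) (l : ℝ) (X : List ℝ) : ℝ :=
  Real.exp (l * (X.sum - X.length * T.μ₀) - l ^ 2 * (T.H : ℝ) ^ 2 / 8 * X.length)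

/-- For a policy of value at most `μ₀`, the exponential deviation is a supermartingale. -/
theorem expect_expDeviation_le {l : ℝ} (hl : 0 ≤ l) {π : Policy S A T.H}
    (hπ : value T D π ≤ T.μ₀) (X : List ℝ) :
    expect D π (fun z => expDeviation T l (X ++ [totalReward T z])) ≤ expDeviation T l X := by
  have heq : ∀ z : Episode S A T.H, expDeviation T l (X ++ [totalReward T z])
      = (expDeviation T l X * Real.exp (l * (value T D π - T.μ₀) - l ^ 2 * (T.H : ℝ) ^ 2 / 8))
        * Real.exp (l * (totalReward T z - value T D π)) := by
    intro z
    unfold expDeviation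
    rw [← Real.exp_add, ← Real.exp_add]
    congr 1
    simp only [List.sum_append, List.length_append, List.sum_singleton, List.length_singleton]
    push_cast
    ring
  simp only [heq]
  rw [expect_const_mul]
  have h1 := expect_exp_reward_le T D π l
  have hpos : 0 < expDeviation T l X := Real.exp_pos _
  calc _ ≤ (expDeviation T l X * Real.exp (l * (value T D π - T.μ₀) - l ^ 2 * (T.H : ℝ) ^ 2 / 8))
        * Real.exp (l ^ 2 * (T.H : ℝ) ^ 2 / 8) := mul_le_mul_of_nonneg_left h1 (by positivity)
    _ = expDeviation T l X * Real.exp (l * (value T D π - T.μ₀)) := by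
        rw [mul_assoc, ← Real.exp_add]
        congr 2
        ring
    _ ≤ expDeviation T l X * 1 := by
        refine mul_le_mul_of_nonneg_left (Real.exp_le_one_iff.2 ?_) hpos.le
        exact mul_nonpos_of_nonneg_of_nonpos hl (by linarith)
    _ = _ := mul_one _

theorem alphaK_pos (k : ℕ) : 0 < alphaK k := by rw [alphaK]; positivity

/-- If the test is passed by a list of `N` rewards with `2 ^ j ≤ N < 2 ^ (j + 1)`, then the
exponential supermartingale with a parameter adapted to `j` is large. For `N = x * 2 ^ j` and
`L = log (2 α_k (j + 1)² / δ)` its exponent is at least `L (2 √x - x / 2)`, and this is at least `L`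
because `1 ≤ x ≤ 2`. -/
theorem le_expDeviation_of_exploitPass {k j : ℕ} {X : List ℝ} (hpass : ExploitPass T k X)
    (hj : 2 ^ j ≤ X.length) (hj' : X.length < 2 ^ (j + 1)) :
    2 * alphaK k * ((j : ℝ) + 1) ^ 2 / T.δ
      ≤ expDeviation T (2 * Real.sqrt (Real.log (2 * alphaK k * ((j : ℝ) + 1) ^ 2 / T.δ))
          / (T.H * Real.sqrt (2 ^ j))) X := by
  set L := Real.log (2 * alphaK k * ((j : ℝ) + 1) ^ 2 / T.δ) with hL
  have hα : 1 ≤ alphaK k := one_le_pow₀ (by norm_num)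
  have hδ := T.δ_pos
  have hδ1 := T.δ_lt_one
  have hj0 : (0 : ℝ) ≤ j := Nat.cast_nonneg j
  have hH : (0 : ℝ) < T.H := by exact_mod_cast T.H_pos
  have hc1 : 1 ≤ 2 * alphaK k * ((j : ℝ) + 1) ^ 2 / T.δ := by
    rw [le_div_iff₀ hδ]
    nlinarith
  have hL0 : 0 ≤ L := Real.log_nonneg hc1
  have hN0 : 0 < X.length := lt_of_lt_of_le (by positivity) hj
  have hN : (0 : ℝ) < X.length := by exact_mod_cast hN0
  have hNj : (2 : ℝ) ^ j ≤ X.length := by exact_mod_cast hj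
  have hNj' : (X.length : ℝ) ≤ 2 * 2 ^ j := by
    have : (X.length : ℝ) < 2 ^ (j + 1) := by exact_mod_cast hj'
    rw [pow_succ] at this
    linarith
  have hlog2 : (j : ℝ) + 1 ≤ Real.logb 2 (2 * X.length) := by
    rw [Real.le_logb_iff_rpow_le (by norm_num) (by positivity)]
    have : (2 : ℝ) ^ ((j : ℝ) + 1) = 2 ^ j * 2 := by
      rw [Real.rpow_add (by norm_num), Real.rpow_natCast, Real.rpow_one]
    rw [this]
    linarith
  have hLN : L ≤ Real.log (2 * alphaK k * (Real.logb 2 (2 * X.length)) ^ 2 / T.δ) := by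
    refine Real.log_le_log (by linarith) ?_
    have := alphaK_pos k
    gcongr
  have hdev : T.H * Real.sqrt L * Real.sqrt X.length ≤ X.sum - X.length * T.μ₀ := by
    unfold ExploitPass at hpass
    have h1 : Real.sqrt ((T.H : ℝ) ^ 2 * L / X.length) ≤ Real.sqrt ((T.H : ℝ) ^ 2
        * Real.log (2 * alphaK k * (Real.logb 2 (2 * X.length)) ^ 2 / T.δ) / X.length) := by
      apply Real.sqrt_le_sqrt
      gcongr
    have h2 : Real.sqrt ((T.H : ℝ) ^ 2 * L / X.length) * X.length
        = T.H * Real.sqrt L * Real.sqrt X.length := by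
      rw [Real.sqrt_div (by positivity), Real.sqrt_mul (by positivity), Real.sqrt_sq hH.le]
      have h3 := Real.sq_sqrt hN.le
      have h4 := Real.sqrt_pos.2 hN
      field_simp
      rw [h3]
    have h5 : X.sum / X.length * X.length = X.sum := by field_simp
    have h6 : (T.μ₀ + Real.sqrt ((T.H : ℝ) ^ 2 * L / X.length)) * X.length
        ≤ X.sum / X.length * X.length :=
      mul_le_mul_of_nonneg_right (by linarith) hN.le
    rw [add_mul, h2, h5] at h6
    linarith
  have hs := Real.sqrt_pos.2 (show (0 : ℝ) < 2 ^ j by positivity)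
  have hs2 := Real.sq_sqrt (show (0 : ℝ) ≤ 2 ^ j by positivity)
  have hsL := Real.sq_sqrt hL0
  have hsN : Real.sqrt (2 ^ j) ≤ Real.sqrt X.length := Real.sqrt_le_sqrt hNj
  rw [expDeviation, ← Real.log_le_iff_le_exp (by linarith), ← hL]
  set sj := Real.sqrt (2 ^ j)
  have hl0 : 0 ≤ 2 * Real.sqrt L / (T.H * sj) := by positivity
  have hmain := mul_le_mul_of_nonneg_left hdev hl0
  have e1 : 2 * Real.sqrt L / (T.H * sj) * (T.H * Real.sqrt L * Real.sqrt X.length)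
      = 2 * L * (Real.sqrt X.length / sj) := by
    field_simp
    exact hsL
  have e2 : (2 * Real.sqrt L / (T.H * sj)) ^ 2 * (T.H : ℝ) ^ 2 / 8 * X.length
      = L / 2 * (X.length / 2 ^ j) := by
    rw [div_pow, mul_pow, mul_pow, hsL, hs2]
    field_simp
    ring
  rw [e1] at hmain
  rw [e2]
  have e3 : 1 ≤ Real.sqrt X.length / sj := by
    rw [le_div_iff₀ hs, one_mul]; exact hsN
  have e4 : (X.length : ℝ) / 2 ^ j ≤ 2 := by
    rw [div_le_iff₀ (by positivity)]; exact hNj'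
  nlinarith

/-- The exploitation stage of phase `k` accepts a policy of value less than `μ₀` with small
probability. The union bound is over the dyadic ranges of the number of rewards. -/
theorem measureReal_wrong_exploitPass_le [MeasurableSpace Ω] {ℙ : Measure Ω}
    [IsProbabilityMeasure ℙ] {Z : ℕ → Ω → Episode S A T.H} (hrun : IsRun (beeGPI T tie) D ℙ Z)
    (k : ℕ) :
    ℙ.real {ω | ∃ n d π X, beeMemory T tie Z n ω = .exploiting k d π X ∧
      value T D π < T.μ₀ ∧ ExploitPass T k (X ++ [totalReward T (Z n ω)])} ≤ T.δ / alphaK k := by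
  classical
  have hδ := T.δ_pos
  have hα := alphaK_pos k
  have hepoch : ∀ j : ℕ, ℙ.real {ω | ∃ n d π X, beeMemory T tie Z n ω = .exploiting k d π X ∧
      (value T D π < T.μ₀ ∧ ExploitPass T k (X ++ [totalReward T (Z n ω)]) ∧
        2 ^ j ≤ (X ++ [totalReward T (Z n ω)]).length ∧
        (X ++ [totalReward T (Z n ω)]).length < 2 ^ (j + 1))}
      ≤ 1 / (2 * alphaK k * ((j : ℝ) + 1) ^ 2 / T.δ) := by
    intro j
    set l := 2 * Real.sqrt (Real.log (2 * alphaK k * ((j : ℝ) + 1) ^ 2 / T.δ))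
          / (T.H * Real.sqrt (2 ^ j))
    have hl : 0 ≤ l := by positivity
    refine measureReal_exploit_le hrun k
      (v := fun π X => if value T D π < T.μ₀ then expDeviation T l X else 0) ?_ zero_le_one ?_ ?_
      (b := fun π X => value T D π < T.μ₀ ∧ ExploitPass T k X ∧
        2 ^ j ≤ X.length ∧ X.length < 2 ^ (j + 1)) (by positivity) ?_
    · intro π X
      split_ifs
      · exact (Real.exp_pos _).le
      · exact le_rfl
    · intro π
      split_ifs
      · simp [expDeviation]
      · exact zero_le_one
    · intro π X _
      split_ifs with h
      · exact expect_expDeviation_le hl h.le X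
      · rw [expect_const]
    · rintro π X - ⟨h1, h2, h3, h4⟩
      rw [if_pos h1]
      exact le_expDeviation_of_exploitPass h2 h3 h4
  have hsub : {ω | ∃ n d π X, beeMemory T tie Z n ω = .exploiting k d π X ∧
      value T D π < T.μ₀ ∧ ExploitPass T k (X ++ [totalReward T (Z n ω)])}
      ⊆ ⋃ j : ℕ, {ω | ∃ n d π X, beeMemory T tie Z n ω = .exploiting k d π X ∧
      (value T D π < T.μ₀ ∧ ExploitPass T k (X ++ [totalReward T (Z n ω)]) ∧
        2 ^ j ≤ (X ++ [totalReward T (Z n ω)]).length ∧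
        (X ++ [totalReward T (Z n ω)]).length < 2 ^ (j + 1))} := by
    rintro ω ⟨n, d, π, X, h1, h2, h3⟩
    refine Set.mem_iUnion.2 ⟨Nat.log 2 (X ++ [totalReward T (Z n ω)]).length,
      n, d, π, X, h1, h2, h3, Nat.pow_log_le_self 2 (by simp),
      Nat.lt_pow_succ_log_self (by norm_num) _⟩
  refine (measureReal_mono hsub).trans ?_
  have hz : HasSum (fun j : ℕ => 1 / (2 * alphaK k * ((j : ℝ) + 1) ^ 2 / T.δ))
      (T.δ / (2 * alphaK k) * (Real.pi ^ 2 / 6)) := by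
    have := (hasSum_nat_add_iff' 1).2 hasSum_zeta_two
    simp only [Finset.sum_range_one, Nat.cast_zero, ne_eq, OfNat.ofNat_ne_zero,
      not_false_eq_true, zero_pow, div_zero, sub_zero] at this
    have heq : (fun j : ℕ => 1 / (2 * alphaK k * ((j : ℝ) + 1) ^ 2 / T.δ))
        = fun j : ℕ => T.δ / (2 * alphaK k) * (1 / ((j + 1 : ℕ) : ℝ) ^ 2) := by
      funext j
      push_cast
      field_simp
    rw [heq]
    exact this.mul_left _
  refine (measureReal_iUnion_le_of_hasSum ℙ hepoch hz).trans ?_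
  have hpi := Real.pi_lt_d2
  have hpi0 := Real.pi_pos
  have : Real.pi ^ 2 / 6 ≤ 2 := by nlinarith
  calc _ ≤ T.δ / (2 * alphaK k) * 2 := mul_le_mul_of_nonneg_left this (by positivity)
    _ = _ := by field_simp

/-- If the confidence radius at the end of the exploitation stage of phase `k` is at most `g / 2`,
then a candidate whose value exceeds `μ₀` by at least `g` is unlikely to fail all tests. This is
Chebyshev's inequality for the number of rewards at the end of the stage. -/
theorem measureReal_exploit_timeout_le [MeasurableSpace Ω] {ℙ : Measure Ω}
    [IsProbabilityMeasure ℙ] {Z : ℕ → Ω → Episode S A T.H} (hrun : IsRun (beeGPI T tie) D ℙ Z)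
    (k : ℕ) {g : ℝ} (hg : 0 < g) (hk : 2 ≤ exploitBudget T k)
    (hrad : ∀ N : ℕ, exploitBudget T k - 1 < N → Real.sqrt ((T.H : ℝ) ^ 2
        * Real.log (2 * alphaK k * (Real.logb 2 (2 * N)) ^ 2 / T.δ) / N) ≤ g / 2) :
    ℙ.real {ω | ∃ n d π X, beeMemory T tie Z n ω = .exploiting k d π X ∧
      (T.μ₀ + g ≤ value T D π ∧ ¬ ExploitPass T k (X ++ [totalReward T (Z n ω)]) ∧
        exploitBudget T k - 1 < (X ++ [totalReward T (Z n ω)]).length)}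
      ≤ (T.H : ℝ) ^ 2 * exploitBudget T k / ((exploitBudget T k - 1) * (g / 2)) ^ 2 := by
  classical
  set N := exploitBudget T k with hN
  have hcpos : 0 < ((N - 1) * (g / 2)) ^ 2 := by
    have : 0 < N - 1 := by linarith
    positivity
  refine measureReal_exploit_le hrun k
      (v := fun π X => if (X.length : ℝ) ≤ N then
        (X.sum - X.length * value T D π) ^ 2 + (T.H : ℝ) ^ 2 * (N - X.length) else 0)
      ?_ (by positivity) ?_ ?_
      (b := fun π X => T.μ₀ + g ≤ value T D π ∧ ¬ ExploitPass T k X ∧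
        N - 1 < X.length) hcpos ?_
  · intro π X
    split_ifs with h
    · have : 0 ≤ N - X.length := by linarith
      positivity
    · exact le_rfl
  · intro π
    rw [if_pos (by simp; linarith)]
    simp
  · intro π X hX
    rw [if_pos (by linarith)]
    have hlen : ∀ z, ((X ++ [totalReward T z]).length : ℝ) ≤ N := by
      intro z
      simp only [List.length_append, List.length_singleton, Nat.cast_add, Nat.cast_one]
      linarith
    have heq : ∀ z : Episode S A T.H, (if ((X ++ [totalReward T z]).length : ℝ) ≤ N then
        ((X ++ [totalReward T z]).sum - (X ++ [totalReward T z]).length * value T D π) ^ 2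
          + (T.H : ℝ) ^ 2 * (N - (X ++ [totalReward T z]).length) else 0)
        = (X.sum - X.length * value T D π) ^ 2 + (T.H : ℝ) ^ 2 * (N - X.length - 1)
          + (2 * (X.sum - X.length * value T D π) * (totalReward T z - value T D π)
            + (totalReward T z - value T D π) ^ 2) := by
      intro z
      rw [if_pos (hlen z)]
      simp only [List.sum_append, List.length_append, List.sum_singleton, List.length_singleton]
      push_cast
      ring
    simp only [heq]
    rw [expect_add D π (fun _ => _), expect_const, expect_add, expect_const_mul, expect_sub,
      expect_const]
    have h1 : expect D π (fun z => totalReward T z) = value T D π := expect_totalReward T D π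
    have h2 := expect_reward_sub_sq_le T D π
    rw [h1, sub_self, mul_zero]
    linarith
  · rintro π X hX ⟨h1, h2, h3⟩
    rw [if_pos hX]
    have hlen : (0 : ℝ) < X.length := by linarith
    have hr := hrad X.length h3
    have h4 : X.sum / X.length < T.μ₀ + g / 2 := by
      unfold ExploitPass at h2
      rw [ge_iff_le, not_le] at h2
      linarith
    rw [div_lt_iff₀ hlen] at h4
    have h5 : (N - 1) * (g / 2) ≤ X.length * value T D π - X.sum := by
      have e1 : X.length * (T.μ₀ + g) ≤ X.length * value T D π :=
        mul_le_mul_of_nonneg_left h1 hlen.le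
      have e2 : (N - 1) * (g / 2) ≤ X.length * (g / 2) :=
        mul_le_mul_of_nonneg_right h3.le (by linarith)
      linarith
    have h6 : ((N - 1) * (g / 2)) ^ 2 ≤ (X.length * value T D π - X.sum) ^ 2 := by
      have : 0 ≤ (N - 1) * (g / 2) := mul_nonneg (by linarith) (by linarith)
      gcongr
    have h7 : 0 ≤ (T.H : ℝ) ^ 2 * (N - X.length) := mul_nonneg (by positivity) (by linarith)
    nlinarith

end Exploit

/-! ### The exploration stage -/

section Bonus

variable {S : Type u} {A : Type v} [Fintype S] [Fintype A] [Nonempty S] [Nonempty A] {H : ℕ}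

/-- The sum of all bonuses `1 / √(n + 1)` collected along an exploration history, `n` being the
number of earlier visits. -/
noncomputable def bonusSum (d : List (Episode S A H)) : ℝ :=
  ∑ j ∈ Finset.range d.length, 1 / Real.sqrt (j + 1)
    + ∑ h, ∑ s, ∑ a, ∑ j ∈ Finset.range (visits d h s a), 1 / Real.sqrt (j + 1)

open Classical in
theorem bonusSum_append (d : List (Episode S A H)) (z : Episode S A H) :
    bonusSum (d ++ [z]) = bonusSum d + (1 / Real.sqrt (d.length + 1)
      + ∑ h, 1 / Real.sqrt (visits d h (z.1 h.castSucc) (z.2 h) + 1)) := by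
  have hv : ∀ h s a, ∑ j ∈ Finset.range (visits (d ++ [z]) h s a), 1 / Real.sqrt ((j : ℝ) + 1)
      = ∑ j ∈ Finset.range (visits d h s a), 1 / Real.sqrt ((j : ℝ) + 1)
        + if z.1 h.castSucc = s then (if z.2 h = a then
          1 / Real.sqrt (visits d h s a + 1) else 0) else 0 := by
    intro h s a
    have : visits (d ++ [z]) h s a = visits d h s a
        + if z.1 h.castSucc = s ∧ z.2 h = a then 1 else 0 := by
      simp [visits, List.countP_append]
    rw [this]
    by_cases h1 : z.1 h.castSucc = s <;> by_cases h2 : z.2 h = a <;>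
      simp [h1, h2, Finset.sum_range_succ]
  unfold bonusSum
  simp only [hv, Finset.sum_add_distrib, List.length_append, List.length_singleton,
    Finset.sum_range_succ]
  have h2 : ∀ h : Fin H, ∑ s, ∑ a, (if z.1 h.castSucc = s then (if z.2 h = a then
      1 / Real.sqrt (visits d h s a + 1) else 0) else 0)
      = 1 / Real.sqrt ((visits d h (z.1 h.castSucc) (z.2 h) : ℝ) + 1) := by
    intro h
    rw [Finset.sum_eq_single (z.1 h.castSucc), Finset.sum_eq_single (z.2 h)]
    · simp
    · intro a _ ha
      rw [if_pos rfl, if_neg (Ne.symm ha)]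
    · simp
    · intro s _ hs
      exact Finset.sum_eq_zero fun a _ => if_neg (Ne.symm hs)
    · simp
  simp only [h2]
  ring

theorem sum_one_div_sqrt_le (n : ℕ) :
    ∑ j ∈ Finset.range n, 1 / Real.sqrt ((j : ℝ) + 1) ≤ 2 * Real.sqrt n := by
  induction n with
  | zero => simp
  | succ n ih =>
    rw [Finset.sum_range_succ]
    refine (add_le_add_left ih _).trans ?_
    push_cast
    have h1 := Real.sq_sqrt (show (0 : ℝ) ≤ n by positivity)
    have h2 := Real.sq_sqrt (show (0 : ℝ) ≤ (n : ℝ) + 1 by positivity)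
    have h3 := Real.sqrt_pos.2 (show (0 : ℝ) < (n : ℝ) + 1 by positivity)
    have h4 := Real.sqrt_nonneg (n : ℝ)
    have : 1 / Real.sqrt ((n : ℝ) + 1)
        ≤ 2 * Real.sqrt ((n : ℝ) + 1) - 2 * Real.sqrt n := by
      rw [div_le_iff₀ h3]
      nlinarith [sq_nonneg (Real.sqrt ((n : ℝ) + 1) - Real.sqrt n)]
    linarith

theorem bonusSum_nonneg (d : List (Episode S A H)) : 0 ≤ bonusSum d := by
  unfold bonusSum
  positivity

theorem bonusSum_le (T : Task S A) {d : List (Episode S A T.H)} {t : ℝ} (ht : (d.length : ℝ) ≤ t) :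
    bonusSum d ≤ (1 + T.H * (Fintype.card S * Fintype.card A)) * (2 * Real.sqrt t) := by
  have h1 : ∀ n : ℕ, n ≤ d.length →
      ∑ j ∈ Finset.range n, 1 / Real.sqrt ((j : ℝ) + 1) ≤ 2 * Real.sqrt t := by
    intro n hn
    refine (sum_one_div_sqrt_le n).trans ?_
    have : (n : ℝ) ≤ t := le_trans (by exact_mod_cast hn) ht
    have := Real.sqrt_le_sqrt this
    linarith
  unfold bonusSum
  calc _ ≤ 2 * Real.sqrt t + ∑ _h : Fin T.H, ∑ _s : S, ∑ _a : A, 2 * Real.sqrt t :=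
        add_le_add (h1 _ le_rfl) (Finset.sum_le_sum fun h _ => Finset.sum_le_sum fun s _ =>
          Finset.sum_le_sum fun a _ => h1 _ (visits_le_length d h s a))
    _ = _ := by
        simp only [Finset.sum_const, Finset.card_univ, nsmul_eq_mul, Fintype.card_fin]
        ring

end Bonus

section Explore

variable {S : Type u} {A : Type v} [Fintype S] [Fintype A] [Nonempty S] [Nonempty A]
  {Ω : Type w} {T : Task S A} {tie : ArgmaxRule S A T.H} {D : Dynamics S A T.H}

open Classical in
/-- A potential which is `M` before the exploration stage of phase `k`, and `g d` during this stage
as long as the exploration history `d` is reliable. -/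
noncomputable def explorePotential (T : Task S A) (D : Dynamics S A T.H) (k : ℕ) (M : ℝ)
    (g : List (Episode S A T.H) → ℝ) : BEEState S A T.H → ℝ
  | .exploring k' d => if k' < k then M else if k' = k ∧ Reliable T D k d then g d else 0
  | .exploiting k' _ _ _ => if k' < k then M else 0
  | .finished _ => 0

/-- As long as the exploration histories are reliable and the confidence intervals have width at
least `w`, the exploration stage of phase `k + 1` uses up its budget with small probability: each
of its episodes collects bonuses proportional to `w` in expectation, but the sum of all bonuses is
of the order of the square root of the budget. The budget that is left to this phase is at least
`exploreBudget T (k + 1) - exploreBudget T k`. -/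
theorem measureReal_explore_timeout_le [MeasurableSpace Ω] {ℙ : Measure Ω}
    [IsProbabilityMeasure ℙ] {Z : ℕ → Ω → Episode S A T.H} (hrun : IsRun (beeGPI T tie) D ℙ Z)
    (k : ℕ) {w : ℝ} (hw : 0 < w)
    (hwidth : ∀ d, Reliable T D (k + 1) d → ¬ PosCrit T tie (k + 1) d → ¬ NegCrit T (k + 1) d →
      w ≤ optimisticV0 T d (deltaK (k + 1))
        - pessimisticV0 T d (deltaK (k + 1)) (optimisticPolicy T tie (k + 1) d))
    (hk : exploreBudget T k + 1 < exploreBudget T (k + 1)) :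
    ℙ.real {ω | ∃ n d, beeMemory T tie Z n ω = .exploring (k + 1) d ∧ Reliable T D (k + 1) d ∧
        exploreBudget T (k + 1) - 1 < d.length + 1}
      ≤ (1 + T.H * (Fintype.card S * Fintype.card A)) * (2 * Real.sqrt (exploreBudget T (k + 1)))
        / (w / (16 * T.H * Real.sqrt (betaP T ⌊exploreBudget T (k + 1)⌋₊ (deltaK (k + 1))))
          * (exploreBudget T (k + 1) - 1 - exploreBudget T k)) := by
  classical
  set b := betaP T ⌊exploreBudget T (k + 1)⌋₊ (deltaK (k + 1)) with hb
  set κ := w / (16 * T.H * Real.sqrt b) with hκ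
  set M := (1 + T.H * (Fintype.card S * Fintype.card A)) *
    (2 * Real.sqrt (exploreBudget T (k + 1))) with hM
  set t₀ := exploreBudget T k
  set t₁ := exploreBudget T (k + 1)
  have hH : (0 : ℝ) < T.H := by exact_mod_cast T.H_pos
  have hb0 : 0 < Real.sqrt b := Real.sqrt_pos.2 (by
    have := half_le_betaP T (k + 1) ⌊t₁⌋₊
    linarith)
  have hκ0 : 0 < κ := by positivity
  have hM0 : 0 ≤ M := by positivity
  -- an episode of the phase takes away at least `κ` from the first part of `g` in expectation, and
  -- adds at most `κ` to the last part
  set g : List (Episode S A T.H) → ℝ :=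
    fun d => M - bonusSum d + κ * max 0 (d.length - t₀) with hg
  have hg0 : ∀ d : List (Episode S A T.H), (d.length : ℝ) ≤ t₁ → 0 ≤ g d := by
    intro d hd
    have h1 := bonusSum_le T hd
    have h2 : 0 ≤ κ * max 0 (d.length - t₀) := mul_nonneg hκ0.le (le_max_left _ _)
    simp only [hg]
    linarith
  have hgM : ∀ d : List (Episode S A T.H), (d.length : ℝ) ≤ t₀ → g d ≤ M := by
    intro d hd
    have h1 := bonusSum_nonneg d
    simp only [hg]
    rw [max_eq_left (by linarith), mul_zero]
    linarith
  have hstart : ∀ k' d, (d.length : ℝ) ≤ t₀ →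
      explorePotential T D (k + 1) M g (explore T tie k' d) ≤ M := by
    intro k' d hd
    obtain ⟨k₁, -, -, ⟨h, -⟩ | ⟨h, -⟩ | ⟨h, -⟩⟩ := explore_cases T tie k' d <;>
      rw [h, explorePotential]
    · split_ifs <;> first | exact le_rfl | exact hM0 | exact hgM d hd
    · split_ifs <;> first | exact le_rfl | exact hM0
    · exact hM0
  have ht₀ : 0 ≤ t₀ := by
    have := le_exploreBudget T k
    have : (0 : ℝ) ≤ k := Nat.cast_nonneg k
    linarith
  have hmono : ∀ k', k' < k + 1 → exploreBudget T k' ≤ t₀ := fun k' h =>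
    exploreBudget_mono T (Nat.lt_succ_iff.1 h)
  have hc : 0 < κ * (t₁ - 1 - t₀) := mul_pos hκ0 (by linarith)
  refine le_trans ?_ (div_le_div_of_nonneg_right (hstart 1 [] (by simpa using ht₀)) hc.le)
  refine bee_measureReal_exists_le hrun (G := explorePotential T D (k + 1) M g)
    (B := fun s _ => ∃ d, s = .exploring (k + 1) d ∧ Reliable T D (k + 1) d ∧
      t₁ - 1 < d.length + 1) ?_ ?_ hc ?_
  · rintro ans z ⟨d, h, -⟩
    simp at h
  · rintro (⟨k', d⟩ | ⟨k', d, π, X⟩ | ans) hinv <;> rw [explorePotential]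
    · split_ifs with h1 h2
      · exact hM0
      · obtain ⟨rfl, -⟩ := h2
        exact hg0 d (by linarith [hinv.2.2])
      · exact le_rfl
    · split_ifs <;> first | exact le_rfl | exact hM0
  · rintro (⟨k', d⟩ | ⟨k', d, π, X⟩ | ans) π' hinv hdec
    · have hlen : ∀ z, ((d ++ [z]).length : ℝ) = d.length + 1 := by
        intro z
        simp
      rcases lt_trichotomy k' (k + 1) with hlt | rfl | hgt
      · refine le_trans (expect_mono fun z _ => ?_)
          (expect_const D π' (explorePotential T D (k + 1) M g (.exploring k' d))).le
        rw [if_neg (by rintro ⟨d, h, -⟩; simp at h; omega), explorePotential, if_pos hlt, update]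
        refine hstart _ _ ?_
        rw [hlen]
        linarith [hinv.2.2, hmono k' hlt]
      · by_cases hrel : Reliable T D (k + 1) d
        · have hπ : optimisticPolicy T tie (k + 1) d = π' := by simpa [nextDecision] using hdec
          have hG : explorePotential T D (k + 1) M g (.exploring (k + 1) d) = g d := by
            rw [explorePotential, if_neg (lt_irrefl _), if_pos ⟨rfl, hrel⟩]
          have hd₁ : (d.length : ℝ) ≤ t₁ - 1 := hinv.2.2
          rw [hG]
          have hpt : ∀ z, (if ∃ d', BEEState.exploring (k + 1) d = .exploring (k + 1) d' ∧
              Reliable T D (k + 1) d' ∧ t₁ - 1 < d'.length + 1 then κ * (t₁ - 1 - t₀) else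
              explorePotential T D (k + 1) M g
                (update T tie (.exploring (k + 1) d) z)) ≤ g (d ++ [z]) := by
            intro z
            have hlen' : ((d ++ [z]).length : ℝ) ≤ t₁ := by rw [hlen]; linarith
            split_ifs with hB
            · obtain ⟨d', h, -, hB⟩ := hB
              simp only [BEEState.exploring.injEq, true_and] at h
              subst h
              have h1 := bonusSum_le T hlen'
              have h2 : κ * (t₁ - 1 - t₀) ≤ κ * max 0 ((d ++ [z]).length - t₀) := by
                refine mul_le_mul_of_nonneg_left (le_trans ?_ (le_max_right _ _)) hκ0.le
                rw [hlen]
                linarith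
              simp only [hg]
              linarith
            · rw [update]
              obtain ⟨k₁, hk₁, -, ⟨h, -⟩ | ⟨h, -⟩ | ⟨h, -⟩⟩ :=
                explore_cases T tie (k + 1) (d ++ [z]) <;> rw [h, explorePotential]
              · rw [if_neg (by omega)]
                split_ifs
                · exact le_rfl
                · exact hg0 _ hlen'
              · rw [if_neg (by omega)]
                exact hg0 _ hlen'
              · exact hg0 _ hlen'
          refine (expect_mono fun z _ => hpt z).trans ?_
          have hgle : ∀ z, g (d ++ [z]) ≤ g d + (κ - (1 / Real.sqrt (d.length + 1)
              + ∑ h, 1 / Real.sqrt (visits d h (z.1 h.castSucc) (z.2 h) + 1))) := by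
            intro z
            simp only [hg]
            rw [bonusSum_append, hlen]
            have : max 0 ((d.length : ℝ) + 1 - t₀) ≤ max 0 (d.length - t₀) + 1 := by
              refine max_le ?_ ?_
              · linarith [le_max_left (0 : ℝ) (d.length - t₀)]
              · linarith [le_max_right (0 : ℝ) (d.length - t₀)]
            have := mul_le_mul_of_nonneg_left this hκ0.le
            linarith
          refine (expect_mono fun z _ => hgle z).trans ?_
          rw [expect_add D π' (fun _ => g d), expect_sub, expect_add D π' (fun _ => 1 / _),
            expect_const, expect_const, expect_const]
          have h3 := width_le tie hrel (b := b) (betaP_mono T _ (Nat.le_floor (by linarith)))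
          rw [hπ] at h3
          have h4 := hwidth d hrel hinv.1 hinv.2.1
          rw [hπ] at h4
          have h5 : κ ≤ 1 / Real.sqrt (d.length + 1) + expect D π' (fun z => ∑ h : Fin T.H,
            1 / Real.sqrt (visits d h (z.1 h.castSucc) (z.2 h) + 1)) := by
            rw [hκ, div_le_iff₀ (by positivity)]
            linarith
          linarith
        · refine le_trans (expect_mono fun z _ => ?_)
            (expect_const D π' (explorePotential T D (k + 1) M g (.exploring (k + 1) d))).le
          rw [if_neg (by
              rintro ⟨d', h, h', -⟩
              simp only [BEEState.exploring.injEq, true_and] at h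
              exact hrel (h ▸ h')), update,
            show explorePotential T D (k + 1) M g (.exploring (k + 1) d) = 0 by
              rw [explorePotential, if_neg (lt_irrefl _), if_neg fun h => hrel h.2]]
          obtain ⟨k₁, hk₁, -, ⟨h, -⟩ | ⟨h, -⟩ | ⟨h, -⟩⟩ :=
            explore_cases T tie (k + 1) (d ++ [z]) <;> rw [h, explorePotential]
          · rw [if_neg (by omega), if_neg fun h => hrel h.2.of_append]
          · rw [if_neg (by omega)]
      · refine le_trans (expect_mono fun z _ => ?_)
          (expect_const D π' (explorePotential T D (k + 1) M g (.exploring k' d))).le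
        rw [if_neg (by rintro ⟨d, h, -⟩; simp at h; omega), explorePotential,
          if_neg (by omega), if_neg (by omega), update]
        obtain ⟨k₁, hk₁, -, ⟨h, -⟩ | ⟨h, -⟩ | ⟨h, -⟩⟩ :=
          explore_cases T tie k' (d ++ [z]) <;> rw [h, explorePotential]
        · rw [if_neg (by omega), if_neg (by omega)]
        · rw [if_neg (by omega)]
    · refine le_trans (expect_mono fun z _ => ?_)
        (expect_const D π' (explorePotential T D (k + 1) M g (.exploiting k' d π X))).le
      rw [if_neg (by rintro ⟨d, h, -⟩; simp at h), explorePotential, update]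
      by_cases hlt : k' < k + 1
      · rw [if_pos hlt]
        split_ifs
        · exact hM0
        · rw [explorePotential, if_pos hlt]
        · exact hstart _ _ (hinv.2.2.1.trans (hmono k' hlt))
      · rw [if_neg hlt]
        split_ifs
        · exact le_rfl
        · rw [explorePotential, if_neg hlt]
        · obtain ⟨k₁, hk₁, -, ⟨h, -⟩ | ⟨h, -⟩ | ⟨h, -⟩⟩ :=
            explore_cases T tie (k' + 1) d <;> rw [h, explorePotential]
          · rw [if_neg (by omega), if_neg (by omega)]
          · rw [if_neg (by omega)]
    · simp [nextDecision] at hdec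

end Explore

/-! ### Almost sure termination -/

section Paths

variable {S : Type u} {A : Type v} [Fintype S] [Fintype A] [Nonempty S] [Nonempty A]
  {Ω : Type w} {T : Task S A} {tie : ArgmaxRule S A T.H}

theorem phase_explore {k : ℕ} {d : List (Episode S A T.H)}
    (h : ∀ a, explore T tie k d ≠ .finished a) :
    k ≤ (explore T tie k d).phase ∧
      ∀ j, k ≤ j → j < (explore T tie k d).phase → ExploreFails T tie j d := by
  obtain ⟨k₁, hk₁, hf, ⟨h', -⟩ | ⟨h', -⟩ | ⟨h', -⟩⟩ := explore_cases T tie k d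
  · rw [h']; exact ⟨hk₁, hf⟩
  · rw [h']; exact ⟨hk₁, hf⟩
  · exact absurd h' (h _)

/-- A counter which increases with each episode within a phase. It starts the exploitation stage
above all values of the exploration stage. -/
noncomputable def progress (T : Task S A) : BEEState S A T.H → ℕ
  | .exploring _ d => d.length
  | .exploiting k _ _ X => ⌊exploreBudget T k⌋₊ + 1 + X.length
  | .finished _ => 0

theorem progress_le {s : BEEState S A T.H} (hs : BEEInv T tie s) :
    progress T s ≤ ⌊exploreBudget T s.phase⌋₊ + 1 + ⌊exploitBudget T s.phase⌋₊ := by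
  rcases s with ⟨k, d⟩ | ⟨k, d, π, X⟩ | ans
  · have : d.length ≤ ⌊exploreBudget T k⌋₊ := Nat.le_floor (by linarith [hs.2.2])
    simp only [progress, BEEState.phase]
    omega
  · have : X.length ≤ ⌊exploitBudget T k⌋₊ := Nat.le_floor (by linarith [hs.2.2.2])
    simp only [progress, BEEState.phase]
    omega
  · simp [progress]

theorem phase_progress_update {s : BEEState S A T.H} (hs : BEEInv T tie s)
    {z : Episode S A T.H} (hfin : ∀ a, update T tie s z ≠ .finished a) :
    s.phase ≤ (update T tie s z).phase ∧
      ((update T tie s z).phase = s.phase → progress T s < progress T (update T tie s z)) := by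
  rcases s with ⟨k, d⟩ | ⟨k, d, π, X⟩ | ans
  · have hd : d.length ≤ ⌊exploreBudget T k⌋₊ := Nat.le_floor (by linarith [hs.2.2])
    refine ⟨(phase_explore hfin).1, ?_⟩
    rw [update] at hfin ⊢
    obtain ⟨k₁, hk₁, hf, ⟨h', -⟩ | ⟨h', -⟩ | ⟨h', -⟩⟩ := explore_cases T tie k (d ++ [z]) <;>
      rw [h']
    · intro _
      simp [progress]
    · simp only [progress, BEEState.phase]
      rintro rfl
      omega
    · exact absurd h' (hfin _)
  · rw [update] at hfin ⊢
    split_ifs at hfin ⊢ with h1 h2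
    · exact absurd rfl (hfin _)
    · exact ⟨le_rfl, fun _ => by simp [progress]⟩
    · have := (phase_explore hfin).1
      simp only [BEEState.phase] at this ⊢
      exact ⟨by omega, fun h => by omega⟩
  · exact absurd rfl (hfin ans)

/-- A run that does not terminate goes through all phases. -/
theorem exists_lt_phase {Z : ℕ → Ω → Episode S A T.H} {ω : Ω}
    (hfin : ∀ n a, beeMemory T tie Z n ω ≠ .finished a) (K : ℕ) :
    ∃ n, K < (beeMemory T tie Z n ω).phase := by
  have hstep : ∀ n, (beeMemory T tie Z n ω).phase ≤ (beeMemory T tie Z (n + 1) ω).phase ∧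
      ((beeMemory T tie Z (n + 1) ω).phase = (beeMemory T tie Z n ω).phase →
        progress T (beeMemory T tie Z n ω) < progress T (beeMemory T tie Z (n + 1) ω)) := by
    intro n
    have h := hfin (n + 1)
    rw [beeMemory_succ] at h ⊢
    exact phase_progress_update (beeInv_beeMemory T tie Z n ω) h
  have hmono : Monotone fun n => (beeMemory T tie Z n ω).phase :=
    monotone_nat_of_le_succ fun n => (hstep n).1
  have hpass : ∀ n, ∃ m, (beeMemory T tie Z n ω).phase < (beeMemory T tie Z m ω).phase := by
    intro n
    by_contra hcon
    push Not at hcon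
    have hconst : ∀ i, (beeMemory T tie Z (n + i) ω).phase = (beeMemory T tie Z n ω).phase :=
      fun i => le_antisymm (hcon _) (hmono (Nat.le_add_right n i))
    have hgrow : ∀ i, i ≤ progress T (beeMemory T tie Z (n + i) ω) := by
      intro i
      induction i with
      | zero => exact Nat.zero_le _
      | succ i ih =>
        have := (hstep (n + i)).2 (by rw [add_assoc, hconst, hconst])
        rw [← add_assoc]
        omega
    set R := ⌊exploreBudget T (beeMemory T tie Z n ω).phase⌋₊ + 1
      + ⌊exploitBudget T (beeMemory T tie Z n ω).phase⌋₊ with hR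
    have h1 := hgrow (R + 1)
    have h2 := progress_le (beeInv_beeMemory T tie Z (n + (R + 1)) ω)
    rw [hconst, ← hR] at h2
    omega
  induction K with
  | zero =>
    obtain ⟨m, hm⟩ := hpass 0
    exact ⟨m, by omega⟩
  | succ K ih =>
    obtain ⟨n, hn⟩ := ih
    obtain ⟨m, hm⟩ := hpass n
    exact ⟨m, by omega⟩

/-- A run that does not terminate uses up one of the two budgets of each phase, except possibly of
the first ones. -/
theorem timeout_of_not_finished {Z : ℕ → Ω → Episode S A T.H} {ω : Ω}
    (hfin : ∀ n a, beeMemory T tie Z n ω ≠ .finished a) {k : ℕ}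
    (hδ : deltaK (k + 1) < T.δ / 10) (hk : exploreBudget T k + 1 < exploreBudget T (k + 1)) :
    (∃ n d, beeMemory T tie Z n ω = .exploring (k + 1) d ∧
        exploreBudget T (k + 1) - 1 < d.length + 1) ∨
      ∃ n d π X, beeMemory T tie Z n ω = .exploiting (k + 1) d π X ∧
        ¬ ExploitPass T (k + 1) (X ++ [totalReward T (Z n ω)]) ∧
        exploitBudget T (k + 1) - 1 < (X ++ [totalReward T (Z n ω)]).length := by
  have hfails : ∀ d, ExploreFails T tie (k + 1) d → exploreBudget T (k + 1) - 1 < d.length := by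
    rintro d ⟨-, ⟨-, h⟩ | ⟨-, h⟩⟩
    · exact absurd hδ (not_lt.2 h)
    · exact h
  classical
  have hex := exists_lt_phase hfin (k + 1)
  have hn := Nat.find_spec hex
  rcases hn0 : Nat.find hex with _ | n
  · -- the budget exceeds the length `0` of the initial exploration history
    exfalso
    have h0 := hfin 0
    rw [hn0, beeMemory_zero] at hn
    rw [beeMemory_zero] at h0
    have h1 := hfails [] ((phase_explore h0).2 (k + 1) (by omega) hn)
    have h2 := le_exploreBudget T (k + 1)
    simp only [List.length_nil, Nat.cast_zero] at h1
    push_cast at h2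
    have : (0 : ℝ) ≤ k := Nat.cast_nonneg k
    linarith
  · have hle : (beeMemory T tie Z n ω).phase ≤ k + 1 :=
      not_lt.1 (Nat.find_min hex (by omega))
    have hinv := beeInv_beeMemory T tie Z n ω
    have hf := hfin (n + 1)
    rw [hn0] at hn
    rw [beeMemory_succ] at hn hf
    rcases hs : beeMemory T tie Z n ω with ⟨k', d⟩ | ⟨k', d, π, X⟩ | ans
    · rw [hs] at hle hinv hn hf
      rw [update] at hn hf
      have h1 := hfails _ ((phase_explore hf).2 (k + 1) hle hn)
      simp only [List.length_append, List.length_singleton, Nat.cast_add, Nat.cast_one] at h1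
      have hk' : k' = k + 1 := by
        by_contra hne
        simp only [BEEState.phase] at hle
        have := exploreBudget_mono T (show k' ≤ k by omega)
        have := hinv.2.2
        linarith
      subst hk'
      exact Or.inl ⟨n, d, hs, h1⟩
    · rw [hs] at hle hinv hn hf
      simp only [BEEState.phase] at hle
      rw [update] at hn hf
      split_ifs at hn hf with h1 h2
      · exact absurd hn (by simp [BEEState.phase])
      · exact absurd hn (by simpa [BEEState.phase] using hle)
      · have hk' : k' = k + 1 := by
          by_contra hne
          have h1 := hfails _ ((phase_explore hf).2 (k + 1) (by omega) hn)
          have := exploreBudget_mono T (show k' ≤ k by omega)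
          have := hinv.2.2.1
          linarith
        subst hk'
        exact Or.inr ⟨n, d, π, X, hs, h1, not_le.1 h2⟩
    · exact absurd hs (hfin n ans)

end Paths

section Limits

open Filter Topology

variable {S : Type u} {A : Type v} [Fintype S] [Fintype A] [Nonempty S] [Nonempty A]

theorem tendsto_one_div_sqrt_two_pow :
    Tendsto (fun k : ℕ => 1 / Real.sqrt (2 ^ k)) atTop (𝓝 0) := by
  simp only [one_div]
  exact (Real.tendsto_sqrt_atTop.comp
    (tendsto_pow_atTop_atTop_of_one_lt (by norm_num : (1 : ℝ) < 2))).inv_tendsto_atTop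

theorem one_div_two_pow_le (k : ℕ) : 1 / (2 : ℝ) ^ k ≤ 1 / Real.sqrt (2 ^ k) := by
  have h2 : (1 : ℝ) ≤ 2 ^ k := one_le_pow₀ (by norm_num)
  refine one_div_le_one_div_of_le (Real.sqrt_pos.2 (by linarith)) ?_
  exact Real.sqrt_le_iff.2 ⟨by linarith, by nlinarith⟩

theorem log_le_two_mul_sqrt {x : ℝ} (hx : 0 < x) : Real.log x ≤ 2 * Real.sqrt x := by
  have h1 : Real.log x = 2 * Real.log (Real.sqrt x) := by
    rw [Real.log_sqrt hx.le]; ring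
  have h2 := Real.log_le_sub_one_of_pos (Real.sqrt_pos.2 hx)
  linarith

theorem le_exploitBudget (T : Task S A) (k : ℕ) :
    0 ≤ Real.log (alphaK k / T.δ) ∧ (2 : ℝ) ^ k ≤ exploitBudget T k ∧
      100 * 2 ^ k * Real.log (alphaK k / T.δ) ≤ exploitBudget T k := by
  have hH : (1 : ℝ) ≤ T.H := by exact_mod_cast T.H_pos
  have h2 : (1 : ℝ) ≤ 2 ^ k := one_le_pow₀ (by norm_num)
  have h5 : (1 : ℝ) ≤ 5 ^ k := one_le_pow₀ (by norm_num)
  have hδ := T.δ_pos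
  have hδ1 := T.δ_lt_one
  have g1 : 0 ≤ Real.log (alphaK k / T.δ) := by
    apply Real.log_nonneg
    rw [alphaK, le_div_iff₀ hδ]
    linarith
  have g2 : (16 : ℝ) ≤ 24 * (T.H : ℝ) ^ 2 / epsK k := by
    rw [epsK, div_div_eq_mul_div, div_one]
    have := one_le_mul_of_one_le_of_one_le (one_le_mul_of_one_le_of_one_le hH hH) h2
    nlinarith
  have e0 := Real.log_two_gt_d9
  have g3 : (2 : ℝ) ≤ Real.log (24 * (T.H : ℝ) ^ 2 / epsK k) := by
    have e1 : Real.log 16 = 4 * Real.log 2 := by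
      rw [show (16 : ℝ) = 2 ^ 4 by norm_num, Real.log_pow]; norm_num
    have e2 := Real.log_le_log (by norm_num) g2
    linarith
  have g4 : (1 / 2 : ℝ) ≤ Real.log (Real.log (24 * (T.H : ℝ) ^ 2 / epsK k)) := by
    have e2 := Real.log_le_log (by norm_num) g3
    linarith
  have g5 : exploitBudget T k = 100 * 2 ^ k * (Real.log (alphaK k / T.δ)
      + Real.log (Real.log (24 * (T.H : ℝ) ^ 2 / epsK k))) := by
    rw [exploitBudget]
    nth_rewrite 2 [epsK]
    rw [div_div_eq_mul_div, div_one]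
    ring
  refine ⟨g1, ?_, ?_⟩
  · rw [g5]; nlinarith
  · rw [g5]; nlinarith

/-- An explicit bound for the confidence radius at the end of the exploitation stage. -/
theorem exploit_radius_le (T : Task S A) {k N : ℕ} (hk : 1 ≤ k)
    (hN : exploitBudget T k - 1 < N) :
    (T.H : ℝ) ^ 2 * Real.log (2 * alphaK k * (Real.logb 2 (2 * N)) ^ 2 / T.δ) / N
      ≤ (T.H : ℝ) ^ 2 * (16 * (1 / Real.sqrt (2 ^ k))) := by
  obtain ⟨h1, h2, h3⟩ := le_exploitBudget T k
  have h2k : (2 : ℝ) ≤ 2 ^ k := by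
    calc (2 : ℝ) = 2 ^ 1 := by norm_num
      _ ≤ 2 ^ k := pow_le_pow_right₀ (by norm_num) hk
  have hN2 : exploitBudget T k ≤ 2 * N := by linarith
  have hNp : (1 : ℝ) ≤ N := by linarith
  have hδ := T.δ_pos
  have hα := alphaK_pos k
  have hlb1 : 1 ≤ Real.logb 2 (2 * N) := by
    rw [Real.le_logb_iff_rpow_le (by norm_num) (by positivity), Real.rpow_one]
    linarith
  have hlb2 : Real.logb 2 (2 * N) ≤ 2 * N := by
    rw [Real.logb_le_iff_le_rpow (by norm_num) (by positivity)]
    have : ((2 * N : ℕ) : ℝ) < 2 ^ (2 * N) := by exact_mod_cast Nat.lt_two_pow_self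
    have e : (2 : ℝ) ^ (2 * (N : ℝ)) = 2 ^ (2 * N) := by
      rw [← Real.rpow_natCast]
      push_cast
      rfl
    rw [e]
    push_cast at this
    exact this.le
  have hlog : Real.log (2 * alphaK k * (Real.logb 2 (2 * N)) ^ 2 / T.δ)
      ≤ 1 + Real.log (alphaK k / T.δ) + 4 * Real.sqrt (2 * N) := by
    have e1 : 2 * alphaK k * (Real.logb 2 (2 * N)) ^ 2 / T.δ
        = 2 * (alphaK k / T.δ) * (Real.logb 2 (2 * N)) ^ 2 := by ring
    rw [e1, Real.log_mul (by positivity) (by positivity), Real.log_mul (by norm_num)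
      (by positivity), Real.log_pow]
    have e2 := Real.log_two_lt_d9
    have e3 : Real.log (Real.logb 2 (2 * N)) ≤ Real.log (2 * N) :=
      Real.log_le_log (by linarith) hlb2
    have e4 := log_le_two_mul_sqrt (show (0 : ℝ) < 2 * N by linarith)
    push_cast
    linarith
  rw [mul_div_assoc]
  refine mul_le_mul_of_nonneg_left ?_ (by positivity)
  rw [div_le_iff₀ (by linarith)]
  refine hlog.trans ?_
  set x := Real.sqrt (2 ^ k) with hx
  have hxp : 0 < x := Real.sqrt_pos.2 (by linarith)
  have hx2 : x ^ 2 = 2 ^ k := Real.sq_sqrt (by linarith)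
  have hx1 : 1 ≤ x := Real.one_le_sqrt.2 (by linarith)
  have hNx : x ^ 2 ≤ 2 * N := by rw [hx2]; linarith
  set y := Real.sqrt (2 * N) with hy
  have hy2 : y ^ 2 = 2 * N := Real.sq_sqrt (by linarith)
  have hy0 : 0 ≤ y := Real.sqrt_nonneg _
  have hxy : x ≤ y := Real.sqrt_le_sqrt (by linarith)
  have hl : Real.log (alphaK k / T.δ) * x ≤ 2 * N := by
    have : 100 * x ^ 2 * Real.log (alphaK k / T.δ) ≤ 2 * N := by rw [hx2]; linarith
    nlinarith [mul_nonneg h1 hxp.le, mul_nonneg h1 (mul_nonneg hxp.le (sub_nonneg.2 hx1))]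
  have e : 16 * (1 / x) * (N : ℝ) = 16 * N / x := by ring
  rw [e, le_div_iff₀ hxp]
  nlinarith

theorem exploreBudget_lower (T : Task S A) (k : ℕ) :
    Real.log (2 * Fintype.card S * Fintype.card A * T.H / deltaK k) * 2 ^ k ≤ exploreBudget T k ∧
      (2 : ℝ) ^ k ≤ exploreBudget T k := by
  have hS : (1 : ℝ) ≤ Fintype.card S := by exact_mod_cast Fintype.card_pos
  have hA : (1 : ℝ) ≤ Fintype.card A := by exact_mod_cast Fintype.card_pos
  have hH : (1 : ℝ) ≤ T.H := by exact_mod_cast T.H_pos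
  have hL := log_ratio_ge T k
  unfold exploreBudget
  set L := Real.log (2 * Fintype.card S * Fintype.card A * T.H / deltaK k)
  have hHH : (4 : ℝ) ≤ ((T.H : ℝ) + 1) ^ 2 := by nlinarith
  have hc1 : (4 : ℝ) ≤ ((T.H : ℝ) + 1) ^ 2 * Fintype.card S * Fintype.card A := by
    have e1 := one_le_mul_of_one_le_of_one_le hS hA
    nlinarith
  have hc2 : (4 : ℝ) ≤ ((T.H : ℝ) + 1) ^ 2 * (Fintype.card S : ℝ) ^ 2 * Fintype.card A := by
    have e1 := one_le_mul_of_one_le_of_one_le (one_le_mul_of_one_le_of_one_le hS hS) hA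
    nlinarith
  set c₁ := ((T.H : ℝ) + 1) ^ 2 * Fintype.card S * Fintype.card A
  set c₂ := ((T.H : ℝ) + 1) ^ 2 * (Fintype.card S : ℝ) ^ 2 * Fintype.card A
  have h2 : (1 : ℝ) ≤ 2 ^ k := one_le_pow₀ (by norm_num)
  simp only [epsK, div_div_eq_mul_div, div_one]
  have f2 : (2 : ℝ) ≤ c₂ * L := by nlinarith
  have f3 : (1 : ℝ) ≤ c₂ * L * 2 ^ k := by nlinarith
  have f4 := Real.log_nonneg f3
  have f5 : 0 ≤ c₂ * 2 ^ k * Real.log (c₂ * L * 2 ^ k) := by positivity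
  have f6 : 4 * L ≤ c₁ * L := mul_le_mul_of_nonneg_right hc1 (by linarith)
  constructor <;> nlinarith

theorem betaP_floor_le (T : Task S A) (k : ℕ) :
    betaP T ⌊exploreBudget T k⌋₊ (deltaK k)
      ≤ exploreBudget T k * ((1 + 4 * Fintype.card S) * (1 / Real.sqrt (2 ^ k))) := by
  have hS : (1 : ℝ) ≤ Fintype.card S := by exact_mod_cast Fintype.card_pos
  obtain ⟨h1, h2⟩ := exploreBudget_lower T k
  set t := exploreBudget T k
  have h2k : (1 : ℝ) ≤ 2 ^ k := one_le_pow₀ (by norm_num)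
  have ht : 1 ≤ t := by linarith
  have hn : (⌊t⌋₊ : ℝ) ≤ t := Nat.floor_le (by linarith)
  set n : ℝ := (⌊t⌋₊ : ℝ)
  have hn0 : 0 ≤ n := Nat.cast_nonneg _
  set x := Real.sqrt (2 ^ k) with hx
  have hxp : 0 < x := Real.sqrt_pos.2 (by linarith)
  have hx2 : x ^ 2 = 2 ^ k := Real.sq_sqrt (by linarith)
  have hx1 : 1 ≤ x := Real.one_le_sqrt.2 h2k
  set y := Real.sqrt t with hy
  have hy2 : y ^ 2 = t := Real.sq_sqrt (by linarith)
  have hxy : x ≤ y := Real.sqrt_le_sqrt h2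
  have hlog : ((Fintype.card S : ℝ) - 1)
      * Real.log (Real.exp 1 * (1 + n / ((Fintype.card S : ℝ) - 1)))
      ≤ Fintype.card S * (4 * y) := by
    rcases hS.eq_or_lt with h | h
    · rw [← h]
      simp only [sub_self, zero_mul, one_mul]
      linarith
    · have hS2 : (1 : ℝ) ≤ (Fintype.card S : ℝ) - 1 := by
        have : 1 < Fintype.card S := by exact_mod_cast h
        have : (2 : ℝ) ≤ Fintype.card S := by exact_mod_cast this
        linarith
      have hdiv : n / ((Fintype.card S : ℝ) - 1) ≤ n := div_le_self hn0 hS2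
      have hdiv0 : 0 ≤ n / ((Fintype.card S : ℝ) - 1) := div_nonneg hn0 (by linarith)
      rw [Real.log_mul (Real.exp_pos 1).ne' (by linarith), Real.log_exp]
      have e1 := log_le_two_mul_sqrt
        (show 0 < 1 + n / ((Fintype.card S : ℝ) - 1) by linarith)
      have e2 : Real.sqrt (1 + n / ((Fintype.card S : ℝ) - 1)) ≤ 3 / 2 * y := by
        refine Real.sqrt_le_iff.2 ⟨by linarith, ?_⟩
        rw [mul_pow, hy2]
        linarith
      have e3 : 0 ≤ 1 + Real.log (1 + n / ((Fintype.card S : ℝ) - 1)) := by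
        have := Real.log_nonneg (show 1 ≤ 1 + n / ((Fintype.card S : ℝ) - 1) by linarith)
        linarith
      calc _ ≤ (Fintype.card S : ℝ) * (1 + Real.log (1 + n / ((Fintype.card S : ℝ) - 1))) :=
            mul_le_mul_of_nonneg_right (by linarith) e3
        _ ≤ _ := mul_le_mul_of_nonneg_left (by linarith) (by linarith)
  have hL : Real.log (2 * Fintype.card S * Fintype.card A * T.H / deltaK k) * x ≤ t := by
    have := log_ratio_ge T k
    rw [← hx2] at h1
    nlinarith
  have hSy : Fintype.card S * (4 * y) * x ≤ 4 * Fintype.card S * t := by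
    rw [← hy2]
    have : y * x ≤ y ^ 2 := by nlinarith
    nlinarith
  have e : t * ((1 + 4 * Fintype.card S) * (1 / x)) = (t + 4 * Fintype.card S * t) / x := by
    field_simp
  rw [e, le_div_iff₀ hxp]
  unfold betaP
  have := mul_le_mul_of_nonneg_right hlog hxp.le
  linarith

/-- A bound for the failure probability of the exploration stage which tends to `0` as `k` grows:
the bonuses are of order `√t`, the width threshold costs a factor `√β ≤ √t * o(1)`, and the budget
left to the phase is of order `t`. -/
theorem explore_timeout_bound_le (T : Task S A) {w : ℝ} (hw : 0 < w) {k : ℕ} (hk : 2 ≤ k) :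
    (1 + T.H * (Fintype.card S * Fintype.card A)) * (2 * Real.sqrt (exploreBudget T (k + 1)))
        / (w / (16 * T.H * Real.sqrt (betaP T ⌊exploreBudget T (k + 1)⌋₊ (deltaK (k + 1))))
          * (exploreBudget T (k + 1) - 1 - exploreBudget T k))
      ≤ (1 + T.H * (Fintype.card S * Fintype.card A)) * (128 * T.H / w)
        * Real.sqrt ((1 + 4 * Fintype.card S) * (1 / Real.sqrt (2 ^ (k + 1)))) := by
  have hH : (0 : ℝ) < T.H := by exact_mod_cast T.H_pos
  have h1 := two_mul_exploreBudget_le T k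
  have h2 := le_exploreBudget T (k + 1)
  have h3 := betaP_floor_le T (k + 1)
  have h4 := half_le_betaP T (k + 1) ⌊exploreBudget T (k + 1)⌋₊
  set t := exploreBudget T (k + 1)
  set b := betaP T ⌊t⌋₊ (deltaK (k + 1))
  set e := (1 + 4 * (Fintype.card S : ℝ)) * (1 / Real.sqrt (2 ^ (k + 1)))
  have hk' : (2 : ℝ) ≤ k := by exact_mod_cast hk
  push_cast at h2
  have ht : 4 ≤ t := by linarith
  have hgap : t / 4 ≤ t - 1 - exploreBudget T k := by linarith
  have hb0 : 0 < Real.sqrt b := Real.sqrt_pos.2 (by linarith)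
  have hsb : Real.sqrt b ≤ Real.sqrt t * Real.sqrt e := by
    rw [← Real.sqrt_mul (by linarith)]
    exact Real.sqrt_le_sqrt h3
  have hst := Real.sqrt_pos.2 (show 0 < t by linarith)
  have hst2 := Real.sq_sqrt (show 0 ≤ t by linarith)
  have hC : (0 : ℝ) < 1 + T.H * (Fintype.card S * Fintype.card A) := by positivity
  calc _ ≤ (1 + T.H * (Fintype.card S * Fintype.card A)) * (2 * Real.sqrt t)
        / (w / (16 * T.H * Real.sqrt b) * (t / 4)) := by
        gcongr
    _ = (1 + T.H * (Fintype.card S * Fintype.card A)) * (128 * T.H / w)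
        * (Real.sqrt b / Real.sqrt t) := by
        rw [← hst2, Real.sqrt_sq hst.le]
        field_simp
        ring
    _ ≤ _ := by
        refine mul_le_mul_of_nonneg_left ?_ (by positivity)
        rw [div_le_iff₀ hst]
        linarith

theorem exploit_timeout_bound_le (T : Task S A) {g : ℝ} (hg : 0 < g) {k : ℕ} (hk : 1 ≤ k) :
    (T.H : ℝ) ^ 2 * exploitBudget T k / ((exploitBudget T k - 1) * (g / 2)) ^ 2
      ≤ (T.H : ℝ) ^ 2 * 16 / g ^ 2 * (1 / Real.sqrt (2 ^ k)) := by
  obtain ⟨-, h2, -⟩ := le_exploitBudget T k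
  set N := exploitBudget T k
  have h2k : (2 : ℝ) ≤ 2 ^ k := by
    calc (2 : ℝ) = 2 ^ 1 := by norm_num
      _ ≤ 2 ^ k := pow_le_pow_right₀ (by norm_num) hk
  have hN : 0 < N := by linarith
  calc _ ≤ (T.H : ℝ) ^ 2 * N / ((N / 2) * (g / 2)) ^ 2 := by
        gcongr
        linarith
    _ = (T.H : ℝ) ^ 2 * 16 / g ^ 2 * (1 / N) := by
        field_simp
        ring
    _ ≤ (T.H : ℝ) ^ 2 * 16 / g ^ 2 * (1 / 2 ^ k) := by gcongr
    _ ≤ _ := mul_le_mul_of_nonneg_left (one_div_two_pow_le k) (by positivity)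

end Limits

section Stops

open Filter Topology

variable {S : Type u} {A : Type v} [Fintype S] [Fintype A] [Nonempty S] [Nonempty A]
  {Ω : Type w} {T : Task S A} {tie : ArgmaxRule S A T.H} {D : Dynamics S A T.H}

/-- BEE-GPI terminates almost surely if, on reliable exploration histories, the confidence
intervals are wide as long as no criterion holds, and the positive criterion holds for good
policies only. -/
theorem measureReal_not_stops_eq_zero [MeasurableSpace Ω] {ℙ : Measure Ω}
    [IsProbabilityMeasure ℙ] {Z : ℕ → Ω → Episode S A T.H} (hrun : IsRun (beeGPI T tie) D ℙ Z)
    {w g : ℝ} (hw : 0 < w) (hg : 0 < g)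
    (hwidth : ∀ k d, Reliable T D k d → ¬ PosCrit T tie k d → ¬ NegCrit T k d →
      w ≤ optimisticV0 T d (deltaK k)
        - pessimisticV0 T d (deltaK k) (optimisticPolicy T tie k d))
    (hgap : ∀ k d, Reliable T D k d → PosCrit T tie k d →
      T.μ₀ + g ≤ value T D (optimisticPolicy T tie k d)) :
    ℙ.real {ω | ¬ Stops (beeGPI T tie) Z ω} = 0 := by
  have hlim0 : Tendsto (fun k : ℕ => 1 / Real.sqrt (2 ^ (k + 1))) atTop (𝓝 0) :=
    (tendsto_add_atTop_iff_nat 1).2 tendsto_one_div_sqrt_two_pow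
  have hδlim : Tendsto (fun k : ℕ => deltaK (k + 1)) atTop (𝓝 0) := by
    refine (tendsto_add_atTop_iff_nat 1).2 ?_
    have : deltaK = fun k : ℕ => (1 / 3 : ℝ) ^ k := by
      funext k
      rw [deltaK, one_div_pow]
    rw [this]
    exact tendsto_pow_atTop_nhds_zero_of_lt_one (by norm_num) (by norm_num)
  set C₁ := (1 + T.H * ((Fintype.card S : ℝ) * Fintype.card A)) * (128 * T.H / w)
  set C₂ := (T.H : ℝ) ^ 2 * 16 / g ^ 2
  have hlim : Tendsto (fun k : ℕ => deltaK (k + 1)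
      + C₁ * Real.sqrt ((1 + 4 * Fintype.card S) * (1 / Real.sqrt (2 ^ (k + 1))))
      + C₂ * (1 / Real.sqrt (2 ^ (k + 1)))) atTop (𝓝 0) := by
    have h1 : Tendsto (fun k : ℕ => Real.sqrt
        ((1 + 4 * Fintype.card S) * (1 / Real.sqrt (2 ^ (k + 1))))) atTop (𝓝 0) := by
      have := (Real.continuous_sqrt.tendsto _).comp
        (hlim0.const_mul (1 + 4 * (Fintype.card S : ℝ)))
      rw [mul_zero, Real.sqrt_zero] at this
      exact this
    have := (hδlim.add (h1.const_mul C₁)).add (hlim0.const_mul C₂)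
    simpa using this
  have hrad : ∀ᶠ k : ℕ in atTop,
      (T.H : ℝ) ^ 2 * (16 * (1 / Real.sqrt (2 ^ (k + 1)))) < (g / 2) ^ 2 := by
    have := (hlim0.const_mul 16).const_mul ((T.H : ℝ) ^ 2)
    simp only [mul_zero] at this
    exact this.eventually_lt_const (by positivity)
  have hδev : ∀ᶠ k : ℕ in atTop, deltaK (k + 1) < T.δ / 10 :=
    hδlim.eventually_lt_const (by have := T.δ_pos; positivity)
  refine le_antisymm (ge_of_tendsto hlim ?_) measureReal_nonneg
  filter_upwards [hrad, hδev, eventually_ge_atTop 2] with k hk1 hk2 hk3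
  have hbud : exploreBudget T k + 1 < exploreBudget T (k + 1) := by
    have h1 := two_mul_exploreBudget_le T k
    have h2 := le_exploreBudget T k
    have : (2 : ℝ) ≤ k := by exact_mod_cast hk3
    linarith
  have hsub : {ω | ¬ Stops (beeGPI T tie) Z ω}
      ⊆ ({ω | ¬ ReliableRun T tie D Z (k + 1) ω}
        ∪ {ω | ∃ n d, beeMemory T tie Z n ω = .exploring (k + 1) d ∧ Reliable T D (k + 1) d ∧
          exploreBudget T (k + 1) - 1 < d.length + 1})
        ∪ {ω | ∃ n d π X, beeMemory T tie Z n ω = .exploiting (k + 1) d π X ∧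
          (T.μ₀ + g ≤ value T D π ∧ ¬ ExploitPass T (k + 1) (X ++ [totalReward T (Z n ω)]) ∧
          exploitBudget T (k + 1) - 1 < (X ++ [totalReward T (Z n ω)]).length)} := by
    intro ω hω
    have hfin : ∀ n a, beeMemory T tie Z n ω ≠ .finished a :=
      fun n a h => hω (stops_of_beeMemory_eq_finished h)
    by_cases hrel : ReliableRun T tie D Z (k + 1) ω
    swap
    · exact Or.inl (Or.inl hrel)
    · rcases timeout_of_not_finished hfin hk2 hbud with ⟨n, d, hs, hd⟩ | ⟨n, d, π, X, hs, h1, h2⟩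
      · have := (hrel n).1
        rw [hs] at this
        exact Or.inl (Or.inr ⟨n, d, hs, this, hd⟩)
      · have h3 := (hrel n).1
        have hinv := beeInv_beeMemory T tie Z n ω
        rw [hs] at h3 hinv
        refine Or.inr ⟨n, d, π, X, hs, ?_, h1, h2⟩
        rw [hinv.2.1]
        exact hgap (k + 1) d h3 hinv.1
  refine (measureReal_mono hsub).trans ((measureReal_union_le _ _).trans ?_)
  refine add_le_add ((measureReal_union_le _ _).trans (add_le_add ?_ ?_)) ?_
  · exact measureReal_not_reliable_le hrun (k + 1)
  · exact (measureReal_explore_timeout_le hrun k hw (hwidth (k + 1)) hbud).trans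
      (explore_timeout_bound_le T hw hk3)
  · refine (measureReal_exploit_timeout_le hrun (k + 1) hg ?_ ?_).trans
      (exploit_timeout_bound_le T hg (by omega))
    · refine le_trans ?_ (le_exploitBudget T (k + 1)).2.1
      calc (2 : ℝ) = 2 ^ 1 := by norm_num
        _ ≤ 2 ^ (k + 1) := pow_le_pow_right₀ (by norm_num) (by omega)
    · intro N hN
      exact Real.sqrt_le_iff.2 ⟨by positivity,
        (exploit_radius_le T (by omega) hN).trans hk1.le⟩

end Stops

/-! ### Correctness of the output -/

section Correctness

variable {S : Type u} {A : Type v} [Fintype S] [Fintype A] [Nonempty S] [Nonempty A]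
  {Ω : Type w} {T : Task S A} {tie : ArgmaxRule S A T.H} {D : Dynamics S A T.H}

theorem negCrit_of_explore_eq_finished {k : ℕ} {d : List (Episode S A T.H)}
    {ans : Option (Policy S A T.H)} (h : explore T tie k d = .finished ans) :
    ans = none ∧ ∃ k', NegCrit T k' d ∧ deltaK k' < T.δ / 10 := by
  obtain ⟨k', -, -, ⟨h', -⟩ | ⟨h', -⟩ | ⟨h', h1⟩⟩ := explore_cases T tie k d <;> rw [h'] at h
  · simp at h
  · simp at h
  · simp only [BEEState.finished.injEq] at h
    exact ⟨h.symm, k', h1⟩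

theorem not_reliableRun_of_outputs_none {Z : ℕ → Ω → Episode S A T.H} {ω : Ω}
    (hD : T.μ₀ ≤ optValue T D) (h : Outputs (beeGPI T tie) Z ω none) :
    ∃ k, deltaK k < T.δ / 10 ∧ ¬ ReliableRun T tie D Z k ω := by
  have hneg : ∀ k d, Reliable T D k d → ¬ NegCrit T k d := fun k d hrel hN => by
    have := optValue_le_optimisticV0 hrel
    have : optimisticV0 T d (deltaK k) < T.μ₀ := hN
    linarith
  rcases exists_beeMemory_of_outputs h with h0 | ⟨n, hfin, hn⟩
  · obtain ⟨-, k, hN, -⟩ := negCrit_of_explore_eq_finished h0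
    exact absurd hN (hneg k [] (reliable_nil T D k))
  · rcases hs : beeMemory T tie Z n ω with ⟨j, d⟩ | ⟨j, d, π, X⟩ | ans
    · rw [hs, update] at hn
      obtain ⟨-, k, hN, hk⟩ := negCrit_of_explore_eq_finished hn
      exact ⟨k, hk, fun hrel => hneg k _ ((hrel n).2 j d hs) hN⟩
    · rw [hs, update] at hn
      split_ifs at hn
      · simp at hn
      · obtain ⟨-, k, hN, hk⟩ := negCrit_of_explore_eq_finished hn
        refine ⟨k, hk, fun hrel => hneg k d ?_ hN⟩
        have := (hrel n).1
        rw [hs] at this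
        exact this
    · exact absurd hs (hfin ans)

theorem exploitPass_of_outputs_some {Z : ℕ → Ω → Episode S A T.H} {ω : Ω}
    {π : Policy S A T.H} (h : Outputs (beeGPI T tie) Z ω (some π)) :
    ∃ n k d X, beeMemory T tie Z n ω = .exploiting k d π X ∧
      ExploitPass T k (X ++ [totalReward T (Z n ω)]) := by
  rcases exists_beeMemory_of_outputs h with h0 | ⟨n, hfin, hn⟩
  · exact absurd (negCrit_of_explore_eq_finished h0).1 (by simp)
  · rcases hs : beeMemory T tie Z n ω with ⟨j, d⟩ | ⟨j, d, π', X⟩ | ans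
    · rw [hs, update] at hn
      exact absurd (negCrit_of_explore_eq_finished hn).1 (by simp)
    · rw [hs, update] at hn
      split_ifs at hn with h1
      · simp only [BEEState.finished.injEq, Option.some.injEq] at hn
        subst hn
        exact ⟨n, j, d, X, hs, h1⟩
      · exact absurd (negCrit_of_explore_eq_finished hn).1 (by simp)
    · exact absurd hs (hfin ans)

theorem one_le_phase {Z : ℕ → Ω → Episode S A T.H} {ω : Ω} (n : ℕ)
    (h : ∀ a, beeMemory T tie Z n ω ≠ .finished a) : 1 ≤ (beeMemory T tie Z n ω).phase := by
  induction n with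
  | zero =>
    rw [beeMemory_zero] at h ⊢
    exact (phase_explore h).1
  | succ n ih =>
    have h' : ∀ a, beeMemory T tie Z n ω ≠ .finished a := by
      intro a ha
      refine h a ?_
      rw [beeMemory_succ, ha]
      rfl
    rw [beeMemory_succ] at h ⊢
    exact (ih h').trans (phase_progress_update (beeInv_beeMemory T tie Z n ω) h).1

theorem measureReal_wrong_none_le [MeasurableSpace Ω] {ℙ : Measure Ω} [IsProbabilityMeasure ℙ]
    {Z : ℕ → Ω → Episode S A T.H} (hrun : IsRun (beeGPI T tie) D ℙ Z)
    (hD : T.μ₀ ≤ optValue T D) :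
    ℙ.real {ω | Outputs (beeGPI T tie) Z ω none} ≤ T.δ / 2 := by
  classical
  have hδ := T.δ_pos
  have hpow : deltaK = fun k : ℕ => (1 / 3 : ℝ) ^ k := by
    funext k
    rw [deltaK, one_div_pow]
  have hex : ∃ k, deltaK k < T.δ / 10 := by
    rw [hpow]
    exact exists_pow_lt_of_lt_one (by positivity) (by norm_num)
  have hsub : {ω | Outputs (beeGPI T tie) Z ω none}
      ⊆ ⋃ i : ℕ, {ω | ¬ ReliableRun T tie D Z (i + Nat.find hex) ω} := by
    intro ω hω
    obtain ⟨k, hk, hrel⟩ := not_reliableRun_of_outputs_none hD hω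
    obtain ⟨i, rfl⟩ := Nat.exists_eq_add_of_le' (Nat.find_min' hex hk)
    exact Set.mem_iUnion.2 ⟨i, hrel⟩
  have hsum : HasSum (fun i => deltaK (i + Nat.find hex)) (3 / 2 * deltaK (Nat.find hex)) := by
    have := (hasSum_geometric_of_lt_one (r := (1 / 3 : ℝ)) (by norm_num) (by norm_num)).mul_right
      (deltaK (Nat.find hex))
    have e : (1 - 1 / 3 : ℝ)⁻¹ = 3 / 2 := by norm_num
    have e2 : (fun i => deltaK (i + Nat.find hex))
        = fun i => (1 / 3 : ℝ) ^ i * deltaK (Nat.find hex) := by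
      funext i
      simp only [hpow, pow_add]
    rw [e] at this
    rw [e2]
    exact this
  have := Nat.find_spec hex
  refine (measureReal_mono hsub).trans ((measureReal_iUnion_le_of_hasSum ℙ
    (fun i => measureReal_not_reliable_le hrun _) hsum).trans ?_)
  linarith

theorem measureReal_wrong_some_le [MeasurableSpace Ω] {ℙ : Measure Ω} [IsProbabilityMeasure ℙ]
    {Z : ℕ → Ω → Episode S A T.H} (hrun : IsRun (beeGPI T tie) D ℙ Z) :
    ℙ.real {ω | ∃ π, Outputs (beeGPI T tie) Z ω (some π) ∧ value T D π < T.μ₀} ≤ T.δ / 4 := by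
  have hδ := T.δ_pos
  have hsub : {ω | ∃ π, Outputs (beeGPI T tie) Z ω (some π) ∧ value T D π < T.μ₀}
      ⊆ ⋃ k : ℕ, {ω | ∃ n d π X, beeMemory T tie Z n ω = .exploiting (k + 1) d π X ∧
        value T D π < T.μ₀ ∧ ExploitPass T (k + 1) (X ++ [totalReward T (Z n ω)])} := by
    rintro ω ⟨π, hout, hv⟩
    obtain ⟨n, k, d, X, hs, hpass⟩ := exploitPass_of_outputs_some hout
    have hk := one_le_phase (T := T) (tie := tie) (Z := Z) (ω := ω) n (by rw [hs]; simp)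
    rw [hs] at hk
    obtain ⟨k, rfl⟩ := Nat.exists_eq_add_of_le' hk
    exact Set.mem_iUnion.2 ⟨k, n, d, π, X, hs, hv, hpass⟩
  have hsum : HasSum (fun k : ℕ => T.δ / alphaK (k + 1)) (T.δ / 4) := by
    have := (hasSum_geometric_of_lt_one (r := (1 / 5 : ℝ)) (by norm_num) (by norm_num)).mul_right
      (T.δ / 5)
    have e : (1 - 1 / 5 : ℝ)⁻¹ * (T.δ / 5) = T.δ / 4 := by ring
    rw [e] at this
    have e2 : (fun k : ℕ => T.δ / alphaK (k + 1)) = fun k : ℕ => (1 / 5 : ℝ) ^ k * (T.δ / 5) := by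
      funext k
      rw [alphaK, one_div_pow, pow_succ]
      field_simp
    rw [e2]
    exact this
  exact (measureReal_mono hsub).trans (measureReal_iUnion_le_of_hasSum ℙ
    (fun k => measureReal_wrong_exploitPass_le hrun (k + 1)) hsum)

/-- BEE-GPI terminates almost surely on positive and on negative instances. On a positive instance
of gap `Δ = V* - μ₀`, the positive criterion holds as soon as the width is below `Δ / 1.01`, and a
candidate has value at least `μ₀ + Δ / 101`. On a negative instance of gap `Δ = μ₀ - V*`, the
negative criterion holds as soon as the width is below `Δ`, and there is no candidate. -/
theorem measureReal_not_stops_of_gap [MeasurableSpace Ω] {ℙ : Measure Ω} [IsProbabilityMeasure ℙ]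
    {Z : ℕ → Ω → Episode S A T.H} (hrun : IsRun (beeGPI T tie) D ℙ Z)
    (hD : IsPositive T D ∨ IsNegative T D) :
    ℙ.real {ω | ¬ Stops (beeGPI T tie) Z ω} = 0 := by
  have hC : tuningC - 1 = 1 / 100 := by norm_num [tuningC]
  rcases hD with hD | hD
  · have hΔ : 0 < optValue T D - T.μ₀ := sub_pos.2 hD
    refine measureReal_not_stops_eq_zero hrun (w := (optValue T D - T.μ₀) / 2)
      (g := (optValue T D - T.μ₀) / 200) (by linarith) (by linarith) ?_ ?_
    · intro k d hrel hP _
      have h1 := optValue_le_optimisticV0 hrel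
      rw [PosCrit, hC, gt_iff_lt, not_lt] at hP
      linarith
    · intro k d hrel hP
      have h1 := optValue_le_optimisticV0 hrel
      have h2 := pessimisticV0_le_value hrel (optimisticPolicy T tie k d)
      rw [PosCrit, hC] at hP
      linarith
  · have hΔ : 0 < T.μ₀ - optValue T D := sub_pos.2 hD
    refine measureReal_not_stops_eq_zero hrun (w := T.μ₀ - optValue T D) (g := 1) hΔ one_pos ?_ ?_
    · intro k d hrel _ hN
      have h2 := pessimisticV0_le_value hrel (optimisticPolicy T tie k d)
      have h3 := value_le_optValue T D (optimisticPolicy T tie k d)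
      rw [NegCrit, not_lt] at hN
      linarith
    · intro k d hrel hP
      have h1 := optValue_le_optimisticV0 hrel
      have h2 := pessimisticV0_le_value hrel (optimisticPolicy T tie k d)
      have h3 := value_le_optValue T D (optimisticPolicy T tie k d)
      rw [PosCrit, hC] at hP
      linarith

theorem one_sub_le_measureReal [MeasurableSpace Ω] {ℙ : Measure Ω} [IsProbabilityMeasure ℙ]
    {E F : Set Ω} {x : ℝ} (h : Eᶜ ⊆ F) (hF : ℙ.real F ≤ x) : 1 - x ≤ ℙ.real E := by
  have h1 : ℙ.real (E ∪ Eᶜ) ≤ ℙ.real E + ℙ.real Eᶜ := measureReal_union_le _ _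
  rw [Set.union_compl_self, probReal_univ] at h1
  have h2 : ℙ.real Eᶜ ≤ ℙ.real F := measureReal_mono h
  linarith

end Correctness

end GPI

theorem theorem1 {S : Type u} {A : Type v} [Fintype S] [Fintype A] [Nonempty S] [Nonempty A]
    (tie : (T : GPI.Task S A) → GPI.ArgmaxRule S A T.H) :
    GPI.IsDeltaPAC.{u, v, w} (fun T : GPI.Task S A => GPI.beeGPI T (tie T)) ∧
      ∀ (T : GPI.Task S A) (D : GPI.Dynamics S A T.H) (Ω : Type w) [MeasurableSpace Ω]
        (ℙ : Measure Ω) [IsProbabilityMeasure ℙ] (Z : ℕ → Ω → GPI.Episode S A T.H),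
        GPI.IsRun (GPI.beeGPI T (tie T)) D ℙ Z →
        GPI.IsPositive T D ∨ GPI.IsNegative T D →
          ∀ᵐ ω ∂ℙ, GPI.Stops (GPI.beeGPI T (tie T)) Z ω := by
  refine ⟨fun T D Ω _ ℙ _ Z hrun => ⟨fun hpos => ?_, fun hneg => ?_⟩,
    fun T D Ω _ ℙ _ Z hrun hD => ?_⟩
  · have h0 := GPI.measureReal_not_stops_of_gap hrun (Or.inl hpos)
    have h1 := GPI.measureReal_wrong_none_le hrun (le_of_lt hpos)
    have h2 := GPI.measureReal_wrong_some_le hrun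
    have hδ := T.δ_pos
    refine GPI.one_sub_le_measureReal (F := ({ω | ¬ GPI.Stops (GPI.beeGPI T (tie T)) Z ω}
      ∪ {ω | GPI.Outputs (GPI.beeGPI T (tie T)) Z ω none})
      ∪ {ω | ∃ π, GPI.Outputs (GPI.beeGPI T (tie T)) Z ω (some π) ∧ GPI.value T D π < T.μ₀}) ?_
      ((measureReal_union_le _ _).trans
        ((add_le_add_left (measureReal_union_le _ _) _).trans (by linarith)))
    intro ω hω
    by_cases hs : GPI.Stops (GPI.beeGPI T (tie T)) Z ω
    · obtain ⟨_ | π, hout⟩ := hs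
      · exact Or.inl (Or.inr hout)
      · exact Or.inr ⟨π, hout, not_le.1 fun hle => hω ⟨π, hout, hle⟩⟩
    · exact Or.inl (Or.inl hs)
  · have h0 := GPI.measureReal_not_stops_of_gap hrun (Or.inr hneg)
    have h2 := GPI.measureReal_wrong_some_le hrun
    have hδ := T.δ_pos
    refine GPI.one_sub_le_measureReal (F := {ω | ¬ GPI.Stops (GPI.beeGPI T (tie T)) Z ω}
      ∪ {ω | ∃ π, GPI.Outputs (GPI.beeGPI T (tie T)) Z ω (some π) ∧ GPI.value T D π < T.μ₀}) ?_
      ((measureReal_union_le _ _).trans (by linarith))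
    intro ω hω
    by_cases hs : GPI.Stops (GPI.beeGPI T (tie T)) Z ω
    · obtain ⟨_ | π, hout⟩ := hs
      · exact absurd hout hω
      · exact Or.inr ⟨π, hout, (GPI.value_le_optValue T D π).trans_lt hneg⟩
    · exact Or.inl hs
  · have h0 := GPI.measureReal_not_stops_of_gap hrun hD
    rw [ae_iff]
    exact (measureReal_eq_zero_iff).1 h0
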